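/- **Setting.** Let $d\ge 2$, let $f$ be a probability density on $\mathbb{R}^d$, $X\sim f$, and let $\mathbb{S}$ be a collection of subsets of $[d]=\{1,\dots,d\}$ with $[d]\notin\mathbb{S}$. For $S\subseteq[d]$ write $x_S=(x_j)_{j\in S}$, $f_S$ for the density of $X_S$, and $\|\cdot\|_\infty$ for the sup norm on $\mathbb{R}^d$ and $\mathbb{R}^S$. For $S\in\mathbb{S}$ let $r_S:\mathbb{R}^S\to(0,\infty)$, $\bar r_S=r_S/\int r_Sf_S$ and $\lambda_S\in(0,\infty)$, and fix a version $x_S\mapsto\mathcal{L}(X_{S^c}\mid X_S=x_S)$, $x_S\in\mathbb{R}^S$, of the conditional distribution, which defines all conditional expectations given $X_S=x_S$ below. Let $a:\mathbb{R}^d\to\mathbb{R}$ be bounded, with $\|a\|_\infty=\sup|a|$. **Target.** For $m\in\mathbb{N}$ let $\mathbb{S}^{(m)}=\{(S_1,\dots,S_m)\in\mathbb{S}^m: S_{j+1}\ne S_j \text{ for } 1\le j<m\}$. Starting from $\bar a^{(0)}=a$, define for $\mathbf{S}=(S_1,\dots,S_m)$ and $S\in\mathbb{S}$ (with $S\neq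 S_m$ if $m\ge1$) $$\bar a^{(m+1)}_{(\mathbf{S},S)}(x)=\frac{\lambda_S\bar r_S(x_S)}{1+\lambda_S\bar r_S(x_S)}\,\mathbb{E}\{\bar a^{(m)}_{\mathbf{S}}(X)-\bar\theta^{(m+1)}_{(\mathbf{S},S)}\mid X_S=x_S\},\qquad \bar\theta^{(m+1)}_{(\mathbf{S},S)}=\frac{\int\frac{\lambda_S\bar r_S}{1+\lambda_S\bar r_S}\bar a^{(m)}_{\mathbf{S}}f}{\int\frac{\lambda_S\bar r_S}{1+\lambda_S\bar r_S}f_S}.$$ For $M\in\mathbb{N}$ let $\eta=1/|\mathbb{S}|$, $b_{M,\eta}(m)=\mathbb{P}(\mathrm{Bin}(M,\eta)\ge m)$ and $$\alpha_S^{(M)}=\sum_{m=1}^M(-1)^{m-1}\sum_{\mathbf{S}\in\mathbb{S}^{(m)}:\,S_m=S}b_{M,\eta}(m)\,\bar a^{(m)}_{\mathbf{S}},$$ a function of $x_S$ only. **Estimator.** Let $n\ge1$ and $X_1,\dots,X_n\overset{\text{i.i.d.}}{\sim}f$. Partition the first half $X_1,\dots,X_{\lceil n/2\rceil}$ of the sample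 into $M$ pieces $\mathcal{D}_{1},\dots,\mathcal{D}_{M}$ whose sizes differ by at most one. Let $T\ge1$, $h\in(0,1)$, $B_T=\{x:\|x\|_\infty\le T\}$, $K(z)=2^{-d}\mathbb{1}\{\|z\|_\infty\le1\}$, $K^S(u_S)=\int_{\mathbb{R}^{S^c}}K(u_S,v)\,dv$ and $K^S_h(u_S)=h^{-|S|}K^S(u_S/h)$. Put $\hat r_S^{(m)}=|\mathcal{D}_m|^{-1}\sum_{y\in\mathcal{D}_m}r_S(y_S)$, $\hat f_S^{(m)}(x_S)=|\mathcal{D}_m|^{-1}\sum_{y\in\mathcal{D}_m}K_h^S(x_S-y_S)$ and $\hat w_S^{(m)}(x_S)=\lambda_Sr_S(x_S)/\{\hat r_S^{(m)}+\lambda_Sr_S(x_S)\}$. Starting from $\hat a^{(0)}=a$, set, when $\|x_S\|_\infty\le T$, $$\hat a^{(m+1)}_{(\mathbf{S},S)}(x_S)=\hat w_S^{(m+1)}(x_S)\Bigl\{\frac{1}{|\mathcal{D}_{m+1}|}\sum_{y\in\mathcal{D}_{m+1}}\hat a^{(m)}_{\mathbf{S}}(y)\mathbb{1}_{B_T}(y)\frac{K_h^S(x_S-y_S)}{\hat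 f_S^{(m+1)}(x_S)}-\frac{\sum_{y\in\mathcal{D}_{m+1}}\hat w_S^{(m+1)}(y_S)\,\hat a^{(m)}_{\mathbf{S}}(y)\mathbb{1}_{B_T}(y)}{\sum_{y\in\mathcal{D}_{m+1}}\hat w_S^{(m+1)}(y_S)}\Bigr\},$$ and $\hat a^{(m+1)}_{(\mathbf{S},S)}(x_S)=0$ otherwise; here any quotient with zero denominator (which can occur only where $\hat f_S^{(m+1)}(x_S)=0$ or $\mathcal{D}_{m+1}=\emptyset$) is read as $0$. Finally let $\hat\alpha^{(M)}_{S,(1)}(x_S)=\sum_{m=1}^M(-1)^{m-1}\sum_{\mathbf{S}\in\mathbb{S}^{(m)}:\,S_m=S}b_{M,\eta}(m)\hat a^{(m)}_{\mathbf{S}}(x_S)$ when $\|x_S\|_\infty\le T$, and $0$ otherwise. **Proposition 7.** Let $\beta_1,\beta_2,\beta_3\in(0,1]$, $L_1,L_2,L_3\in(0,\infty)$ and $0<c\le C<\infty$, and suppose that - (A1) $|a(x)-a(x')|\le L_1\|x-x'\|_\infty^{\beta_1}$ for all $x,x'\in\mathbb{R}^d$ with $\|x-x'\|_\infty\le1$;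 - (A2) $d_{\mathrm{TV}}\bigl(\mathcal{L}(X_{S^c}\mid X_S=x_S),\mathcal{L}(X_{S^c}\mid X_S=x_S')\bigr)\le L_2\|x_S-x_S'\|_\infty^{\beta_2}$ for all $S\in\mathbb{S}$ and $x_S,x_S'\in\mathbb{R}^S$ with $\|x_S-x_S'\|_\infty\le1$, where $d_{\mathrm{TV}}=\frac12\int|p-q|$ for densities $p,q$ with respect to a common dominating measure; - (A3) $|\bar r_S(x_S)-\bar r_S(x_S')|\le L_3\|x_S-x_S'\|_\infty^{\beta_3}$ for all $S\in\mathbb{S}$ and $x_S,x_S'\in\mathbb{R}^S$ with $\|x_S-x_S'\|_\infty\le1$; - $c\le\bar r_S(x_S)\le C$ for all $S\in\mathbb{S}$ and $x_S\in\mathbb{R}^S$. Then for every $M\in\mathbb{N}=\{1,2,\dots\}$ and $S\in\mathbb{S}$, $$\mathbb{E}\Bigl\{\int(\hat\alpha^{(M)}_{S,(1)}-\alpha^{(M)}_S)^2f_S\Bigr\}\le A^MB\Bigl\{\frac Mn\Bigl(\frac Th\Bigr)^d+h^{2\beta_\wedge}+\mathbb{P}(\|X\|_\infty\ge T)\Bigr\},$$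 where $\beta_\wedge=\min(\beta_1,\beta_2,\beta_3)$, $A=28(C/c+2^d)$ and $B=16\max(\|a\|_\infty^2,1)\max\{(C/c)^2,(L_1+L_2+L_3)^2,8^d\}$. -/

import Mathlib

open MeasureTheory ProbabilityTheory
open scoped ENNReal

namespace IncompleteData

noncomputable section

variable {d n : ℕ}

/-- `ℝ^d`; its norm is the sup norm `‖x‖_∞`, and so is the norm of `S → ℝ`, i.e. of `ℝ^S`. -/
abbrev Pt (d : ℕ) : Type := Fin d → ℝ

/-- `f` is a probability density on `ℝ^d`. -/
structure IsDensity (f : Pt d → ℝ) : Prop where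
  measurable : Measurable f
  nonneg : ∀ x, 0 ≤ f x
  lintegral_eq_one : ∫⁻ x, ENNReal.ofReal (f x) = 1

/-- The distribution with density `f`. -/
def law (f : Pt d → ℝ) : Measure (Pt d) :=
  volume.withDensity fun x => ENNReal.ofReal (f x)

/-- The point of `ℝ^d` with coordinates `u` in `S` and `v` in the complement of `S`. -/
def glue (S : Finset (Fin d)) (u : S → ℝ) (v : ↥Sᶜ → ℝ) : Pt d := fun j =>
  if hj : j ∈ S then u ⟨j, hj⟩ else v ⟨j, Finset.mem_compl.2 hj⟩

/-- `κ` is a version of the conditional distribution of `X_{S^c}` given `X_S`, for `X ∼ f`: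
a Markov kernel that disintegrates the law of `(X_S, X_{S^c})`. -/
def IsCondLaw (f : Pt d → ℝ) (S : Finset (Fin d)) (κ : Kernel (S → ℝ) (↥Sᶜ → ℝ)) : Prop :=
  IsMarkovKernel κ ∧
    ((law f).map fun x => (S.restrict x, Sᶜ.restrict x)).IsCondKernel κ

/-- Total variation distance `(1/2) ∫ |p - q|`, where `p`, `q` are the densities of `P`, `Q` with
respect to the dominating measure `P + Q`. -/
def tvDist {E : Type*} [MeasurableSpace E] (P Q : Measure E) : ℝ :=
  2⁻¹ * ∫ z, |(P.rnDeriv (P + Q) z).toReal - (Q.rnDeriv (P + Q) z).toReal| ∂(P + Q)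

/-- The normalised shift `r̄_S = r_S / ∫ r_S f`. -/
def rBar (f : Pt d → ℝ) (S : Finset (Fin d)) (r : (S → ℝ) → ℝ) (u : S → ℝ) : ℝ :=
  r u / ∫ x, r (S.restrict x) ∂(law f)

/-! ### Population quantities -/

/-- The population weight `λ_S r̄_S(x_S) / (1 + λ_S r̄_S(x_S))`. -/
def wBar (f : Pt d → ℝ) (S : Finset (Fin d)) (r : (S → ℝ) → ℝ) (lam : ℝ) (x : Pt d) : ℝ :=
  lam * rBar f S r (S.restrict x) / (1 + lam * rBar f S r (S.restrict x))

/-- The centring constant `∫ w g f / ∫ w f` for the population weight `w`. -/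
def thetaBar (f : Pt d → ℝ) (S : Finset (Fin d)) (r : (S → ℝ) → ℝ) (lam : ℝ)
    (g : Pt d → ℝ) : ℝ :=
  (∫ x, wBar f S r lam x * g x ∂(law f)) / ∫ x, wBar f S r lam x ∂(law f)

/-- One population step: `x ↦ w(x_S) 𝔼{g(X) - θ̄ | X_S = x_S}`. -/
def stepBar (f : Pt d → ℝ) (S : Finset (Fin d)) (r : (S → ℝ) → ℝ) (lam : ℝ)
    (κ : Kernel (S → ℝ) (↥Sᶜ → ℝ)) (g : Pt d → ℝ) (x : Pt d) : ℝ :=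
  wBar f S r lam x *
    ∫ v, (g (glue S (S.restrict x) v) - thetaBar f S r lam g) ∂(κ (S.restrict x))

/-- `ā_Ss^{(m)}` for `Ss = (S_1, …, S_m)`, started at `ā^{(0)} = a`. -/
def aBar (f : Pt d → ℝ) (r : ∀ S : Finset (Fin d), (S → ℝ) → ℝ) (lam : Finset (Fin d) → ℝ)
    (κ : ∀ S : Finset (Fin d), Kernel (S → ℝ) (↥Sᶜ → ℝ)) (a : Pt d → ℝ) :
    (m : ℕ) → (Fin m → Finset (Fin d)) → Pt d → ℝ
  | 0, _ => a
  | m + 1, Ss =>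
      let S := Ss (Fin.last m)
      stepBar f S (r S) (lam S) (κ S) (aBar f r lam κ a m fun j => Ss j.castSucc)

/-- The sequences `Ss ∈ 𝕊^{(m+1)}` (consecutive entries distinct) whose last entry is `S`. -/
def paths (𝕊 : Finset (Finset (Fin d))) (m : ℕ) (S : Finset (Fin d)) :
    Finset (Fin (m + 1) → Finset (Fin d)) :=
  (Fintype.piFinset fun _ => 𝕊).filter fun Ss =>
    (∀ j : Fin m, Ss j.succ ≠ Ss j.castSucc) ∧ Ss (Fin.last m) = S

/-- `b_{M,η}(m) = ℙ(Bin(M, η) ≥ m)`. -/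
def binTail (M : ℕ) (η : ℝ) (m : ℕ) : ℝ :=
  ∑ j ∈ Finset.Icc m M, (M.choose j : ℝ) * η ^ j * (1 - η) ^ (M - j)

/-- `α_S^{(M,η)} = ∑_{m=1}^M (-1)^{m-1} ∑_{Ss ∈ 𝕊^{(m)}, S_m = S} b_{M,η}(m) ā_Ss^{(m)}`; the index
of summation below is `m - 1`. It is a function of `x_S` only. -/
def alpha (𝕊 : Finset (Finset (Fin d))) (f : Pt d → ℝ)
    (r : ∀ S : Finset (Fin d), (S → ℝ) → ℝ) (lam : Finset (Fin d) → ℝ)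
    (κ : ∀ S : Finset (Fin d), Kernel (S → ℝ) (↥Sᶜ → ℝ)) (a : Pt d → ℝ) (η : ℝ) (M : ℕ)
    (S : Finset (Fin d)) (x : Pt d) : ℝ :=
  ∑ m ∈ Finset.range M, (-1) ^ m *
    ∑ Ss ∈ paths 𝕊 m S, binTail M η (m + 1) * aBar f r lam κ a (m + 1) Ss x

/-! ### The estimator -/

/-- `D 1, …, D M` index a partition of the first half `X_1, …, X_{⌈n/2⌉}` of the sample into `M`
pieces whose sizes differ by at most one (indices of the sample start at `0`, and
`(n + 1) / 2 = ⌈n/2⌉`). -/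
structure IsSplit (n M : ℕ) (D : ℕ → Finset (Fin n)) : Prop where
  disjoint : ∀ m ∈ Finset.Icc 1 M, ∀ m' ∈ Finset.Icc 1 M, m ≠ m' → Disjoint (D m) (D m')
  union : (Finset.Icc 1 M).biUnion D = Finset.univ.filter fun i : Fin n => (i : ℕ) < (n + 1) / 2
  balanced : ∀ m ∈ Finset.Icc 1 M, ∀ m' ∈ Finset.Icc 1 M, (D m).card ≤ (D m').card + 1

open Classical in
/-- The uniform kernel `K(z) = 2^{-d} 1{‖z‖_∞ ≤ 1}`. -/
def unifKernel (z : Pt d) : ℝ := if ‖z‖ ≤ 1 then ((2 : ℝ) ^ d)⁻¹ else 0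

/-- `K^S(u) = ∫ K(u, v) dv`. -/
def margKernel (S : Finset (Fin d)) (u : S → ℝ) : ℝ :=
  ∫ v : ↥Sᶜ → ℝ, unifKernel (glue S u v)

/-- `K_h^S(u) = h^{-|S|} K^S(u / h)`. -/
def scaledKernel (S : Finset (Fin d)) (h : ℝ) (u : S → ℝ) : ℝ :=
  (h ^ S.card)⁻¹ * margKernel S (h⁻¹ • u)

/-- `r̂_S`, the average of `r_S` over the piece `D` of the sample `z`. -/
def rHat (S : Finset (Fin d)) (r : (S → ℝ) → ℝ) (D : Finset (Fin n)) (z : Fin n → Pt d) : ℝ :=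
  (D.card : ℝ)⁻¹ * ∑ i ∈ D, r (S.restrict (z i))

/-- `f̂_S`, the kernel density estimator from the piece `D` of the sample `z`. -/
def fHat (S : Finset (Fin d)) (h : ℝ) (D : Finset (Fin n)) (z : Fin n → Pt d) (u : S → ℝ) : ℝ :=
  (D.card : ℝ)⁻¹ * ∑ i ∈ D, scaledKernel S h (u - S.restrict (z i))

/-- The empirical weight `λ_S r_S(x_S) / (r̂_S + λ_S r_S(x_S))`. -/
def wHat (S : Finset (Fin d)) (r : (S → ℝ) → ℝ) (lam : ℝ) (D : Finset (Fin n))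
    (z : Fin n → Pt d) (x : Pt d) : ℝ :=
  lam * r (S.restrict x) / (rHat S r D z + lam * r (S.restrict x))

open Classical in
/-- `g 1_{B_T}` with `B_T = {‖y‖_∞ ≤ T}`. -/
def trunc (T : ℝ) (g : Pt d → ℝ) (y : Pt d) : ℝ := if ‖y‖ ≤ T then g y else 0

open Classical in
/-- One regression step on the piece `D` of the sample `z`, applied to `g`. Quotients `0 / 0`
are `0`, as they are for the division of the reals here. -/
def stepHat (S : Finset (Fin d)) (r : (S → ℝ) → ℝ) (lam T h : ℝ) (D : Finset (Fin n))
    (z : Fin n → Pt d) (g : Pt d → ℝ) (x : Pt d) : ℝ :=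
  if ‖S.restrict x‖ ≤ T then
    wHat S r lam D z x *
      ((D.card : ℝ)⁻¹ * ∑ i ∈ D, trunc T g (z i) *
          (scaledKernel S h (S.restrict x - S.restrict (z i)) / fHat S h D z (S.restrict x))
        - (∑ i ∈ D, wHat S r lam D z (z i) * trunc T g (z i)) / ∑ i ∈ D, wHat S r lam D z (z i))
  else 0

/-- `â_Ss^{(m)}`, started at `â^{(0)} = a`; step `m + 1` uses the piece `D (m + 1)`. -/
def aHat (r : ∀ S : Finset (Fin d), (S → ℝ) → ℝ) (lam : Finset (Fin d) → ℝ) (T h : ℝ)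
    (D : ℕ → Finset (Fin n)) (z : Fin n → Pt d) (a : Pt d → ℝ) :
    (m : ℕ) → (Fin m → Finset (Fin d)) → Pt d → ℝ
  | 0, _ => a
  | m + 1, Ss =>
      let S := Ss (Fin.last m)
      stepHat S (r S) (lam S) T h (D (m + 1)) z
        (aHat r lam T h D z a m fun j => Ss j.castSucc)

open Classical in
/-- The estimator `α̂_{S,(1)}^{(M)}` of `α_S^{(M,η)}`, computed from the sample `z`. -/
def alphaHat (𝕊 : Finset (Finset (Fin d))) (r : ∀ S : Finset (Fin d), (S → ℝ) → ℝ)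
    (lam : Finset (Fin d) → ℝ) (T h : ℝ) (D : ℕ → Finset (Fin n)) (z : Fin n → Pt d)
    (a : Pt d → ℝ) (η : ℝ) (M : ℕ) (S : Finset (Fin d)) (x : Pt d) : ℝ :=
  if ‖S.restrict x‖ ≤ T then
    ∑ m ∈ Finset.range M, (-1) ^ m *
      ∑ Ss ∈ paths 𝕊 m S, binTail M η (m + 1) * aHat r lam T h D z a (m + 1) Ss x
  else 0

/-! ### Smoothness assumptions -/

/-- (A1): local Hölder smoothness of `a`. -/
def A1 (a : Pt d → ℝ) (β L : ℝ) : Prop :=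
  ∀ x x' : Pt d, ‖x - x'‖ ≤ 1 → |a x - a x'| ≤ L * ‖x - x'‖ ^ β

/-- (A2): local Hölder smoothness in total variation of the conditional distributions. -/
def A2 (𝕊 : Finset (Finset (Fin d)))
    (κ : ∀ S : Finset (Fin d), Kernel (S → ℝ) (↥Sᶜ → ℝ)) (β L : ℝ) : Prop :=
  ∀ S ∈ 𝕊, ∀ u u' : S → ℝ, ‖u - u'‖ ≤ 1 → tvDist (κ S u) (κ S u') ≤ L * ‖u - u'‖ ^ β

/-- (A3): local Hölder smoothness of the normalised shifts. -/
def A3 (𝕊 : Finset (Finset (Fin d))) (f : Pt d → ℝ)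
    (r : ∀ S : Finset (Fin d), (S → ℝ) → ℝ) (β L : ℝ) : Prop :=
  ∀ S ∈ 𝕊, ∀ u u' : S → ℝ, ‖u - u'‖ ≤ 1 →
    |rBar f S (r S) u - rBar f S (r S) u'| ≤ L * ‖u - u'‖ ^ β

end

end IncompleteData

open IncompleteData

/-!
Write `V` for the length of the range of `a` and `K = C / c + 2 ^ d`. Replacing `r` by `r̄` changes
no estimator, so one may assume that `r` takes values in `[c, C]` and has mean `1`.

The error of one regression step splits into four parts.
* The error of the previous step, averaged locally and globally. Exchanging the fresh point with a
  sample point shows that the local average inflates the mean square error by at most `2 ^ |S|`,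
  the number of orthants: two points in the same orthant around `x`, both within `h` of `x`, are
  within `h` of each other. The weighted mean inflates it by at most `C / c`.
* The fluctuation. The terms are conditionally centred, hence orthogonal, and the same exchange
  bounds the mean of the inverse neighbour count by the number of cells of side `h` covering the
  cube, divided by the sample size.
* The bias, of order `h ^ β`, since conditional means of Hölder functions under a kernel that is
  Hölder in total variation are Hölder.
* The tail outside the cube, charged to the next step through truncation.

The mean square errors along a path thus satisfy an affine recursion with factor of order `K`.
Cauchy–Schwarz against the binomial weights sums them over the paths, and the union bound
`ℙ(Bin(M, 1/|𝕊|) ≥ m) ≤ choose M m / |𝕊| ^ m` cancels the number of paths, so that the binomial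
theorem yields the factor `(28 K) ^ M`.
-/

namespace IncompleteData

noncomputable section

variable {d n : ℕ}

section WeightedAverage

variable {ι : Type*} (I : Finset ι) {p y : ι → ℝ} {lo hi : ℝ}

theorem sum_mul_div_sum_mem_Icc (hp : ∀ i ∈ I, 0 ≤ p i) (hy : ∀ i ∈ I, y i ∈ Set.Icc lo hi)
    (h0 : (0 : ℝ) ∈ Set.Icc lo hi) :
    (∑ i ∈ I, p i * y i) / ∑ i ∈ I, p i ∈ Set.Icc lo hi := by
  rcases (Finset.sum_nonneg hp).eq_or_lt with hsum | hsum
  · simpa [← hsum] using h0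
  · refine ⟨(le_div_iff₀ hsum).2 ?_, (div_le_iff₀ hsum).2 ?_⟩ <;>
      rw [mul_comm, Finset.sum_mul] <;> refine Finset.sum_le_sum fun i hi => ?_
    · exact mul_le_mul_of_nonneg_left (hy i hi).1 (hp i hi)
    · exact mul_le_mul_of_nonneg_left (hy i hi).2 (hp i hi)

theorem sq_sum_mul_div_sum_le (y : ι → ℝ) (hp : ∀ i ∈ I, 0 ≤ p i) :
    ((∑ i ∈ I, p i * y i) / ∑ i ∈ I, p i) ^ 2 ≤ (∑ i ∈ I, p i * y i ^ 2) / ∑ i ∈ I, p i := by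
  rcases (Finset.sum_nonneg hp).eq_or_lt with hsum | hsum
  · simp [← hsum]
  · have cauchy_schwarz :
        (∑ i ∈ I, p i * y i) ^ 2 ≤ (∑ i ∈ I, p i) * ∑ i ∈ I, p i * y i ^ 2 :=
      Finset.sum_sq_le_sum_mul_sum_of_sq_le_mul I hp
        (fun i hi => mul_nonneg (hp i hi) (sq_nonneg _)) fun i _ => le_of_eq (by ring)
    rw [div_pow, div_le_div_iff₀ (pow_pos hsum 2) hsum]
    nlinarith

end WeightedAverage

theorem sum_inv_sum_le_card_of_coloring {ι κ : Type*} {I J : Finset ι} (hIJ : I ⊆ J)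
    {ρ : ι → ι → ℝ} (hρ : ∀ i j, 0 ≤ ρ i j) {col : ι → κ} {K : Finset κ} (hK : ∀ i ∈ I, col i ∈ K)
    (hcol : ∀ i ∈ I, ∀ j ∈ I, col i = col j → 1 ≤ ρ i j) :
    ∑ i ∈ I, (∑ j ∈ J, ρ i j)⁻¹ ≤ K.card := by
  classical
  have color_class_le (k : κ) : ∑ i ∈ I with col i = k, (∑ j ∈ J, ρ i j)⁻¹ ≤ 1 := by
    set Q := I.filter fun i => col i = k with hQ
    rcases Q.eq_empty_or_nonempty with hempty | hne
    · simp [hempty]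
    have hpos : (0 : ℝ) < Q.card := by exact_mod_cast hne.card_pos
    have card_le_sum : ∀ i ∈ Q, (Q.card : ℝ) ≤ ∑ j ∈ J, ρ i j := fun i hi => by
      calc (Q.card : ℝ) = ∑ _j ∈ Q, (1 : ℝ) := by simp
        _ ≤ ∑ j ∈ Q, ρ i j := Finset.sum_le_sum fun j hj => by
            rw [hQ, Finset.mem_filter] at hi hj
            exact hcol i hi.1 j hj.1 (hi.2.trans hj.2.symm)
        _ ≤ ∑ j ∈ J, ρ i j := Finset.sum_le_sum_of_subset_of_nonneg
            ((Finset.filter_subset _ _).trans hIJ) fun j _ _ => hρ i j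
    calc ∑ i ∈ Q, (∑ j ∈ J, ρ i j)⁻¹ ≤ ∑ _i ∈ Q, (Q.card : ℝ)⁻¹ :=
          Finset.sum_le_sum fun i hi => inv_anti₀ hpos (card_le_sum i hi)
      _ = 1 := by simp [hpos.ne']
  rw [← Finset.sum_fiberwise_of_maps_to hK]
  calc _ ≤ ∑ _k ∈ K, (1 : ℝ) := Finset.sum_le_sum fun k _ => color_class_le k
    _ = K.card := by simp

theorem abs_sub_le_of_floor_add_div_eq {h s t c : ℝ} (hh : 0 < h)
    (hst : ⌊(s + c) / h⌋ = ⌊(t + c) / h⌋) : |s - t| ≤ h := by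
  have hlt := Int.abs_sub_lt_one_of_floor_eq_floor hst
  rw [← sub_div, add_sub_add_right_eq_sub, abs_div, abs_of_pos hh, div_lt_one hh] at hlt
  exact hlt.le

section Near

variable {E σ : Type*} [Fintype σ] (π : E → σ → ℝ) (h : ℝ)

open Classical in
/-- The indicator that the features `π x` and `π y` of two observations are at sup-distance at most
`h`; in the application `π` is the restriction of `x` to a pattern `S`. -/
def near (x y : E) : ℝ := if ‖π x - π y‖ ≤ h then 1 else 0

/-- The number of points `z i`, `i ∈ D`, that are near `x`, as a real number. -/
def nearCount {ι : Type*} (D : Finset ι) (z : ι → E) (x : E) : ℝ := ∑ i ∈ D, near π h x (z i)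

theorem near_eq_zero_or_one (x y : E) : near π h x y = 0 ∨ near π h x y = 1 := by
  unfold near; split_ifs <;> simp

theorem near_nonneg (x y : E) : 0 ≤ near π h x y := by
  rcases near_eq_zero_or_one π h x y with e | e <;> simp [e]

theorem near_sq (x y : E) : near π h x y ^ 2 = near π h x y := by
  rcases near_eq_zero_or_one π h x y with e | e <;> simp [e]

theorem near_comm (x y : E) : near π h x y = near π h y x := by
  simp only [near, norm_sub_rev]

variable {h} in
theorem near_self (hh : 0 ≤ h) (x : E) : near π h x x = 1 := by
  simp [near, hh]

variable {π} in
theorem near_congr_right (x : E) {y y' : E} (hy : π y = π y') : near π h x y = near π h x y' := by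
  simp [near, hy]

section NearCount

variable {ι : Type*} (D : Finset ι) (z : ι → E) (x : E)

theorem nearCount_nonneg : 0 ≤ nearCount π h D z x :=
  Finset.sum_nonneg fun _ _ => near_nonneg _ _ _ _

theorem nearCount_eq_zero_or_one_le : nearCount π h D z x = 0 ∨ 1 ≤ nearCount π h D z x := by
  by_cases hnear : ∃ i ∈ D, near π h x (z i) = 1
  · obtain ⟨i, hi, e⟩ := hnear
    exact .inr (e ▸ Finset.single_le_sum (f := fun i => near π h x (z i))
      (fun _ _ => near_nonneg _ _ _ _) hi)
  · push Not at hnear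
    exact .inl (Finset.sum_eq_zero fun i hi =>
      (near_eq_zero_or_one π h x (z i)).resolve_right (hnear i hi))

theorem sum_near_mul_inv_nearCount_le :
    ∑ i ∈ D, near π h x (z i) * (nearCount π h D z (z i))⁻¹ ≤ 2 ^ Fintype.card σ := by
  classical
  set I := D.filter fun i => ‖π x - π (z i)‖ ≤ h with hI
  -- Two neighbours of `x` in the same orthant around `x` are neighbours of each other.
  have same_orthant : ∀ i ∈ I, ∀ j ∈ I,
      (fun s => decide (π x s ≤ π (z i) s)) = (fun s => decide (π x s ≤ π (z j) s)) →
      1 ≤ near π h (z i) (z j) := by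
    intro i hi j hj horth
    have hxi : ‖π x - π (z i)‖ ≤ h := (Finset.mem_filter.1 hi).2
    have hxj : ‖π x - π (z j)‖ ≤ h := (Finset.mem_filter.1 hj).2
    have h0 : 0 ≤ h := (norm_nonneg _).trans hxi
    rw [pi_norm_le_iff_of_nonneg h0] at hxi hxj
    refine (if_pos ((pi_norm_le_iff_of_nonneg h0).2 fun s => ?_)).ge
    have hs := congrFun horth s
    have hi' := abs_le.1 (hxi s)
    have hj' := abs_le.1 (hxj s)
    simp only [decide_eq_decide, Pi.sub_apply] at hs hi' hj'
    rw [Pi.sub_apply, Real.norm_eq_abs, abs_le]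
    by_cases hle : π x s ≤ π (z i) s
    · have := hs.1 hle
      constructor <;> linarith
    · have := not_le.1 (mt hs.2 hle)
      constructor <;> linarith
  calc ∑ i ∈ D, near π h x (z i) * (nearCount π h D z (z i))⁻¹
      = ∑ i ∈ I, (∑ j ∈ D, near π h (z i) (z j))⁻¹ := by
        simp only [hI, Finset.sum_filter, near, nearCount, ite_mul, one_mul, zero_mul]
    _ ≤ (Finset.univ : Finset (σ → Bool)).card :=
        sum_inv_sum_le_card_of_coloring (Finset.filter_subset _ _)
          (fun i j => near_nonneg π h (z i) (z j)) (fun i _ => Finset.mem_univ _) same_orthant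
    _ = 2 ^ Fintype.card σ := by simp

theorem sum_sq_near_div_nearCount_le :
    ∑ i ∈ D, (near π h x (z i) / nearCount π h D z x) ^ 2 ≤ 2 * (1 + nearCount π h D z x)⁻¹ := by
  have sum_eq : ∑ i ∈ D, (near π h x (z i) / nearCount π h D z x) ^ 2
      = nearCount π h D z x / nearCount π h D z x ^ 2 := by
    simp_rw [div_pow, near_sq, ← Finset.sum_div]
    rfl
  rw [sum_eq]
  rcases nearCount_eq_zero_or_one_le π h D z x with hN | hN
  · simp [hN]
  · rw [← div_eq_mul_inv, div_le_div_iff₀ (by positivity) (by positivity)]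
    nlinarith

open Classical in
theorem sum_inv_nearCount_le_pow {h T : ℝ} (hh : 0 < h) (hhT : h ≤ T) :
    ∑ i ∈ D with ‖π (z i)‖ ≤ T, (nearCount π h D z (z i))⁻¹ ≤ (3 * (T / h)) ^ Fintype.card σ := by
  have hT : 0 ≤ T := hh.le.trans hhT
  have abs_le_T : ∀ i ∈ D.filter fun i => ‖π (z i)‖ ≤ T, ∀ s, |π (z i) s| ≤ T := fun i hi =>
    (pi_norm_le_iff_of_nonneg hT).1 (Finset.mem_filter.1 hi).2
  -- The cube of half-side `T` is cut into cells of side `h`; points of one cell are neighbours.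
  set cell : ι → σ → ℤ := fun i s => ⌊(π (z i) s + T) / h⌋
  set cells : Finset (σ → ℤ) := Fintype.piFinset fun _ => Finset.Icc 0 ⌊2 * T / h⌋
  have cell_mem : ∀ i ∈ D.filter fun i => ‖π (z i)‖ ≤ T, cell i ∈ cells := fun i hi =>
    Fintype.mem_piFinset.2 fun s => by
      have := abs_le.1 (abs_le_T i hi s)
      refine Finset.mem_Icc.2 ⟨Int.floor_nonneg.2 (div_nonneg (by linarith) hh.le), ?_⟩
      exact Int.floor_le_floor (by gcongr; linarith)
  have near_of_cell_eq : ∀ i ∈ D.filter fun i => ‖π (z i)‖ ≤ T,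
      ∀ j ∈ D.filter fun i => ‖π (z i)‖ ≤ T, cell i = cell j → 1 ≤ near π h (z i) (z j) :=
    fun i _ j _ hij => (if_pos ((pi_norm_le_iff_of_nonneg hh.le).2 fun s =>
      abs_sub_le_of_floor_add_div_eq hh (congrFun hij s))).ge
  have card_cells : (cells.card : ℝ) ≤ (3 * (T / h)) ^ Fintype.card σ := by
    have one_le : 1 ≤ T / h := (one_le_div hh).2 hhT
    have floor_le : (⌊2 * T / h⌋ : ℝ) ≤ 2 * (T / h) :=
      (Int.floor_le _).trans_eq (mul_div_assoc _ _ _)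
    have floor_nonneg : 0 ≤ ⌊2 * T / h⌋ := Int.floor_nonneg.2 (by positivity)
    have card_Icc : ((Finset.Icc 0 ⌊2 * T / h⌋).card : ℝ) = ⌊2 * T / h⌋ + 1 := by
      rw [Int.card_Icc, sub_zero]
      exact_mod_cast Int.toNat_of_nonneg (by omega)
    have card_eq : cells.card = (Finset.Icc 0 ⌊2 * T / h⌋).card ^ Fintype.card σ :=
      (Fintype.card_piFinset _).trans (by simp)
    rw [card_eq, Nat.cast_pow, card_Icc]
    have : (0 : ℝ) ≤ ⌊2 * T / h⌋ := by exact_mod_cast floor_nonneg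
    exact pow_le_pow_left₀ (by linarith) (by linarith) _
  exact (sum_inv_sum_le_card_of_coloring (Finset.filter_subset _ _)
    (fun i j => near_nonneg π h (z i) (z j)) cell_mem near_of_cell_eq).trans card_cells

end NearCount

section Measurable

variable {Ω : Type*} [MeasurableSpace Ω] [MeasurableSpace E] {π}

theorem measurable_near (hπ : Measurable π) {F G : Ω → E} (hF : Measurable F) (hG : Measurable G) :
    Measurable fun ω => near π h (F ω) (G ω) := by
  classical
  exact Measurable.ite
    (measurableSet_le ((hπ.comp hF).sub (hπ.comp hG)).norm measurable_const)
    measurable_const measurable_const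

theorem measurable_nearCount (hπ : Measurable π) {ι : Type*} (D : Finset ι) {F : Ω → E}
    {Z : Ω → ι → E} (hF : Measurable F) (hZ : Measurable Z) :
    Measurable fun ω => nearCount π h D (Z ω) (F ω) :=
  Finset.measurable_fun_sum _ fun i _ => measurable_near h hπ hF ((measurable_pi_apply i).comp hZ)

end Measurable

end Near

section Swap

variable {E : Type*} [MeasurableSpace E] (μ : Measure E)

/-- The joint distribution of a fresh observation and an i.i.d. sample of size `n`. -/
abbrev sampleLaw (n : ℕ) : Measure (E × (Fin n → E)) := μ.prod (Measure.pi fun _ => μ)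

theorem measurable_sample (i : Fin n) : Measurable fun p : E × (Fin n → E) => p.2 i :=
  (measurable_pi_apply i).comp measurable_snd

theorem measurable_update_sample (i : Fin n) :
    Measurable fun p : E × (Fin n → E) => Function.update p.2 i p.1 := by
  refine measurable_pi_iff.2 fun j => ?_
  obtain rfl | hij := eq_or_ne j i
  · simpa only [Function.update_self] using measurable_fst
  · simpa only [Function.update_of_ne hij] using measurable_sample j

theorem exists_measurableEquiv_swap [SigmaFinite μ] (i : Fin n) :
    ∃ e : (E × (Fin n → E)) ≃ᵐ (E × (Fin n → E)),
      (∀ p, e p = (p.2 i, Function.update p.2 i p.1)) ∧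
        MeasurePreserving e (sampleLaw μ n) (sampleLaw μ n) := by
  let cons := MeasurableEquiv.piFinSuccAbove (fun _ : Fin (n + 1) => E) 0
  let swap := MeasurableEquiv.piCongrLeft (fun _ : Fin (n + 1) => E) (Equiv.swap 0 i.succ)
  have cons_preserving := measurePreserving_piFinSuccAbove (n := n) (fun _ => μ) 0
  have swap_preserving :=
    measurePreserving_piCongrLeft (fun _ : Fin (n + 1) => μ) (Equiv.swap 0 i.succ)
  refine ⟨(cons.symm.trans swap).trans cons, fun p => ?_,
    (cons_preserving.comp swap_preserving).comp cons_preserving.symm⟩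
  have swap_apply (y : Fin (n + 1) → E) (b) : swap y b = y (Equiv.swap 0 i.succ b) := by
    conv_lhs => rw [← Equiv.swap_apply_self 0 i.succ b]
    exact Equiv.piCongrLeft_apply_apply (fun _ => E) _ _ _
  have cons_symm_apply : cons.symm p = Fin.cons p.1 p.2 := by
    simp [cons, MeasurableEquiv.piFinSuccAbove_symm_apply, Fin.insertNthEquiv]
  have cons_apply (y : Fin (n + 1) → E) : cons y = (y 0, fun j => y j.succ) := rfl
  simp only [MeasurableEquiv.trans_apply, cons_symm_apply, cons_apply, swap_apply,
    Equiv.swap_apply_left, Fin.cons_succ]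
  refine Prod.ext rfl (funext fun j => ?_)
  obtain rfl | hj := eq_or_ne j i
  · simp
  · have swap_succ : Equiv.swap 0 i.succ j.succ = j.succ :=
      Equiv.swap_apply_of_ne_of_ne (Fin.succ_ne_zero j) (by simpa using hj)
    simp [swap_succ, hj]

theorem lintegral_swap [SigmaFinite μ] (i : Fin n) (F : E → (Fin n → E) → ℝ≥0∞) :
    ∫⁻ p, F (p.2 i) (Function.update p.2 i p.1) ∂(sampleLaw μ n)
      = ∫⁻ p, F p.1 p.2 ∂(sampleLaw μ n) := by
  obtain ⟨e, he, he_preserving⟩ := exists_measurableEquiv_swap μ i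
  rw [← he_preserving.lintegral_comp_emb e.measurableEmbedding fun p => F p.1 p.2]
  simp only [he]

theorem measurePreserving_update_sample [IsProbabilityMeasure μ] (i : Fin n) :
    MeasurePreserving (fun p : E × (Fin n → E) => Function.update p.2 i p.1)
      (sampleLaw μ n) (Measure.pi fun _ => μ) := by
  obtain ⟨e, he, he_preserving⟩ := exists_measurableEquiv_swap μ i
  convert measurePreserving_snd.comp he_preserving using 1
  ext1 p
  simp [he]

theorem integrable_of_bound {Ω : Type*} [MeasurableSpace Ω] {ν : Measure Ω} [IsFiniteMeasure ν]
    {F : Ω → ℝ} (hF : Measurable F) {b : ℝ} (hb : ∀ ω, |F ω| ≤ b) : Integrable F ν :=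
  .of_bound hF.aestronglyMeasurable b (.of_forall hb)

theorem integral_resample [IsProbabilityMeasure μ] (i : Fin n) {F : (Fin n → E) → ℝ}
    (hF : Measurable F) {b : ℝ} (hb : ∀ z, |F z| ≤ b) :
    ∫ z, F z ∂(Measure.pi fun _ => μ)
      = ∫ z, ∫ y, F (Function.update z i y) ∂μ ∂(Measure.pi fun _ => μ) := by
  have hmp := measurePreserving_update_sample μ i
  rw [← hmp.map_eq, integral_map hmp.measurable.aemeasurable hF.aestronglyMeasurable,
    integral_prod_symm, hmp.map_eq]
  exact integrable_of_bound (hF.comp hmp.measurable) fun p => hb _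

variable {μ} [SigmaFinite μ] (D : Finset (Fin n))

theorem lintegral_sum_swap {F : Fin n → E → (Fin n → E) → ℝ≥0∞}
    (hF : ∀ i, Measurable fun p : E × (Fin n → E) => F i p.1 p.2) :
    ∫⁻ p, ∑ i ∈ D, F i (p.2 i) (Function.update p.2 i p.1) ∂(sampleLaw μ n)
      = ∫⁻ p, ∑ i ∈ D, F i p.1 p.2 ∂(sampleLaw μ n) := by
  have hF_swap (i) : Measurable fun p : E × (Fin n → E) =>
      F i (p.2 i) (Function.update p.2 i p.1) :=
    (hF i).comp ((measurable_sample i).prodMk (measurable_update_sample i))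
  rw [lintegral_finsetSum _ fun i _ => hF i, lintegral_finsetSum _ fun i _ => hF_swap i]
  exact Finset.sum_congr rfl fun i _ => lintegral_swap μ i (F i)

end Swap

section Orthogonality

theorem integral_sq_sum_of_orthogonal {Ω ι : Type*} [MeasurableSpace Ω] {ν : Measure Ω}
    (D : Finset ι) {Y : ι → Ω → ℝ} (hint : ∀ i j, Integrable (fun ω => Y i ω * Y j ω) ν)
    (horth : ∀ i j, i ≠ j → ∫ ω, Y i ω * Y j ω ∂ν = 0) :
    ∫ ω, (∑ i ∈ D, Y i ω) ^ 2 ∂ν = ∫ ω, ∑ i ∈ D, Y i ω ^ 2 ∂ν := by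
  simp_rw [sq, Finset.sum_mul_sum]
  rw [integral_finsetSum _ fun i _ => integrable_finsetSum _ fun j _ => hint i j,
    integral_finsetSum _ fun i _ => hint i i]
  refine Finset.sum_congr rfl fun i hi => ?_
  rw [integral_finsetSum _ fun j _ => hint i j]
  exact Finset.sum_eq_single_of_mem i hi fun j _ hji => horth i j hji.symm

variable {E F : Type*} [MeasurableSpace E] {μ : Measure E} {π : E → F} {ζ : E → ℝ} {B : ℝ}
  {q : Fin n → (Fin n → E) → ℝ}

/-- `ζ` has conditional mean zero given the feature `π`, in the weak form tested against bounded
measurable functions of `π`. -/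
def CondCentred (μ : Measure E) (π : E → F) (ζ : E → ℝ) : Prop :=
  ∀ φ : E → ℝ, Measurable φ → (∃ b, ∀ y, |φ y| ≤ b) → φ.FactorsThrough π → ∫ y, φ y * ζ y ∂μ = 0

theorem condCentred_const (hζ : ∫ y, ζ y ∂μ = 0) : CondCentred μ (fun _ => ()) ζ := by
  intro φ _ _ hφ
  rcases isEmpty_or_nonempty E with hE | ⟨⟨y₀⟩⟩
  · rw [Measure.eq_zero_of_isEmpty μ, integral_zero_measure]
  · calc ∫ y, φ y * ζ y ∂μ = ∫ y, φ y₀ * ζ y ∂μ :=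
          integral_congr_ae (.of_forall fun y => congrArg (· * ζ y) (hφ rfl))
      _ = 0 := by rw [integral_const_mul, hζ, mul_zero]

theorem abs_mul_le_of_le_one {s t b : ℝ} (hs : |s| ≤ 1) (ht : |t| ≤ b) : |s * t| ≤ b := by
  rw [abs_mul]
  exact (mul_le_of_le_one_left (abs_nonneg t) hs).trans ht

theorem integral_mul_eq_zero_of_condCentred [IsProbabilityMeasure μ] (hζm : Measurable ζ)
    (hζb : ∀ x, |ζ x| ≤ B) (hζ : CondCentred μ π ζ) (hqm : ∀ i, Measurable (q i))
    (hqb : ∀ i z, |q i z| ≤ 1)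
    (hq : ∀ i j z, (fun y => q i (Function.update z j y)).FactorsThrough π)
    {i j : Fin n} (hij : i ≠ j) :
    ∫ z, (q i z * ζ (z i)) * (q j z * ζ (z j)) ∂(Measure.pi fun _ => μ) = 0 := by
  have hm (k) : Measurable fun z : Fin n → E => q k z * ζ (z k) :=
    (hqm k).mul (hζm.comp (measurable_pi_apply k))
  have hb (k z) : |q k z * ζ (z k)| ≤ B := abs_mul_le_of_le_one (hqb k z) (hζb _)
  have hbb (z) : |q i z * ζ (z i) * (q j z * ζ (z j))| ≤ B * B := by
    rw [abs_mul]
    exact mul_le_mul (hb i z) (hb j z) (abs_nonneg _) ((abs_nonneg _).trans (hb i z))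
  rw [integral_resample μ i (F := fun z => q i z * ζ (z i) * (q j z * ζ (z j)))
    ((hm i).mul (hm j)) hbb]
  refine integral_eq_zero_of_ae (.of_forall fun z => ?_)
  -- Given all points but the `i`-th, the factor of `ζ (z i)` depends on that point through `π`.
  have hcentred := hζ
    (fun y => q i (Function.update z i y) * (q j (Function.update z i y) * ζ (z j)))
    (((hqm i).comp (measurable_update z)).mul (((hqm j).comp (measurable_update z)).mul_const _))
    ⟨B, fun y => abs_mul_le_of_le_one (hqb i _) (abs_mul_le_of_le_one (hqb j _) (hζb _))⟩
    fun y y' hy => by simp only [hq i i z hy, hq j i z hy]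
  rw [Pi.zero_apply, ← hcentred]
  refine integral_congr_ae (.of_forall fun y => ?_)
  simp only [Function.update_self, Function.update_of_ne hij.symm]
  ring

theorem lintegral_sq_sum_le_of_condCentred [IsProbabilityMeasure μ] (hζm : Measurable ζ)
    (hζb : ∀ x, |ζ x| ≤ B) (hζ : CondCentred μ π ζ) (hqm : ∀ i, Measurable (q i))
    (hqb : ∀ i z, |q i z| ≤ 1)
    (hq : ∀ i j z, (fun y => q i (Function.update z j y)).FactorsThrough π)
    (D : Finset (Fin n)) :
    ∫⁻ z, ENNReal.ofReal ((∑ i ∈ D, q i z * ζ (z i)) ^ 2) ∂(Measure.pi fun _ => μ)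
      ≤ ∫⁻ z, ENNReal.ofReal (B ^ 2 * ∑ i ∈ D, q i z ^ 2) ∂(Measure.pi fun _ => μ) := by
  have hm (k) : Measurable fun z : Fin n → E => q k z * ζ (z k) :=
    (hqm k).mul (hζm.comp (measurable_pi_apply k))
  have hb (k z) : |q k z * ζ (z k)| ≤ B := abs_mul_le_of_le_one (hqb k z) (hζb _)
  have hint (i j) : Integrable (fun z => (q i z * ζ (z i)) * (q j z * ζ (z j)))
      (Measure.pi fun _ => μ) :=
    integrable_of_bound ((hm i).mul (hm j)) (b := B * B) fun z => by
      rw [abs_mul]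
      exact mul_le_mul (hb i z) (hb j z) (abs_nonneg _) ((abs_nonneg _).trans (hb i z))
  have hsq_int : Integrable (fun z => ∑ i ∈ D, (q i z * ζ (z i)) ^ 2) (Measure.pi fun _ => μ) :=
    integrable_finsetSum _ fun i _ => (hint i i).congr (.of_forall fun z => (sq _).symm)
  have hsum_int : Integrable (fun z => (∑ i ∈ D, q i z * ζ (z i)) ^ 2) (Measure.pi fun _ => μ) := by
    simp_rw [sq, Finset.sum_mul_sum]
    exact integrable_finsetSum _ fun i _ => integrable_finsetSum _ fun j _ => hint i j
  rw [← ofReal_integral_eq_lintegral_ofReal hsum_int (.of_forall fun z => sq_nonneg _),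
    integral_sq_sum_of_orthogonal D hint fun i j hij =>
      integral_mul_eq_zero_of_condCentred hζm hζb hζ hqm hqb hq hij,
    ofReal_integral_eq_lintegral_ofReal hsq_int
      (.of_forall fun z => Finset.sum_nonneg fun i _ => sq_nonneg _)]
  refine lintegral_mono fun z => ENNReal.ofReal_le_ofReal ?_
  rw [Finset.mul_sum]
  refine Finset.sum_le_sum fun i _ => ?_
  rw [mul_pow, mul_comm]
  exact mul_le_mul_of_nonneg_right (sq_le_sq' (abs_le.1 (hζb _)).1 (abs_le.1 (hζb _)).2)
    (sq_nonneg _)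

end Orthogonality

section MeanLE

variable {Ω : Type*} [MeasurableSpace Ω] {ν : Measure Ω} {F G : Ω → ℝ} {x y : ℝ}

/-- `x` bounds the mean of `F`: `F` is measurable and the integral of its positive part is at most
`x ≥ 0`. Stated with the Lebesgue integral, so that it does not presuppose integrability. -/
structure MeanLE (ν : Measure Ω) (F : Ω → ℝ) (x : ℝ) : Prop where
  measurable : Measurable F
  nonneg : 0 ≤ x
  le : ∫⁻ ω, ENNReal.ofReal (F ω) ∂ν ≤ ENNReal.ofReal x

theorem MeanLE.add (hF : MeanLE ν F x) (hG : MeanLE ν G y) :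
    MeanLE ν (fun ω => F ω + G ω) (x + y) := by
  refine ⟨hF.measurable.add hG.measurable, add_nonneg hF.nonneg hG.nonneg, ?_⟩
  calc ∫⁻ ω, ENNReal.ofReal (F ω + G ω) ∂ν
      ≤ ∫⁻ ω, (ENNReal.ofReal (F ω) + ENNReal.ofReal (G ω)) ∂ν :=
        lintegral_mono fun ω => ENNReal.ofReal_add_le
    _ = ∫⁻ ω, ENNReal.ofReal (F ω) ∂ν + ∫⁻ ω, ENNReal.ofReal (G ω) ∂ν :=
        lintegral_add_left hF.measurable.ennreal_ofReal _
    _ ≤ ENNReal.ofReal x + ENNReal.ofReal y := add_le_add hF.le hG.le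
    _ = ENNReal.ofReal (x + y) := (ENNReal.ofReal_add hF.nonneg hG.nonneg).symm

theorem MeanLE.const_mul (hF : MeanLE ν F x) {k : ℝ} (hk : 0 ≤ k) :
    MeanLE ν (fun ω => k * F ω) (k * x) := by
  refine ⟨hF.measurable.const_mul k, mul_nonneg hk hF.nonneg, ?_⟩
  simp_rw [ENNReal.ofReal_mul hk]
  rw [lintegral_const_mul' _ _ ENNReal.ofReal_ne_top]
  exact mul_le_mul_right hF.le _

theorem MeanLE.sum {ι : Type*} (I : Finset ι) {F : ι → Ω → ℝ} {x : ι → ℝ}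
    (hF : ∀ i ∈ I, MeanLE ν (F i) (x i)) :
    MeanLE ν (fun ω => ∑ i ∈ I, F i ω) (∑ i ∈ I, x i) := by
  classical
  induction I using Finset.induction_on with
  | empty => exact ⟨by simp, by simp, by simp⟩
  | insert i I hi ih =>
    simp only [Finset.sum_insert hi]
    exact (hF i (Finset.mem_insert_self i I)).add
      (ih fun j hj => hF j (Finset.mem_insert_of_mem hj))

theorem meanLE_const [IsProbabilityMeasure ν] (hx : 0 ≤ x) : MeanLE ν (fun _ => x) x :=
  ⟨measurable_const, hx, by simp⟩

theorem MeanLE.mono (hF : MeanLE ν F x) (hG : Measurable G) (hGF : ∀ ω, G ω ≤ F ω) (hxy : x ≤ y) :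
    MeanLE ν G y :=
  ⟨hG, hF.nonneg.trans hxy, (lintegral_mono fun ω => ENNReal.ofReal_le_ofReal (hGF ω)).trans
    (hF.le.trans (ENNReal.ofReal_le_ofReal hxy))⟩

end MeanLE

theorem nearCount_update {E σ : Type*} [Fintype σ] (π : E → σ → ℝ) (h : ℝ) {D : Finset (Fin n)}
    {i : Fin n} (hi : i ∈ D) (z : Fin n → E) (x y : E) :
    near π h y (z i) + nearCount π h D (Function.update z i x) y
      = near π h y x + nearCount π h D z y := by
  have sum_erase : ∑ j ∈ D.erase i, near π h y (Function.update z i x j)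
      = ∑ j ∈ D.erase i, near π h y (z j) :=
    Finset.sum_congr rfl fun j hj => by rw [Function.update_of_ne (Finset.ne_of_mem_erase hj)]
  simp only [nearCount, ← Finset.add_sum_erase D _ hi, Function.update_self, sum_erase]
  ring

theorem near_update_factorsThrough {E σ : Type*} [Fintype σ] (π : E → σ → ℝ) (h : ℝ) (x : E)
    (i j : Fin n) (z : Fin n → E) :
    (fun y => near π h x (Function.update z j y i)).FactorsThrough π := fun y y' hy =>
  near_congr_right h x <| by
    obtain rfl | hij := eq_or_ne i j
    · simpa using hy
    · simp [hij]

theorem abs_near_div_nearCount_le_one {E σ : Type*} [Fintype σ] (π : E → σ → ℝ) (h : ℝ)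
    (D : Finset (Fin n)) (z : Fin n → E) (x y : E) :
    |near π h x y / nearCount π h D z x| ≤ 1 := by
  rw [abs_of_nonneg (div_nonneg (near_nonneg π h _ _) (nearCount_nonneg π h _ _ _))]
  rcases nearCount_eq_zero_or_one_le π h D z x with hN | hN
  · simp [hN]
  · refine div_le_one_of_le₀ (le_trans ?_ hN) (by positivity)
    rcases near_eq_zero_or_one π h x y with e | e <;> simp [e]

section LocalAverage

variable {E σ : Type*} [MeasurableSpace E] {μ : Measure E} [Fintype σ]
  {π : E → σ → ℝ} {h T : ℝ} {D : Finset (Fin n)} {φ : (Fin n → E) → E → ℝ} {ε : ℝ}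

theorem measurable_comp_sample (hφ : Measurable fun p : E × (Fin n → E) => φ p.2 p.1)
    (i : Fin n) : Measurable fun p : E × (Fin n → E) => φ p.2 (p.2 i) :=
  hφ.comp ((measurable_sample i).prodMk measurable_snd)

theorem MeanLE.comp_sample [SigmaFinite μ] (hφ : MeanLE (sampleLaw μ n) (fun p => φ p.2 p.1) ε)
    {i : Fin n} (hφi : ∀ z y, φ (Function.update z i y) = φ z) :
    MeanLE (sampleLaw μ n) (fun p => φ p.2 (p.2 i)) ε := by
  refine ⟨measurable_comp_sample hφ.measurable i, hφ.nonneg, le_of_eq_of_le ?_ hφ.le⟩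
  rw [← lintegral_swap μ i fun x z => ENNReal.ofReal (φ z x)]
  simp only [hφi]

theorem MeanLE.inv_card_mul_sum [SigmaFinite μ]
    (hφ : MeanLE (sampleLaw μ n) (fun p => φ p.2 p.1) ε)
    (hφD : ∀ i ∈ D, ∀ z y, φ (Function.update z i y) = φ z) :
    MeanLE (sampleLaw μ n) (fun p => (D.card : ℝ)⁻¹ * ∑ i ∈ D, φ p.2 (p.2 i)) ε := by
  have hsum := (MeanLE.sum D fun i hi => hφ.comp_sample (hφD i hi)).const_mul
    (k := (D.card : ℝ)⁻¹) (by positivity)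
  refine hsum.mono hsum.measurable (fun _ => le_rfl) ?_
  rw [Finset.sum_const, nsmul_eq_mul, ← mul_assoc]
  exact mul_le_of_le_one_left hφ.nonneg inv_mul_le_one

theorem MeanLE.sum_near_div_nearCount [SigmaFinite μ] (hπ : Measurable π) (hh : 0 ≤ h)
    (hφ : MeanLE (sampleLaw μ n) (fun p => φ p.2 p.1) ε) (hφ0 : ∀ z x, 0 ≤ φ z x)
    (hφD : ∀ i ∈ D, ∀ z y, φ (Function.update z i y) = φ z) :
    MeanLE (sampleLaw μ n)
      (fun p => (∑ i ∈ D, near π h p.1 (p.2 i) * φ p.2 (p.2 i)) / nearCount π h D p.2 p.1)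
      (2 ^ Fintype.card σ * ε) := by
  set F : Fin n → E → (Fin n → E) → ℝ := fun i x z =>
    near π h x (z i) * φ z (z i) / nearCount π h D z x with hF
  have hFm (i) : Measurable fun p : E × (Fin n → E) => F i p.1 p.2 :=
    ((measurable_near h hπ measurable_fst (measurable_sample i)).mul
      (measurable_comp_sample hφ.measurable i)).div
        (measurable_nearCount h hπ D measurable_fst measurable_snd)
  have hF0 (i x z) : 0 ≤ F i x z :=
    div_nonneg (mul_nonneg (near_nonneg π h _ _) (hφ0 _ _)) (nearCount_nonneg π h _ _ _)
  have F_swap : ∀ i ∈ D, ∀ x z, F i (z i) (Function.update z i x)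
      = near π h x (z i) * (nearCount π h D z (z i))⁻¹ * φ z x := by
    intro i hi x z
    have hcount := nearCount_update π h hi z x (z i)
    simp only [hF, Function.update_self, hφD i hi]
    rcases near_eq_zero_or_one π h x (z i) with e | e <;> rw [near_comm] at e <;>
      rw [near_comm π h x, e]
    · simp
    · rw [near_self π hh, e, add_right_inj] at hcount
      rw [hcount]
      ring
  have h2 : (0 : ℝ) ≤ 2 ^ Fintype.card σ := by positivity
  refine ⟨by simpa only [Finset.sum_div] using Finset.measurable_fun_sum D fun i _ => hFm i,
    mul_nonneg h2 hφ.nonneg, le_trans ?_ (hφ.const_mul h2).le⟩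
  calc _ = ∫⁻ p, ∑ i ∈ D, ENNReal.ofReal (F i p.1 p.2) ∂(sampleLaw μ n) := by
        simp_rw [Finset.sum_div]
        exact lintegral_congr fun p => ENNReal.ofReal_sum_of_nonneg fun i _ => hF0 i _ _
    _ = ∫⁻ p, ∑ i ∈ D, ENNReal.ofReal (F i (p.2 i) (Function.update p.2 i p.1))
          ∂(sampleLaw μ n) := (lintegral_sum_swap D
            (F := fun i x z => ENNReal.ofReal (F i x z)) fun i => (hFm i).ennreal_ofReal).symm
    _ ≤ ∫⁻ p, ENNReal.ofReal (2 ^ Fintype.card σ * φ p.2 p.1) ∂(sampleLaw μ n) := by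
        refine lintegral_mono fun p => ?_
        rw [← ENNReal.ofReal_sum_of_nonneg fun i _ => hF0 i _ _,
          Finset.sum_congr rfl fun i hi => F_swap i hi p.1 p.2, ← Finset.sum_mul]
        exact ENNReal.ofReal_le_ofReal (mul_le_mul_of_nonneg_right
          (sum_near_mul_inv_nearCount_le π h D p.2 p.1) (hφ0 _ _))

theorem lintegral_le_div_of_add_sum_swap_le [IsProbabilityMeasure μ] (D : Finset (Fin n))
    {F : E → (Fin n → E) → ℝ≥0∞} (hF : Measurable fun p : E × (Fin n → E) => F p.1 p.2)
    {b : ℝ≥0∞} (hb : ∀ x z, F x z + ∑ i ∈ D, F (z i) (Function.update z i x) ≤ b) :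
    ∫⁻ p, F p.1 p.2 ∂(sampleLaw μ n) ≤ b / (D.card + 1) := by
  rw [ENNReal.le_div_iff_mul_le (by simp) (by simp)]
  calc (∫⁻ p, F p.1 p.2 ∂(sampleLaw μ n)) * (D.card + 1)
      = ∫⁻ p, F p.1 p.2 ∂(sampleLaw μ n) + ∫⁻ p, ∑ _i ∈ D, F p.1 p.2 ∂(sampleLaw μ n) := by
        rw [lintegral_finsetSum _ fun i _ => hF, Finset.sum_const, nsmul_eq_mul]
        ring
    _ = ∫⁻ p, (F p.1 p.2 + ∑ i ∈ D, F (p.2 i) (Function.update p.2 i p.1))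
          ∂(sampleLaw μ n) := by
        rw [lintegral_add_left hF, ← lintegral_sum_swap D fun _ => hF]
    _ ≤ ∫⁻ _, b ∂(sampleLaw μ n) := lintegral_mono fun p => hb p.1 p.2
    _ = b := by simp

open Classical in
theorem measurable_ite_norm_le {Ω : Type*} [MeasurableSpace Ω] (hπ : Measurable π) {x : Ω → E}
    (hx : Measurable x) {F : Ω → ℝ} (hF : Measurable F) (T : ℝ) :
    Measurable fun ω => if ‖π (x ω)‖ ≤ T then F ω else 0 :=
  .ite (measurableSet_le (hπ.comp hx).norm measurable_const) hF measurable_const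

open Classical in
theorem meanLE_inv_one_add_nearCount [IsProbabilityMeasure μ] (hπ : Measurable π) (hh : 0 < h)
    (hhT : h ≤ T) (D : Finset (Fin n)) :
    MeanLE (sampleLaw μ n)
      (fun p => if ‖π p.1‖ ≤ T then (1 + nearCount π h D p.2 p.1)⁻¹ else 0)
      ((3 * (T / h)) ^ Fintype.card σ / (D.card + 1)) := by
  set F : E → (Fin n → E) → ℝ := fun x z =>
    if ‖π x‖ ≤ T then (1 + nearCount π h D z x)⁻¹ else 0 with hF
  have hFm : Measurable fun p : E × (Fin n → E) => F p.1 p.2 :=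
    measurable_ite_norm_le hπ measurable_fst
      ((measurable_nearCount h hπ D measurable_fst measurable_snd).const_add 1).inv T
  have hF0 (x z) : 0 ≤ F x z := by
    have := nearCount_nonneg π h D z x
    simp only [hF]
    split_ifs <;> positivity
  have hTh : 0 ≤ T / h := div_nonneg (hh.le.trans hhT) hh.le
  have F_swap_le (x z) : F x z + ∑ i ∈ D, F (z i) (Function.update z i x)
      ≤ (3 * (T / h)) ^ Fintype.card σ := by
    have hcells := sum_inv_nearCount_le_pow π (Finset.insertNone D) (fun o => o.elim x z) hh hhT
    rw [Finset.sum_filter, Finset.sum_insertNone] at hcells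
    simp only [nearCount, Finset.sum_insertNone, Option.elim, near_self π hh.le] at hcells
    refine le_of_eq_of_le (congrArg₂ _ rfl (Finset.sum_congr rfl fun i hi => ?_)) hcells
    have hcount := nearCount_update π h hi z x (z i)
    rw [near_self π hh.le] at hcount
    simp only [hF, hcount]
    rfl
  refine ⟨hFm, by positivity, ?_⟩
  rw [ENNReal.ofReal_div_of_pos (by positivity), ENNReal.ofReal_add (by positivity) zero_le_one,
    ENNReal.ofReal_natCast, ENNReal.ofReal_one]
  refine lintegral_le_div_of_add_sum_swap_le D
    (F := fun x z => ENNReal.ofReal (F x z)) hFm.ennreal_ofReal fun x z => ?_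
  rw [← ENNReal.ofReal_sum_of_nonneg fun _ _ => hF0 _ _,
    ← ENNReal.ofReal_add (hF0 _ _) (Finset.sum_nonneg fun _ _ => hF0 _ _)]
  exact ENNReal.ofReal_le_ofReal (F_swap_le x z)

open Classical in
theorem meanLE_sq_local_average [IsProbabilityMeasure μ] (hπ : Measurable π) (hh : 0 < h)
    (hhT : h ≤ T) {ξ : E → ℝ} (hξm : Measurable ξ) {V : ℝ} (hξb : ∀ x, |ξ x| ≤ V)
    (hξ : CondCentred μ π ξ) (D : Finset (Fin n)) :
    MeanLE (sampleLaw μ n)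
      (fun p => if ‖π p.1‖ ≤ T then
        (∑ i ∈ D, near π h p.1 (p.2 i) / nearCount π h D p.2 p.1 * ξ (p.2 i)) ^ 2 else 0)
      (2 * V ^ 2 * ((3 * (T / h)) ^ Fintype.card σ / (D.card + 1))) := by
  have hm : Measurable fun p : E × (Fin n → E) => if ‖π p.1‖ ≤ T then
      (∑ i ∈ D, near π h p.1 (p.2 i) / nearCount π h D p.2 p.1 * ξ (p.2 i)) ^ 2 else 0 :=
    measurable_ite_norm_le hπ measurable_fst ((Finset.measurable_fun_sum D fun i _ =>
      ((measurable_near h hπ measurable_fst (measurable_sample i)).div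
        (measurable_nearCount h hπ D measurable_fst measurable_snd)).mul
          (hξm.comp (measurable_sample i))).pow_const 2) T
  have hcount := (meanLE_inv_one_add_nearCount (μ := μ) hπ hh hhT D).const_mul
    (k := 2 * V ^ 2) (by positivity)
  refine ⟨hm, hcount.nonneg, le_trans ?_ hcount.le⟩
  rw [lintegral_prod _ hm.ennreal_ofReal.aemeasurable,
    lintegral_prod _ hcount.measurable.ennreal_ofReal.aemeasurable]
  refine lintegral_mono fun x => ?_
  by_cases hx : ‖π x‖ ≤ T
  swap
  · simp [hx]
  simp only [hx, if_true]
  refine (lintegral_sq_sum_le_of_condCentred hξm hξb hξ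
    (q := fun i z => near π h x (z i) / nearCount π h D z x)
    (fun i => (measurable_near h hπ measurable_const (measurable_pi_apply i)).div
      (measurable_nearCount h hπ D measurable_const measurable_id))
    (fun i z => abs_near_div_nearCount_le_one π h D z x _)
    (fun i j z y y' hy => congrArg₂ _ (near_update_factorsThrough π h x i j z hy)
      (Finset.sum_congr rfl fun k _ => near_update_factorsThrough π h x k j z hy)) D).trans
    (lintegral_mono fun z => ENNReal.ofReal_le_ofReal ?_)
  have hsum := sum_sq_near_div_nearCount_le π h D z x
  nlinarith [mul_le_mul_of_nonneg_left hsum (sq_nonneg V)]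

open Classical in
theorem meanLE_nearCount_eq_zero [IsProbabilityMeasure μ] (hπ : Measurable π) (hh : 0 < h)
    (hhT : h ≤ T) (V : ℝ) (D : Finset (Fin n)) :
    MeanLE (sampleLaw μ n)
      (fun p => if ‖π p.1‖ ≤ T then if nearCount π h D p.2 p.1 = 0 then V ^ 2 else 0 else 0)
      (V ^ 2 * ((3 * (T / h)) ^ Fintype.card σ / (D.card + 1))) := by
  have hcm : Measurable fun p : E × (Fin n → E) => nearCount π h D p.2 p.1 :=
    measurable_nearCount h hπ D measurable_fst measurable_snd
  refine ((meanLE_inv_one_add_nearCount hπ hh hhT D).const_mul (sq_nonneg V)).mono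
    (measurable_ite_norm_le hπ measurable_fst (.ite (hcm (measurableSet_singleton 0))
      measurable_const measurable_const) T) (fun p => ?_) le_rfl
  have := nearCount_nonneg π h D p.2 p.1
  split_ifs with hx hN
  · simp [hN]
  · positivity
  · simp

theorem meanLE_sq_sum_centred [IsProbabilityMeasure μ] {ζ : E → ℝ} (hζm : Measurable ζ) {B : ℝ}
    (hζb : ∀ x, |ζ x| ≤ B) (hζ : ∫ y, ζ y ∂μ = 0) (D : Finset (Fin n)) :
    MeanLE (sampleLaw μ n) (fun p => (∑ i ∈ D, ζ (p.2 i)) ^ 2) (D.card * B ^ 2) := by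
  have hm : Measurable fun z : Fin n → E => (∑ i ∈ D, ζ (z i)) ^ 2 :=
    (Finset.measurable_fun_sum _ fun i _ => hζm.comp (measurable_pi_apply i)).pow_const 2
  refine ⟨hm.comp measurable_snd, by positivity, ?_⟩
  rw [measurePreserving_snd.lintegral_comp hm.ennreal_ofReal]
  have := lintegral_sq_sum_le_of_condCentred (q := fun (_ : Fin n) _ => 1) hζm hζb
    (condCentred_const hζ) (fun _ => measurable_const) (by simp) (fun _ _ _ _ _ _ => rfl) D
  simpa [mul_comm] using this

end LocalAverage

section Glue

theorem glue_restrict (S : Finset (Fin d)) (x : Pt d) :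
    glue S (S.restrict x) (Sᶜ.restrict x) = x := by
  ext j
  unfold glue
  split_ifs <;> rfl

theorem restrict_glue (S : Finset (Fin d)) (u : S → ℝ) (v : ↥Sᶜ → ℝ) :
    S.restrict (glue S u v) = u := by
  ext ⟨j, hj⟩
  simp [glue, hj]

theorem measurable_glue (S : Finset (Fin d)) :
    Measurable fun p : (S → ℝ) × (↥Sᶜ → ℝ) => glue S p.1 p.2 := by
  refine measurable_pi_iff.2 fun j => ?_
  unfold glue
  split_ifs with hj
  · exact (measurable_pi_apply _).comp measurable_fst
  · exact (measurable_pi_apply _).comp measurable_snd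

theorem measurable_glue_right (S : Finset (Fin d)) (u : S → ℝ) :
    Measurable fun v : ↥Sᶜ → ℝ => glue S u v :=
  (measurable_glue S).comp (measurable_const.prodMk measurable_id)

theorem norm_restrict_le (S : Finset (Fin d)) (x : Pt d) : ‖S.restrict x‖ ≤ ‖x‖ :=
  (pi_norm_le_iff_of_nonneg (norm_nonneg x)).2 fun s => norm_le_pi_norm x s

theorem norm_glue_sub_le (S : Finset (Fin d)) (u u' : S → ℝ) (v : ↥Sᶜ → ℝ) :
    ‖glue S u v - glue S u' v‖ ≤ ‖u - u'‖ := by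
  rw [pi_norm_le_iff_of_nonneg (norm_nonneg _)]
  intro j
  simp only [Pi.sub_apply, glue]
  split_ifs with hj
  · exact norm_le_pi_norm (u - u') ⟨j, hj⟩
  · simp

end Glue

section LocHolder

variable {E : Type*} [SeminormedAddCommGroup E] {β β' L : ℝ}

/-- Hölder continuity with exponent `β` and constant `L` at scales up to `1`, as in the
smoothness assumptions. -/
def LocHolder (F : E → ℝ) (β L : ℝ) : Prop :=
  ∀ x x' : E, ‖x - x'‖ ≤ 1 → |F x - F x'| ≤ L * ‖x - x'‖ ^ β

theorem LocHolder.mono_exponent {F : E → ℝ} (hF : LocHolder F β L) (hL : 0 ≤ L) (hβ' : 0 ≤ β')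
    (h : β' ≤ β) : LocHolder F β' L := fun x x' hx =>
  (hF x x' hx).trans (mul_le_mul_of_nonneg_left
    (Real.rpow_le_rpow_of_exponent_ge' (norm_nonneg _) hx hβ' h) hL)

theorem LocHolder.continuous {F : E → ℝ} (hF : LocHolder F β L) (hβ : 0 < β) : Continuous F := by
  refine continuous_iff_continuousAt.2 fun x => tendsto_iff_norm_sub_tendsto_zero.2 ?_
  have modulus_tendsto : Filter.Tendsto (fun y : E => L * ‖y - x‖ ^ β) (nhds x) (nhds 0) := by
    have norm_tendsto : Filter.Tendsto (fun y : E => ‖y - x‖) (nhds x) (nhds 0) :=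
      tendsto_iff_norm_sub_tendsto_zero.1 Filter.tendsto_id
    simpa [Real.zero_rpow hβ.ne'] using
      (norm_tendsto.rpow_const (p := β) (Or.inr hβ.le)).const_mul L
  refine squeeze_zero' (.of_forall fun _ => norm_nonneg _) ?_ modulus_tendsto
  filter_upwards [Metric.closedBall_mem_nhds x one_pos] with y hy
  exact hF y x (by simpa [dist_eq_norm] using hy)

theorem LocHolder.comp_restrict {S : Finset (Fin d)} {F : (S → ℝ) → ℝ} (hF : LocHolder F β L)
    (hβ : 0 ≤ β) (hL : 0 ≤ L) : LocHolder (fun x : Pt d => F (S.restrict x)) β L := fun x x' hx =>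
  have hle : ‖S.restrict x - S.restrict x'‖ ≤ ‖x - x'‖ := norm_restrict_le S (x - x')
  (hF _ _ (hle.trans hx)).trans
    (mul_le_mul_of_nonneg_left (Real.rpow_le_rpow (norm_nonneg _) hle hβ) hL)

end LocHolder

section BoundedIntegral

variable {E : Type*} [MeasurableSpace E] {φ w : E → ℝ} {lo hi : ℝ}

theorem integrable_of_mem_Icc {P : Measure E} [IsFiniteMeasure P] (hφ : Measurable φ)
    (hr : ∀ z, φ z ∈ Set.Icc lo hi) : Integrable φ P :=
  integrable_of_bound hφ fun z => abs_le_max_abs_abs (hr z).1 (hr z).2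

theorem integral_mem_Icc (P : Measure E) [IsProbabilityMeasure P] (hφ : Measurable φ)
    (hr : ∀ z, φ z ∈ Set.Icc lo hi) : ∫ z, φ z ∂P ∈ Set.Icc lo hi := by
  have hint : Integrable φ P := integrable_of_mem_Icc hφ hr
  constructor
  · simpa using integral_mono (integrable_const lo) hint fun z => (hr z).1
  · simpa using integral_mono hint (integrable_const hi) fun z => (hr z).2

theorem integral_mul_div_integral_mem_Icc {P : Measure E} (hw : Integrable w P)
    (hw0 : ∀ z, 0 ≤ w z) (hpos : 0 < ∫ z, w z ∂P) (hwφ : Integrable (fun z => w z * φ z) P)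
    (hr : ∀ z, φ z ∈ Set.Icc lo hi) :
    (∫ z, w z * φ z ∂P) / ∫ z, w z ∂P ∈ Set.Icc lo hi := by
  constructor
  · rw [le_div_iff₀ hpos, mul_comm, ← integral_mul_const]
    exact integral_mono (hw.mul_const _) hwφ fun z => mul_le_mul_of_nonneg_left (hr z).1 (hw0 z)
  · rw [div_le_iff₀ hpos, mul_comm, ← integral_mul_const]
    exact integral_mono hwφ (hw.mul_const _) fun z => mul_le_mul_of_nonneg_left (hr z).2 (hw0 z)

end BoundedIntegral

section TotalVariation

variable {E : Type*} [MeasurableSpace E] {φ : E → ℝ}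

theorem integral_sub_const_eq_integral_rnDeriv {P ν : Measure E} [IsProbabilityMeasure P]
    [SigmaFinite ν] (hPν : P ≪ ν) (hφ : Integrable φ P) (t : ℝ) :
    (∫ z, φ z ∂P) - t = ∫ z, (P.rnDeriv ν z).toReal * (φ z - t) ∂ν := by
  have change_measure := integral_rnDeriv_smul hPν (f := fun z => φ z - t)
  simp only [smul_eq_mul] at change_measure
  rw [change_measure, integral_sub hφ (integrable_const _), integral_const, probReal_univ, one_smul]

theorem abs_integral_sub_integral_le (P Q : Measure E) [IsProbabilityMeasure P]
    [IsProbabilityMeasure Q] (hφ : Measurable φ) {lo hi : ℝ} (hr : ∀ z, φ z ∈ Set.Icc lo hi) :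
    |∫ z, φ z ∂P - ∫ z, φ z ∂Q| ≤ (hi - lo) * tvDist P Q := by
  -- Subtracting the midpoint of the range halves the sup norm and leaves the difference unchanged.
  set mid := (lo + hi) / 2 with hmid
  have abs_sub_mid_le (z) : |φ z - mid| ≤ (hi - lo) / 2 := by
    rw [abs_le, hmid]
    constructor <;> linarith [(hr z).1, (hr z).2]
  have hint (ν : Measure E) [IsProbabilityMeasure ν] :
      Integrable (fun z => (ν.rnDeriv (P + Q) z).toReal * (φ z - mid)) (P + Q) :=
    Measure.integrable_toReal_rnDeriv.mul_bdd (c := (hi - lo) / 2)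
      (hφ.sub_const _).aestronglyMeasurable (.of_forall abs_sub_mid_le)
  have hP := integral_sub_const_eq_integral_rnDeriv (ν := P + Q)
    (Measure.AbsolutelyContinuous.rfl.add_right Q) (integrable_of_mem_Icc hφ hr) mid
  have hQ := integral_sub_const_eq_integral_rnDeriv (ν := P + Q)
    (add_comm P Q ▸ Measure.AbsolutelyContinuous.rfl.add_right P) (integrable_of_mem_Icc hφ hr) mid
  calc |∫ z, φ z ∂P - ∫ z, φ z ∂Q|
      = |∫ z, ((P.rnDeriv (P + Q) z).toReal - (Q.rnDeriv (P + Q) z).toReal) * (φ z - mid)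
          ∂(P + Q)| := by
        rw [← sub_sub_sub_cancel_right _ _ mid, hP, hQ, ← integral_sub (hint P) (hint Q)]
        simp only [sub_mul]
    _ ≤ ∫ z, (hi - lo) / 2 * |(P.rnDeriv (P + Q) z).toReal - (Q.rnDeriv (P + Q) z).toReal|
          ∂(P + Q) := by
        refine abs_integral_le_integral_abs.trans (integral_mono_of_nonneg
          (.of_forall fun _ => abs_nonneg _) ((Measure.integrable_toReal_rnDeriv.sub
            Measure.integrable_toReal_rnDeriv).abs.const_mul _) (.of_forall fun z => ?_))
        dsimp only
        rw [abs_mul, mul_comm]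
        exact mul_le_mul_of_nonneg_right (abs_sub_mid_le z) (abs_nonneg _)
    _ = (hi - lo) * tvDist P Q := by rw [integral_const_mul, tvDist, ← mul_assoc, div_eq_mul_inv]

end TotalVariation

section CondMean

/-- The conditional mean `𝔼{g(X) | X_S = u}`, for the version `κ` of the conditional law. -/
def condMean (S : Finset (Fin d)) (κ : Kernel (S → ℝ) (↥Sᶜ → ℝ)) (g : Pt d → ℝ) (u : S → ℝ) : ℝ :=
  ∫ v, g (glue S u v) ∂(κ u)

variable {S : Finset (Fin d)} {κ : Kernel (S → ℝ) (↥Sᶜ → ℝ)} {f g : Pt d → ℝ} {lo hi : ℝ}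

theorem measurable_condMean [IsMarkovKernel κ] (hg : Measurable g) :
    Measurable (condMean S κ g) :=
  (StronglyMeasurable.integral_kernel_prod_right'
    (hg.comp (measurable_glue S)).stronglyMeasurable).measurable

theorem condMean_mem_Icc [IsMarkovKernel κ] (hg : Measurable g)
    (hr : ∀ x, g x ∈ Set.Icc lo hi) (u : S → ℝ) : condMean S κ g u ∈ Set.Icc lo hi :=
  integral_mem_Icc (κ u) (hg.comp (measurable_glue_right S u)) fun _ => hr _

theorem locHolder_condMean [IsMarkovKernel κ] {β L L' : ℝ} (hg : LocHolder g β L) (hβ : 0 < β)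
    (hL : 0 ≤ L) (hr : ∀ x, g x ∈ Set.Icc lo hi)
    (hκ : ∀ u u' : S → ℝ, ‖u - u'‖ ≤ 1 → tvDist (κ u) (κ u') ≤ L' * ‖u - u'‖ ^ β) :
    LocHolder (condMean S κ g) β (L + (hi - lo) * L') := by
  intro u u' hu
  have hgm : Measurable g := (hg.continuous hβ).measurable
  have hlh : 0 ≤ hi - lo := sub_nonneg.2 ((hr 0).1.trans (hr 0).2)
  have hgm_glue (w) : Measurable fun v => g (glue S w v) := hgm.comp (measurable_glue_right S w)
  have hint (w t) : Integrable (fun v => g (glue S w v)) (κ t) :=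
    integrable_of_mem_Icc (hgm_glue w) fun v => hr _
  have change_point :
      |∫ v, g (glue S u v) ∂(κ u) - ∫ v, g (glue S u' v) ∂(κ u)| ≤ L * ‖u - u'‖ ^ β := by
    rw [← integral_sub (hint _ _) (hint _ _)]
    calc |∫ v, (g (glue S u v) - g (glue S u' v)) ∂(κ u)|
        ≤ ∫ v, |g (glue S u v) - g (glue S u' v)| ∂(κ u) := abs_integral_le_integral_abs
      _ ≤ ∫ _, L * ‖u - u'‖ ^ β ∂(κ u) := by
          refine integral_mono_of_nonneg (.of_forall fun _ => abs_nonneg _)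
            (integrable_const _) (.of_forall fun v => ?_)
          have hle := norm_glue_sub_le S u u' v
          exact (hg _ _ (hle.trans hu)).trans
            (mul_le_mul_of_nonneg_left (Real.rpow_le_rpow (norm_nonneg _) hle hβ.le) hL)
      _ = L * ‖u - u'‖ ^ β := by rw [integral_const, probReal_univ, one_smul]
  have change_law :
      |∫ v, g (glue S u' v) ∂(κ u) - ∫ v, g (glue S u' v) ∂(κ u')|
        ≤ (hi - lo) * (L' * ‖u - u'‖ ^ β) :=
    (abs_integral_sub_integral_le (κ u) (κ u') (hgm_glue u') fun _ => hr _).trans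
      (mul_le_mul_of_nonneg_left (hκ u u' hu) hlh)
  calc |condMean S κ g u - condMean S κ g u'|
      ≤ _ := abs_sub_le _ (∫ v, g (glue S u' v) ∂(κ u)) _
    _ ≤ L * ‖u - u'‖ ^ β + (hi - lo) * (L' * ‖u - u'‖ ^ β) := add_le_add change_point change_law
    _ = (L + (hi - lo) * L') * ‖u - u'‖ ^ β := by ring

theorem IsDensity.isProbabilityMeasure (hf : IsDensity f) : IsProbabilityMeasure (law f) :=
  ⟨by rw [law, withDensity_apply _ .univ, setLIntegral_univ, hf.lintegral_eq_one]⟩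

theorem integral_condMean [IsProbabilityMeasure (law f)] (hκ : IsCondLaw f S κ)
    (hg : Measurable g) (hr : ∀ x, g x ∈ Set.Icc lo hi) :
    ∫ x, condMean S κ g (S.restrict x) ∂(law f) = ∫ x, g x ∂(law f) := by
  obtain ⟨_, hdis⟩ := hκ
  have hpair : Measurable fun x : Pt d => (S.restrict x, Sᶜ.restrict x) :=
    (Finset.measurable_restrict S).prodMk (Finset.measurable_restrict Sᶜ)
  set ν := (law f).map fun x => (S.restrict x, Sᶜ.restrict x) with hν
  have : IsProbabilityMeasure ν := Measure.isProbabilityMeasure_map hpair.aemeasurable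
  have hglue : Measurable fun p : (S → ℝ) × (↥Sᶜ → ℝ) => g (glue S p.1 p.2) :=
    hg.comp (measurable_glue S)
  calc ∫ x, condMean S κ g (S.restrict x) ∂(law f) = ∫ u, condMean S κ g u ∂ν.fst := by
        rw [hν, Measure.fst_map_prodMk (Finset.measurable_restrict Sᶜ),
          integral_map (Finset.measurable_restrict S).aemeasurable
            (measurable_condMean hg).aestronglyMeasurable]
    _ = ∫ p, g (glue S p.1 p.2) ∂ν := by
        conv_rhs => rw [← hdis.disintegrate]
        exact (Measure.integral_compProd (integrable_of_mem_Icc hglue fun p => hr _)).symm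
    _ = ∫ x, g x ∂(law f) := by
        rw [hν, integral_map hpair.aemeasurable hglue.aestronglyMeasurable]
        simp only [glue_restrict]

theorem condMean_mul_of_factorsThrough {φ : Pt d → ℝ} (hφ : φ.FactorsThrough S.restrict)
    (x : Pt d) :
    condMean S κ (fun y => φ y * g y) (S.restrict x) = φ x * condMean S κ g (S.restrict x) := by
  have hφ_glue (v) : φ (glue S (S.restrict x) v) = φ x := hφ (restrict_glue S _ v)
  simp only [condMean, hφ_glue, integral_const_mul]

theorem condCentred_sub_condMean [IsProbabilityMeasure (law f)] (hκ : IsCondLaw f S κ)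
    (hg : Measurable g) (hr : ∀ x, g x ∈ Set.Icc lo hi) :
    CondCentred (law f) S.restrict fun x => g x - condMean S κ g (S.restrict x) := by
  have := hκ.1
  rintro φ hφ ⟨b, hb⟩ hfac
  have hmul_bdd {k : Pt d → ℝ} (hk : ∀ x, k x ∈ Set.Icc lo hi) (x) :
      φ x * k x ∈ Set.Icc (-(b * max |lo| |hi|)) (b * max |lo| |hi|) := by
    rw [Set.mem_Icc, ← abs_le, abs_mul]
    exact mul_le_mul (hb x) (abs_le_max_abs_abs (hk x).1 (hk x).2) (abs_nonneg _)
      ((abs_nonneg _).trans (hb x))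
  have hm : Measurable fun x : Pt d => condMean S κ g (S.restrict x) :=
    (measurable_condMean hg).comp (Finset.measurable_restrict S)
  have hφg : Measurable fun x => φ x * g x := hφ.mul hg
  have hφm : Measurable fun x => φ x * condMean S κ g (S.restrict x) := hφ.mul hm
  simp_rw [mul_sub]
  rw [integral_sub (integrable_of_mem_Icc hφg (hmul_bdd hr))
    (integrable_of_mem_Icc hφm (hmul_bdd fun x => condMean_mem_Icc hg hr _)), sub_eq_zero,
    ← integral_condMean hκ hφg (hmul_bdd hr)]
  exact integral_congr_ae (.of_forall (condMean_mul_of_factorsThrough hfac))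

end CondMean

section Weights

variable {lam c C ρ s s' : ℝ}

/-- The weight `λ s / (ρ + λ s)`: the population weight is the case `ρ = 1`, `s = r̄_S(x_S)`, the
empirical one the case `ρ = r̂_S / ∫ r_S f_S`, `s = r̄_S(x_S)`. -/
def weight (lam ρ s : ℝ) : ℝ := lam * s / (ρ + lam * s)

theorem weight_mem_Icc (hlam : 0 < lam) (hρ : 0 < ρ) (hs : 0 < s) :
    weight lam ρ s ∈ Set.Icc 0 1 := by
  unfold weight
  refine ⟨by positivity, (div_le_one (by positivity)).2 ?_⟩
  linarith

theorem weight_pos (hlam : 0 < lam) (hρ : 0 < ρ) (hs : 0 < s) : 0 < weight lam ρ s := by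
  unfold weight
  positivity

theorem weight_le_mul_weight (hlam : 0 < lam) (hρ : 0 < ρ) (hc : 0 < c) (hs : c ≤ s) (hsC : s ≤ C)
    (hs' : c ≤ s') : weight lam ρ s ≤ C / c * weight lam ρ s' := by
  have hs_pos : 0 < s := hc.trans_le hs
  have hs'_pos : 0 < s' := hc.trans_le hs'
  have hC : 0 < C := hs_pos.trans_le hsC
  have hss' : s * c ≤ C * s' := mul_le_mul hsC hs' hc.le hC.le
  have hsc : s * c ≤ C * s := by
    rw [mul_comm C]
    exact mul_le_mul_of_nonneg_left (hs.trans hsC) hs_pos.le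
  unfold weight
  rw [div_mul_div_comm, div_le_div_iff₀ (by positivity) (by positivity)]
  calc lam * s * (c * (ρ + lam * s'))
      = lam * ρ * (s * c) + lam * lam * s' * (s * c) := by ring
    _ ≤ lam * ρ * (C * s') + lam * lam * s' * (C * s) := by gcongr
    _ = C * (lam * s') * (ρ + lam * s) := by ring

-- The slope `λ / (1 + λ s)²` of the weight is at most `1 / (4 s)`.
theorem abs_weight_one_sub_weight_one_le (hlam : 0 < lam) (hc : 0 < c) (hs : c ≤ s)
    (hs' : c ≤ s') : |weight lam 1 s - weight lam 1 s'| ≤ |s - s'| / (4 * c) := by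
  have hs_pos : 0 < s := hc.trans_le hs
  have hs'_pos : 0 < s' := hc.trans_le hs'
  have hsub : weight lam 1 s - weight lam 1 s'
      = lam * (s - s') / ((1 + lam * s) * (1 + lam * s')) := by
    unfold weight
    field_simp
    ring
  have four_mul_le : lam * (4 * c) ≤ (1 + lam * s) * (1 + lam * s') :=
    calc lam * (4 * c) ≤ (1 + lam * c) * (1 + lam * c) := by linarith [sq_nonneg (1 - lam * c)]
      _ ≤ (1 + lam * s) * (1 + lam * s') := by gcongr
  rw [hsub, abs_div, abs_mul, abs_of_pos hlam,
    abs_of_pos (show 0 < (1 + lam * s) * (1 + lam * s') by positivity),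
    div_le_div_iff₀ (by positivity) (by positivity), mul_right_comm, mul_comm]
  exact mul_le_mul_of_nonneg_left four_mul_le (abs_nonneg _)

theorem abs_weight_sub_weight_one_le (hlam : 0 < lam) (hρ : 0 < ρ) (hs : 0 < s) :
    |weight lam ρ s - weight lam 1 s| ≤ weight lam ρ s * |1 - ρ| := by
  have hsub : weight lam ρ s - weight lam 1 s
      = weight lam ρ s * ((1 - ρ) / (1 + lam * s)) := by
    unfold weight
    field_simp
    ring
  rw [hsub, abs_mul, abs_of_pos (weight_pos hlam hρ hs), abs_div,
    abs_of_pos (show 0 < 1 + lam * s by positivity)]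
  exact mul_le_mul_of_nonneg_left
    (div_le_self (abs_nonneg _) (le_add_of_nonneg_right (mul_pos hlam hs).le))
    (weight_pos hlam hρ hs).le

end Weights

section Population

variable {f g : Pt d → ℝ} {S : Finset (Fin d)} {r : (S → ℝ) → ℝ} {lam lo hi : ℝ}

theorem integral_ne_zero_of_rBar_pos (hpos : ∀ u, 0 < rBar f S r u) :
    ∫ x, r (S.restrict x) ∂(law f) ≠ 0 := by
  intro h
  have := hpos 0
  rw [rBar, h, div_zero] at this
  exact this.false

theorem integral_rBar (hpos : ∀ u, 0 < rBar f S r u) :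
    ∫ x, rBar f S r (S.restrict x) ∂(law f) = 1 := by
  unfold rBar
  rw [integral_div, div_self (integral_ne_zero_of_rBar_pos hpos)]

theorem one_mem_Icc_of_rBar_mem_Icc [IsProbabilityMeasure (law f)] {c C : ℝ} (hc : 0 < c)
    (hm : Measurable (rBar f S r)) (hb : ∀ u, rBar f S r u ∈ Set.Icc c C) :
    (1 : ℝ) ∈ Set.Icc c C :=
  integral_rBar (fun u => hc.trans_le (hb u).1) ▸
    integral_mem_Icc (law f) (hm.comp (Finset.measurable_restrict S)) fun _ => hb _

theorem measurable_wBar (hm : Measurable (rBar f S r)) : Measurable (wBar f S r lam) := by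
  have h : Measurable fun x : Pt d => lam * rBar f S r (S.restrict x) :=
    (hm.comp (Finset.measurable_restrict S)).const_mul lam
  exact h.div (h.const_add 1)

theorem wBar_mem_Icc (hlam : 0 < lam) (hpos : ∀ u, 0 < rBar f S r u) (x : Pt d) :
    wBar f S r lam x ∈ Set.Icc 0 1 :=
  weight_mem_Icc hlam one_pos (hpos _)

theorem mul_mem_Icc_of_zero_mem {w t : ℝ} (hw : w ∈ Set.Icc 0 1) (ht : t ∈ Set.Icc lo hi)
    (h0 : 0 ∈ Set.Icc lo hi) : w * t ∈ Set.Icc lo hi := by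
  constructor <;> nlinarith [hw.1, hw.2, ht.1, ht.2, h0.1, h0.2]

theorem stepBar_eq {κ : Kernel (S → ℝ) (↥Sᶜ → ℝ)} [IsMarkovKernel κ] (hg : Measurable g)
    (hr : ∀ x, g x ∈ Set.Icc lo hi) (x : Pt d) :
    stepBar f S r lam κ g x
      = wBar f S r lam x * (condMean S κ g (S.restrict x) - thetaBar f S r lam g) := by
  have hint : Integrable (fun v => g (glue S (S.restrict x) v)) (κ (S.restrict x)) :=
    integrable_of_mem_Icc (hg.comp (measurable_glue_right S _)) fun v => hr _
  rw [stepBar, integral_sub hint (integrable_const _), integral_const, probReal_univ, one_smul,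
    condMean]

variable [IsProbabilityMeasure (law f)]

theorem integrable_wBar (hlam : 0 < lam) (hm : Measurable (rBar f S r))
    (hpos : ∀ u, 0 < rBar f S r u) : Integrable (wBar f S r lam) (law f) :=
  integrable_of_mem_Icc (measurable_wBar hm) (wBar_mem_Icc hlam hpos)

theorem integrable_wBar_mul (hlam : 0 < lam) (hm : Measurable (rBar f S r))
    (hpos : ∀ u, 0 < rBar f S r u) (hg : Measurable g) (hr : ∀ x, g x ∈ Set.Icc lo hi) :
    Integrable (fun x => wBar f S r lam x * g x) (law f) :=
  (integrable_of_mem_Icc hg hr).bdd_mul (c := 1) (measurable_wBar hm).aestronglyMeasurable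
    (.of_forall fun x => abs_le.2 ⟨neg_one_lt_zero.le.trans (wBar_mem_Icc hlam hpos x).1,
      (wBar_mem_Icc hlam hpos x).2⟩)

theorem integral_wBar_pos (hlam : 0 < lam) (hm : Measurable (rBar f S r))
    (hpos : ∀ u, 0 < rBar f S r u) : 0 < ∫ x, wBar f S r lam x ∂(law f) := by
  have wBar_pos (x) : 0 < wBar f S r lam x := weight_pos hlam one_pos (hpos _)
  rw [integral_pos_iff_support_of_nonneg (fun x => (wBar_pos x).le) (integrable_wBar hlam hm hpos),
    Set.eq_univ_of_forall (s := Function.support _) fun x => (wBar_pos x).ne', measure_univ]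
  exact one_pos

theorem thetaBar_mem_Icc (hlam : 0 < lam) (hm : Measurable (rBar f S r))
    (hpos : ∀ u, 0 < rBar f S r u) (hg : Measurable g) (hr : ∀ x, g x ∈ Set.Icc lo hi) :
    thetaBar f S r lam g ∈ Set.Icc lo hi :=
  integral_mul_div_integral_mem_Icc (integrable_wBar hlam hm hpos)
    (fun x => (wBar_mem_Icc hlam hpos x).1) (integral_wBar_pos hlam hm hpos)
    (integrable_wBar_mul hlam hm hpos hg hr) hr

theorem integral_wBar_mul_sub_thetaBar (hlam : 0 < lam) (hm : Measurable (rBar f S r))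
    (hpos : ∀ u, 0 < rBar f S r u) (hg : Measurable g) (hr : ∀ x, g x ∈ Set.Icc lo hi) :
    ∫ x, wBar f S r lam x * (g x - thetaBar f S r lam g) ∂(law f) = 0 := by
  simp_rw [mul_sub]
  rw [integral_sub (integrable_wBar_mul hlam hm hpos hg hr)
    ((integrable_wBar hlam hm hpos).mul_const _), integral_mul_const, thetaBar,
    mul_div_cancel₀ _ (integral_wBar_pos hlam hm hpos).ne', sub_self]

variable {κ : Kernel (S → ℝ) (↥Sᶜ → ℝ)} [IsMarkovKernel κ]

-- The range is shifted by `θ̄`, so its length does not increase from step to step.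
theorem stepBar_mem_Icc (hlam : 0 < lam) (hm : Measurable (rBar f S r))
    (hpos : ∀ u, 0 < rBar f S r u) (hg : Measurable g) (hr : ∀ x, g x ∈ Set.Icc lo hi) (x : Pt d) :
    stepBar f S r lam κ g x
      ∈ Set.Icc (lo - thetaBar f S r lam g) (hi - thetaBar f S r lam g) := by
  have hθ := thetaBar_mem_Icc hlam hm hpos hg hr
  have hmean := condMean_mem_Icc (κ := κ) hg hr (S.restrict x)
  rw [stepBar_eq hg hr]
  exact mul_mem_Icc_of_zero_mem (wBar_mem_Icc hlam hpos x)
    ⟨sub_le_sub_right hmean.1 _, sub_le_sub_right hmean.2 _⟩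
    ⟨sub_nonpos.2 hθ.1, sub_nonneg.2 hθ.2⟩

theorem locHolder_stepBar {c β L L₂ L₃ : ℝ} (hlam : 0 < lam) (hc : 0 < c)
    (hb : ∀ u, c ≤ rBar f S r u) (hβ : 0 < β) (hL : 0 ≤ L) (hL₂ : 0 ≤ L₂) (hL₃ : 0 ≤ L₃)
    (hg : LocHolder g β L) (hr : ∀ x, g x ∈ Set.Icc lo hi)
    (hκ : ∀ u u' : S → ℝ, ‖u - u'‖ ≤ 1 → tvDist (κ u) (κ u') ≤ L₂ * ‖u - u'‖ ^ β)
    (hs : LocHolder (rBar f S r) β L₃) :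
    LocHolder (stepBar f S r lam κ g) β (L + (hi - lo) * (L₂ + L₃ / (4 * c))) := by
  intro x x' hx
  have hgm : Measurable g := (hg.continuous hβ).measurable
  have hpos (u) : 0 < rBar f S r u := hc.trans_le (hb u)
  have hlh : 0 ≤ hi - lo := sub_nonneg.2 ((hr 0).1.trans (hr 0).2)
  have hθ := thetaBar_mem_Icc hlam (hs.continuous hβ).measurable hpos hgm hr
  have hmean' := condMean_mem_Icc (κ := κ) hgm hr (S.restrict x')
  have hw := wBar_mem_Icc hlam hpos x
  rw [stepBar_eq hgm hr, stepBar_eq hgm hr]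
  set θ := thetaBar f S r lam g
  set w := wBar f S r lam
  set G := fun y : Pt d => condMean S κ g (S.restrict y)
  have mean_diff : |G x - G x'| ≤ (L + (hi - lo) * L₂) * ‖x - x'‖ ^ β :=
    (locHolder_condMean hg hβ hL hr hκ).comp_restrict hβ.le
      (add_nonneg hL (mul_nonneg hlh hL₂)) x x' hx
  have weight_diff : |w x - w x'| ≤ L₃ * ‖x - x'‖ ^ β / (4 * c) :=
    (abs_weight_one_sub_weight_one_le hlam hc (hb _) (hb _)).trans
      (div_le_div_of_nonneg_right (hs.comp_restrict hβ.le hL₃ x x' hx) (by positivity))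
  have centred_le : |G x' - θ| ≤ hi - lo := by
    rw [abs_le]
    constructor <;> linarith [hθ.1, hθ.2, hmean'.1, hmean'.2]
  calc |w x * (G x - θ) - w x' * (G x' - θ)|
      = |w x * (G x - G x') + (w x - w x') * (G x' - θ)| := by ring_nf
    _ ≤ |w x * (G x - G x')| + |(w x - w x') * (G x' - θ)| := abs_add_le _ _
    _ ≤ 1 * ((L + (hi - lo) * L₂) * ‖x - x'‖ ^ β)
          + L₃ * ‖x - x'‖ ^ β / (4 * c) * (hi - lo) := by
        rw [abs_mul, abs_mul, abs_of_nonneg hw.1]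
        exact add_le_add (mul_le_mul hw.2 mean_diff (abs_nonneg _) zero_le_one)
          (mul_le_mul weight_diff centred_le (abs_nonneg _) ((abs_nonneg _).trans weight_diff))
    _ = (L + (hi - lo) * (L₂ + L₃ / (4 * c))) * ‖x - x'‖ ^ β := by ring

end Population

section Iteration

variable {𝕊 : Finset (Finset (Fin d))} {f : Pt d → ℝ}
  {κ : ∀ S : Finset (Fin d), Kernel (S → ℝ) (↥Sᶜ → ℝ)} {r : ∀ S : Finset (Fin d), (S → ℝ) → ℝ}
  {lam : Finset (Fin d) → ℝ} {a : Pt d → ℝ} {β L₁ L₂ L₃ c a₀ : ℝ}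

theorem exists_aBar_mem_Icc_and_locHolder_aBar [IsProbabilityMeasure (law f)]
    (hκ : ∀ S ∈ 𝕊, IsMarkovKernel (κ S)) (hlam : ∀ S ∈ 𝕊, 0 < lam S) (ha : ∀ x, |a x| ≤ a₀)
    (hβ : 0 < β) (hL₁ : 0 ≤ L₁) (hL₂ : 0 ≤ L₂) (hL₃ : 0 ≤ L₃) (hA1 : A1 a β L₁)
    (hA2 : A2 𝕊 κ β L₂) (hA3 : A3 𝕊 f r β L₃) (hc : 0 < c)
    (hb : ∀ S ∈ 𝕊, ∀ u, c ≤ rBar f S (r S) u) (m : ℕ) (Ss : Fin m → Finset (Fin d))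
    (hSs : ∀ j, Ss j ∈ 𝕊) :
    (∃ lo hi, 0 ∈ Set.Icc lo hi ∧ hi - lo ≤ 2 * a₀ ∧
      ∀ x, aBar f r lam κ a m Ss x ∈ Set.Icc lo hi) ∧
    LocHolder (aBar f r lam κ a m Ss) β (L₁ + m * (2 * a₀ * (L₂ + L₃ / (4 * c)))) := by
  have ha₀ : 0 ≤ a₀ := (abs_nonneg _).trans (ha 0)
  induction m with
  | zero =>
    refine ⟨⟨-a₀, a₀, ⟨by linarith, ha₀⟩, by linarith, fun x => abs_le.1 (ha x)⟩, ?_⟩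
    rw [Nat.cast_zero, zero_mul, add_zero]
    exact hA1
  | succ m ih =>
    obtain ⟨⟨lo, hi, -, hlh, hr⟩, hH⟩ := ih (fun j => Ss j.castSucc) fun j => hSs _
    have hS := hSs (Fin.last m)
    have := hκ _ hS
    have hs : LocHolder (rBar f _ (r (Ss (Fin.last m)))) β L₃ := hA3 _ hS
    have hs_meas := (hs.continuous hβ).measurable
    have hpos (u) := hc.trans_le (hb _ hS u)
    have hg_meas := (hH.continuous hβ).measurable
    have hθ := thetaBar_mem_Icc (hlam _ hS) hs_meas hpos hg_meas hr
    refine ⟨⟨_, _, ⟨sub_nonpos.2 hθ.1, sub_nonneg.2 hθ.2⟩, ?_,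
      stepBar_mem_Icc (hlam _ hS) hs_meas hpos hg_meas hr⟩, fun x x' hx => ?_⟩
    · rwa [sub_sub_sub_cancel_right]
    · refine (locHolder_stepBar (hlam _ hS) hc (hb _ hS) hβ (by positivity) hL₂ hL₃ hH hr
        (hA2 _ hS) hs x x' hx).trans (mul_le_mul_of_nonneg_right ?_ (by positivity))
      calc L₁ + m * (2 * a₀ * (L₂ + L₃ / (4 * c))) + (hi - lo) * (L₂ + L₃ / (4 * c))
          ≤ L₁ + m * (2 * a₀ * (L₂ + L₃ / (4 * c))) + 2 * a₀ * (L₂ + L₃ / (4 * c)) := by gcongr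
        _ = L₁ + (m + 1 : ℕ) * (2 * a₀ * (L₂ + L₃ / (4 * c))) := by push_cast; ring

end Iteration

section Kernel

theorem norm_glue_le_iff (S : Finset (Fin d)) (u : S → ℝ) (v : ↥Sᶜ → ℝ) {t : ℝ} (ht : 0 ≤ t) :
    ‖glue S u v‖ ≤ t ↔ ‖u‖ ≤ t ∧ ‖v‖ ≤ t := by
  simp only [pi_norm_le_iff_of_nonneg ht, glue]
  refine ⟨fun H => ⟨fun s => by simpa using H s, fun s => ?_⟩, fun ⟨hu, hv⟩ j => ?_⟩
  · have := H s
    rwa [dif_neg (Finset.mem_compl.1 s.2)] at this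
  · split_ifs with hj
    exacts [hu _, hv _]

theorem margKernel_eq_indicator (S : Finset (Fin d)) (u : S → ℝ) :
    margKernel S u = (Metric.closedBall 0 1).indicator
      (fun _ => volume.real (Metric.closedBall (0 : ↥Sᶜ → ℝ) 1) * ((2 : ℝ) ^ d)⁻¹) u := by
  classical
  have unifKernel_glue (v : ↥Sᶜ → ℝ) : unifKernel (glue S u v)
      = (Metric.closedBall 0 1).indicator
        (fun _ => (Metric.closedBall 0 1).indicator (fun _ => ((2 : ℝ) ^ d)⁻¹) u) v := by
    simp only [unifKernel, norm_glue_le_iff S u v zero_le_one, Set.indicator_apply,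
      mem_closedBall_zero_iff, ite_and]
    split_ifs <;> rfl
  simp only [margKernel, unifKernel_glue]
  rw [integral_indicator_const _ measurableSet_closedBall, smul_eq_mul]
  simp only [Set.indicator_apply, mul_ite, mul_zero]

theorem exists_scaledKernel_sub_eq_mul_near (S : Finset (Fin d)) {h : ℝ} (hh : 0 < h) :
    ∃ k : ℝ, k ≠ 0 ∧ ∀ x y : Pt d,
      scaledKernel S h (S.restrict x - S.restrict y) = k * near S.restrict h x y := by
  have hvol : 0 < volume.real (Metric.closedBall (0 : ↥Sᶜ → ℝ) 1) :=
    ENNReal.toReal_pos (Metric.measure_closedBall_pos volume _ one_pos).ne'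
      measure_closedBall_lt_top.ne
  refine ⟨(h ^ S.card)⁻¹ * (volume.real (Metric.closedBall (0 : ↥Sᶜ → ℝ) 1) * ((2 : ℝ) ^ d)⁻¹),
    by positivity, fun x y => ?_⟩
  have hscale : ‖h⁻¹ • (S.restrict x - S.restrict y)‖ ≤ 1 ↔ ‖S.restrict x - S.restrict y‖ ≤ h := by
    rw [norm_smul, norm_inv, Real.norm_of_nonneg hh.le, inv_mul_le_iff₀ hh, mul_one]
  classical
  rw [scaledKernel, margKernel_eq_indicator, near, Set.indicator_apply]
  simp only [mem_closedBall_zero_iff, hscale, mul_ite, mul_zero, mul_one]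

end Kernel

section Step

variable {S : Finset (Fin d)} {r : (S → ℝ) → ℝ} {lam T h : ℝ}

theorem mean_mul_scaledKernel_div_fHat (S : Finset (Fin d)) (hh : 0 < h) (D : Finset (Fin n))
    (z : Fin n → Pt d) (y : Fin n → ℝ) (x : Pt d) :
    (D.card : ℝ)⁻¹ * ∑ i ∈ D, y i *
        (scaledKernel S h (S.restrict x - S.restrict (z i)) / fHat S h D z (S.restrict x))
      = (∑ i ∈ D, near S.restrict h x (z i) * y i) / nearCount S.restrict h D z x := by
  obtain ⟨k, hk, hK⟩ := exists_scaledKernel_sub_eq_mul_near S hh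
  have fHat_eq : fHat S h D z (S.restrict x)
      = (D.card : ℝ)⁻¹ * (k * nearCount S.restrict h D z x) := by
    simp only [fHat, nearCount, hK, Finset.mul_sum]
  rcases D.eq_empty_or_nonempty with rfl | hD
  · simp
  have hcard : (D.card : ℝ) ≠ 0 := by exact_mod_cast hD.card_pos.ne'
  rw [fHat_eq, Finset.mul_sum, Finset.sum_div]
  refine Finset.sum_congr rfl fun i _ => ?_
  rw [hK]
  rcases eq_or_ne (nearCount S.restrict h D z x) 0 with hN | hN
  · simp [hN]
  · field_simp

open Classical in
theorem stepHat_eq (r : (S → ℝ) → ℝ) (lam T : ℝ) (hh : 0 < h) (D : Finset (Fin n))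
    (z : Fin n → Pt d) (g : Pt d → ℝ) (x : Pt d) :
    stepHat S r lam T h D z g x = if ‖S.restrict x‖ ≤ T then
      wHat S r lam D z x *
        ((∑ i ∈ D, near S.restrict h x (z i) * trunc T g (z i)) / nearCount S.restrict h D z x
          - (∑ i ∈ D, wHat S r lam D z (z i) * trunc T g (z i)) / ∑ i ∈ D, wHat S r lam D z (z i))
      else 0 := by
  rw [stepHat, mean_mul_scaledKernel_div_fHat S hh D z fun i => trunc T g (z i)]

theorem rHat_congr (r : (S → ℝ) → ℝ) {D : Finset (Fin n)} {z z' : Fin n → Pt d}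
    (hz : ∀ i ∈ D, z i = z' i) : rHat S r D z = rHat S r D z' := by
  rw [rHat, rHat, Finset.sum_congr rfl fun i hi => by rw [hz i hi]]

theorem stepHat_congr (r : (S → ℝ) → ℝ) (lam T h : ℝ) {D : Finset (Fin n)}
    {z z' : Fin n → Pt d} (g : Pt d → ℝ) (hz : ∀ i ∈ D, z i = z' i) :
    stepHat S r lam T h D z g = stepHat S r lam T h D z' g := by
  have sum_congr (F : Pt d → ℝ) : ∑ i ∈ D, F (z i) = ∑ i ∈ D, F (z' i) :=
    Finset.sum_congr rfl fun i hi => by rw [hz i hi]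
  have wHat_congr : wHat S r lam D z = wHat S r lam D z' := by
    funext y
    rw [wHat, wHat, rHat_congr r hz]
  have fHat_congr : fHat S h D z = fHat S h D z' := by
    funext u
    rw [fHat, fHat, sum_congr fun y => scaledKernel S h (u - S.restrict y)]
  funext x
  simp only [stepHat, wHat_congr, fHat_congr]
  rw [sum_congr fun y => trunc T g y * (scaledKernel S h (S.restrict x - S.restrict y)
    / fHat S h D z' (S.restrict x)), sum_congr fun y => wHat S r lam D z' y * trunc T g y,
    sum_congr (wHat S r lam D z')]

theorem aHat_congr (r : ∀ S : Finset (Fin d), (S → ℝ) → ℝ) (lam : Finset (Fin d) → ℝ) (T h : ℝ)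
    (D : ℕ → Finset (Fin n)) (a : Pt d → ℝ) {z z' : Fin n → Pt d} (m : ℕ)
    (Ss : Fin m → Finset (Fin d)) (hz : ∀ k ∈ Finset.Icc 1 m, ∀ i ∈ D k, z i = z' i) :
    aHat r lam T h D z a m Ss = aHat r lam T h D z' a m Ss := by
  induction m with
  | zero => rfl
  | succ m ih =>
    have hz_init : ∀ k ∈ Finset.Icc 1 m, ∀ i ∈ D k, z i = z' i := fun k hk =>
      hz k (Finset.Icc_subset_Icc_right m.le_succ hk)
    rw [aHat, aHat, ih (fun j => Ss j.castSucc) hz_init]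
    exact stepHat_congr _ _ _ _ _ (hz (m + 1) (Finset.mem_Icc.2 ⟨by omega, le_rfl⟩))

theorem wHat_rBar {f : Pt d → ℝ} (hI : ∫ x, r (S.restrict x) ∂(law f) ≠ 0) (lam : ℝ)
    (D : Finset (Fin n)) (z : Fin n → Pt d) :
    wHat S (rBar f S r) lam D z = wHat S r lam D z := by
  have rHat_rBar : rHat S (rBar f S r) D z = rHat S r D z / ∫ x, r (S.restrict x) ∂(law f) := by
    simp only [rHat, rBar, ← Finset.sum_div, mul_div_assoc]
  funext x
  simp only [wHat, rHat_rBar, rBar, ← mul_div_assoc, ← add_div]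
  exact div_div_div_cancel_right₀ hI _ _

theorem stepHat_rBar {f : Pt d → ℝ} (hI : ∫ x, r (S.restrict x) ∂(law f) ≠ 0) (lam T h : ℝ)
    (D : Finset (Fin n)) (z : Fin n → Pt d) (g : Pt d → ℝ) :
    stepHat S (rBar f S r) lam T h D z g = stepHat S r lam T h D z g := by
  unfold stepHat
  rw [wHat_rBar hI]

section Measurability

variable {φ : (Fin n → Pt d) → Pt d → ℝ}

theorem measurable_trunc (T : ℝ) (hφ : Measurable fun p : Pt d × (Fin n → Pt d) => φ p.2 p.1) :
    Measurable fun p : Pt d × (Fin n → Pt d) => trunc T (φ p.2) p.1 :=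
  Measurable.ite (measurableSet_le measurable_fst.norm measurable_const) hφ measurable_const

theorem measurable_wHat (hr : Measurable r) (lam : ℝ) (D : Finset (Fin n)) :
    Measurable fun p : Pt d × (Fin n → Pt d) => wHat S r lam D p.2 p.1 := by
  have hr_restrict : Measurable fun x : Pt d => r (S.restrict x) :=
    hr.comp (Finset.measurable_restrict S)
  have measurable_rHat : Measurable fun p : Pt d × (Fin n → Pt d) => rHat S r D p.2 :=
    (Finset.measurable_fun_sum _ fun i _ =>
      hr_restrict.comp ((measurable_pi_apply i).comp measurable_snd)).const_mul _
  have hnum : Measurable fun p : Pt d × (Fin n → Pt d) => lam * r (S.restrict p.1) :=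
    (hr_restrict.comp measurable_fst).const_mul lam
  exact hnum.div (measurable_rHat.add hnum)

theorem measurable_stepHat (hr : Measurable r) (lam T : ℝ) (hh : 0 < h) (D : Finset (Fin n))
    (hφ : Measurable fun p : Pt d × (Fin n → Pt d) => φ p.2 p.1) :
    Measurable fun p : Pt d × (Fin n → Pt d) => stepHat S r lam T h D p.2 (φ p.2) p.1 := by
  have hS := Finset.measurable_restrict (X := fun _ : Fin d => ℝ) S
  have heval (i : Fin n) : Measurable fun p : Pt d × (Fin n → Pt d) => p.2 i :=
    (measurable_pi_apply i).comp measurable_snd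
  have hswap (i : Fin n) : Measurable fun p : Pt d × (Fin n → Pt d) => (p.2 i, p.2) :=
    (heval i).prodMk measurable_snd
  have hw := measurable_wHat (n := n) hr lam D
  have hwi (i : Fin n) : Measurable fun p : Pt d × (Fin n → Pt d) => wHat S r lam D p.2 (p.2 i) :=
    hw.comp (hswap i)
  have hti (i : Fin n) : Measurable fun p : Pt d × (Fin n → Pt d) => trunc T (φ p.2) (p.2 i) :=
    (measurable_trunc T hφ).comp (hswap i)
  simp only [stepHat_eq r lam T hh]
  refine Measurable.ite (measurableSet_le (hS.comp measurable_fst).norm measurable_const)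
    (hw.mul (Measurable.sub ?_ ?_)) measurable_const
  · exact (Finset.measurable_fun_sum _ fun i _ =>
      (measurable_near h hS measurable_fst (heval i)).mul (hti i)).div
        (measurable_nearCount h hS D measurable_fst measurable_snd)
  · exact (Finset.measurable_fun_sum _ fun i _ => (hwi i).mul (hti i)).div
      (Finset.measurable_fun_sum _ fun i _ => hwi i)

theorem measurable_aHat {𝕊 : Finset (Finset (Fin d))} {r : ∀ S : Finset (Fin d), (S → ℝ) → ℝ}
    (hr : ∀ S ∈ 𝕊, Measurable (r S)) (lam : Finset (Fin d) → ℝ) (T : ℝ) (hh : 0 < h)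
    (D : ℕ → Finset (Fin n)) {a : Pt d → ℝ} (ha : Measurable a) (m : ℕ)
    (Ss : Fin m → Finset (Fin d)) (hSs : ∀ j, Ss j ∈ 𝕊) :
    Measurable fun p : Pt d × (Fin n → Pt d) => aHat r lam T h D p.2 a m Ss p.1 := by
  induction m with
  | zero => exact ha.comp measurable_fst
  | succ m ih =>
    exact measurable_stepHat (φ := fun z => aHat r lam T h D z a m fun j => Ss j.castSucc)
      (hr _ (hSs (Fin.last m))) _ T hh (D (m + 1)) (ih _ fun j => hSs _)

end Measurability

end Step

section WeightedAverageError

variable {ι : Type*} (I : Finset ι) {p q y : ι → ℝ} {lo hi ε Λ : ℝ}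

theorem abs_sum_mul_div_sum_sub_le (hq : ∀ i ∈ I, 0 ≤ q i) (hP : 0 < ∑ i ∈ I, p i)
    (hQ : 0 < ∑ i ∈ I, q i) (hpq : ∀ i ∈ I, |p i - q i| ≤ p i * ε)
    (hy : ∀ i ∈ I, y i ∈ Set.Icc lo hi) (h0 : (0 : ℝ) ∈ Set.Icc lo hi) :
    |(∑ i ∈ I, p i * y i) / ∑ i ∈ I, p i - (∑ i ∈ I, q i * y i) / ∑ i ∈ I, q i|
      ≤ (hi - lo) * ε := by
  set m := (∑ i ∈ I, q i * y i) / ∑ i ∈ I, q i with hm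
  have hm_mem : m ∈ Set.Icc lo hi := sum_mul_div_sum_mem_Icc I hq hy h0
  have centred : ∑ i ∈ I, q i * (y i - m) = 0 := by
    simp only [mul_sub, Finset.sum_sub_distrib, ← Finset.sum_mul]
    rw [hm, mul_div_cancel₀ _ hQ.ne', sub_self]
  have diff_eq : (∑ i ∈ I, p i * y i) / ∑ i ∈ I, p i - m
      = (∑ i ∈ I, (p i - q i) * (y i - m)) / ∑ i ∈ I, p i := by
    simp only [sub_mul (p _), Finset.sum_sub_distrib, centred, sub_zero]
    rw [div_sub' hP.ne', Finset.sum_mul, ← Finset.sum_sub_distrib]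
    simp only [mul_sub]
  rw [diff_eq, abs_div, abs_of_pos hP, div_le_iff₀ hP]
  calc |∑ i ∈ I, (p i - q i) * (y i - m)| ≤ ∑ i ∈ I, |(p i - q i) * (y i - m)| :=
        Finset.abs_sum_le_sum_abs _ _
    _ ≤ ∑ i ∈ I, p i * ε * (hi - lo) := by
        refine Finset.sum_le_sum fun i hi' => ?_
        rw [abs_mul]
        exact mul_le_mul (hpq i hi')
          (abs_sub_le_of_le_of_le (hy i hi').1 (hy i hi').2 hm_mem.1 hm_mem.2)
          (abs_nonneg _) ((abs_nonneg _).trans (hpq i hi'))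
    _ = (hi - lo) * ε * ∑ i ∈ I, p i := by
        rw [← Finset.sum_mul, ← Finset.sum_mul]; ring

theorem sq_sum_mul_div_sum_le_mul_mean (y : ι → ℝ) (hp : ∀ i ∈ I, 0 ≤ p i)
    (hP : 0 < ∑ i ∈ I, p i) (hΛ : ∀ i ∈ I, ∀ j ∈ I, p i ≤ Λ * p j) :
    ((∑ i ∈ I, p i * y i) / ∑ i ∈ I, p i) ^ 2 ≤ Λ * ((I.card : ℝ)⁻¹ * ∑ i ∈ I, y i ^ 2) := by
  have hI : I.Nonempty := Finset.nonempty_of_sum_ne_zero hP.ne'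
  have hcard : (0 : ℝ) < I.card := by exact_mod_cast hI.card_pos
  have le_mean : ∀ i ∈ I, p i ≤ (I.card : ℝ)⁻¹ * (Λ * ∑ j ∈ I, p j) := fun i hi => by
    rw [le_inv_mul_iff₀ hcard, Finset.mul_sum, ← nsmul_eq_mul, ← Finset.sum_const]
    exact Finset.sum_le_sum fun j hj => hΛ i hi j hj
  refine (sq_sum_mul_div_sum_le I y hp).trans ((div_le_iff₀ hP).2 ?_)
  calc ∑ i ∈ I, p i * y i ^ 2
      ≤ ∑ i ∈ I, (I.card : ℝ)⁻¹ * (Λ * ∑ j ∈ I, p j) * y i ^ 2 :=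
        Finset.sum_le_sum fun i hi => mul_le_mul_of_nonneg_right (le_mean i hi) (sq_nonneg _)
    _ = Λ * ((I.card : ℝ)⁻¹ * ∑ i ∈ I, y i ^ 2) * ∑ i ∈ I, p i := by
        rw [← Finset.mul_sum]; ring

theorem sum_mul_div_sum_sub_eq (hP : ∑ i ∈ I, p i ≠ 0) (y' : ι → ℝ) (t : ℝ) :
    (∑ i ∈ I, p i * y' i) / ∑ i ∈ I, p i - t
      = (∑ i ∈ I, p i * (y' i - y i)) / ∑ i ∈ I, p i
        + (∑ i ∈ I, p i * (y i - t)) / ∑ i ∈ I, p i := by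
  rw [← add_div, ← Finset.sum_add_distrib, div_sub' hP, Finset.sum_mul, ← Finset.sum_sub_distrib]
  congr 1
  exact Finset.sum_congr rfl fun i _ => by ring

end WeightedAverageError

section LocalAverageError

variable {E σ ι : Type*} [Fintype σ] (π : E → σ → ℝ) (h : ℝ) (D : Finset ι) (z : ι → E) (x : E)

open Classical in
theorem sum_near_mul_div_nearCount_sub_eq (y y' m : ι → ℝ) (t : ℝ) :
    (∑ i ∈ D, near π h x (z i) * y' i) / nearCount π h D z x - t
      = (∑ i ∈ D, near π h x (z i) * (y' i - y i)) / nearCount π h D z x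
        + ∑ i ∈ D, near π h x (z i) / nearCount π h D z x * (y i - m i)
        + ∑ i ∈ D, near π h x (z i) / nearCount π h D z x * (m i - t)
        - if nearCount π h D z x = 0 then t else 0 := by
  split_ifs with hN
  · simp [hN]
  · rw [sub_zero, add_assoc, ← Finset.sum_add_distrib]
    refine (sum_mul_div_sum_sub_eq D hN (y := y) y' t).trans (congrArg₂ (· + ·) rfl ?_)
    rw [Finset.sum_div]
    exact Finset.sum_congr rfl fun i _ => by rw [nearCount]; ring

theorem abs_sum_near_div_nearCount_mul_le {e : ι → ℝ} {b : ℝ} (hb0 : 0 ≤ b)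
    (hb : ∀ i ∈ D, ‖π x - π (z i)‖ ≤ h → |e i| ≤ b) :
    |∑ i ∈ D, near π h x (z i) / nearCount π h D z x * e i| ≤ b := by
  have hN := nearCount_nonneg π h D z x
  calc |∑ i ∈ D, near π h x (z i) / nearCount π h D z x * e i|
      ≤ ∑ i ∈ D, |near π h x (z i) / nearCount π h D z x * e i| := Finset.abs_sum_le_sum_abs _ _
    _ ≤ ∑ i ∈ D, near π h x (z i) / nearCount π h D z x * b := by
        refine Finset.sum_le_sum fun i hi => ?_
        rw [abs_mul, abs_of_nonneg (div_nonneg (near_nonneg _ _ _ _) hN)]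
        by_cases hnear : ‖π x - π (z i)‖ ≤ h
        · exact mul_le_mul_of_nonneg_left (hb i hi hnear) (div_nonneg (near_nonneg _ _ _ _) hN)
        · simp [near, hnear]
    _ = nearCount π h D z x / nearCount π h D z x * b := by
        rw [← Finset.sum_mul, ← Finset.sum_div]; rfl
    _ ≤ b := mul_le_of_le_one_left hb0 (div_self_le_one _)

end LocalAverageError

section StepError

theorem sq_error_le {w t₁ t₂ r₁ r₀ r₂ r₄ δ : ℝ} (hw : w ∈ Set.Icc (0 : ℝ) 1) (h : r₁ * r₀ = 0) :
    (w * ((t₁ + r₁ + r₂ - r₀) - (t₂ + r₄)) + δ) ^ 2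
      ≤ 3 * t₁ ^ 2 + 3 * t₂ ^ 2 + 12 * (r₁ ^ 2 + r₀ ^ 2 + r₂ ^ 2 + r₄ ^ 2 + δ ^ 2) := by
  have sq_three (A B E : ℝ) : (A - B + E) ^ 2 ≤ 3 * A ^ 2 + 3 * B ^ 2 + 3 * E ^ 2 := by
    nlinarith [sq_nonneg (A + B), sq_nonneg (A - E), sq_nonneg (B + E)]
  have sq_four (F G H J : ℝ) : (F + G - H + J) ^ 2 ≤ 4 * (F ^ 2 + G ^ 2 + H ^ 2 + J ^ 2) := by
    nlinarith [sq_nonneg (F - G), sq_nonneg (F + H), sq_nonneg (F - J), sq_nonneg (G + H),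
      sq_nonneg (G - J), sq_nonneg (H + J)]
  have sq_mul_le (t : ℝ) : (w * t) ^ 2 ≤ t ^ 2 := by
    rw [mul_pow]
    exact mul_le_of_le_one_left (sq_nonneg _) (pow_le_one₀ hw.1 hw.2)
  have sq_sub_eq : (r₁ - r₀) ^ 2 = r₁ ^ 2 + r₀ ^ 2 := by linear_combination (-2) * h
  have split : w * ((t₁ + r₁ + r₂ - r₀) - (t₂ + r₄)) + δ
      = w * t₁ - w * t₂ + (w * (r₁ - r₀) + w * r₂ - w * r₄ + δ) := by ring
  rw [split]
  linarith [sq_three (w * t₁) (w * t₂) (w * (r₁ - r₀) + w * r₂ - w * r₄ + δ),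
    sq_four (w * (r₁ - r₀)) (w * r₂) (w * r₄) δ, sq_mul_le t₁, sq_mul_le t₂, sq_mul_le (r₁ - r₀),
    sq_mul_le r₂, sq_mul_le r₄, sq_sub_eq]

variable {S : Finset (Fin d)} {s : (S → ℝ) → ℝ} {lam T h c C θ lo hi b : ℝ} {D : Finset (Fin n)}
  {g gh : Pt d → ℝ} {G : (S → ℝ) → ℝ}

theorem rHat_pos (hD : D.Nonempty) (hs : ∀ u, 0 < s u) (z : Fin n → Pt d) : 0 < rHat S s D z :=
  mul_pos (inv_pos.2 (by exact_mod_cast hD.card_pos)) (Finset.sum_pos (fun _ _ => hs _) hD)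

theorem sq_weight_error_le {wh w e δ ρ V : ℝ} (hwh : wh ∈ Set.Icc 0 1)
    (hw : |wh - w| ≤ wh * |1 - ρ|) (he : |e| ≤ V) (hδ : |δ| ≤ V * |1 - ρ|) :
    ((wh - w) * e - wh * δ) ^ 2 ≤ 4 * V ^ 2 * (1 - ρ) ^ 2 := by
  have weight_diff : |(wh - w) * e| ≤ |1 - ρ| * V := by
    rw [abs_mul]
    exact mul_le_mul (hw.trans (mul_le_of_le_one_left (abs_nonneg _) hwh.2)) he (abs_nonneg _)
      (abs_nonneg _)
  have mean_diff : |wh * δ| ≤ V * |1 - ρ| := by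
    rw [abs_mul, abs_of_nonneg hwh.1]
    exact (mul_le_of_le_one_left (abs_nonneg _) hwh.2).trans hδ
  have abs_le : |(wh - w) * e - wh * δ| ≤ 2 * V * |1 - ρ| := by
    linarith [abs_sub ((wh - w) * e) (wh * δ)]
  calc ((wh - w) * e - wh * δ) ^ 2 ≤ (2 * V * |1 - ρ|) ^ 2 := by
        rw [← sq_abs]; exact pow_le_pow_left₀ (abs_nonneg _) abs_le 2
    _ = 4 * V ^ 2 * (1 - ρ) ^ 2 := by rw [mul_pow, sq_abs]; ring

theorem abs_wHat_mean_sub_weight_mean_le (hD : D.Nonempty) (z : Fin n → Pt d)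
    (hs : ∀ u, 0 < s u) (hlam : 0 < lam) (hg : ∀ x, g x ∈ Set.Icc lo hi) (hθ : θ ∈ Set.Icc lo hi) :
    |(∑ i ∈ D, wHat S s lam D z (z i) * (g (z i) - θ)) / ∑ i ∈ D, wHat S s lam D z (z i)
        - (∑ i ∈ D, weight lam 1 (s (S.restrict (z i))) * (g (z i) - θ))
          / ∑ i ∈ D, weight lam 1 (s (S.restrict (z i)))|
      ≤ (hi - lo) * |1 - rHat S s D z| := by
  have hρ := rHat_pos hD hs z
  have w_pos (y : Pt d) : 0 < weight lam 1 (s (S.restrict y)) := weight_pos hlam one_pos (hs _)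
  have wh_pos (y) : 0 < wHat S s lam D z y := weight_pos hlam hρ (hs _)
  rw [← sub_sub_sub_cancel_right hi lo θ]
  exact abs_sum_mul_div_sum_sub_le D (fun i _ => (w_pos (z i)).le)
    (Finset.sum_pos (fun _ _ => wh_pos _) hD) (Finset.sum_pos (fun _ _ => w_pos _) hD)
    (fun i _ => abs_weight_sub_weight_one_le hlam hρ (hs _))
    (fun i _ => ⟨sub_le_sub_right (hg (z i)).1 θ, sub_le_sub_right (hg (z i)).2 θ⟩)
    ⟨sub_nonpos.2 hθ.1, sub_nonneg.2 hθ.2⟩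

open Classical in
theorem stepHat_sub_eq (z : Fin n → Pt d) (hh : 0 < h)
    (hP : ∑ i ∈ D, wHat S s lam D z (z i) ≠ 0) (w : Pt d → ℝ) {x : Pt d}
    (hx : ‖S.restrict x‖ ≤ T) :
    stepHat S s lam T h D z gh x - w x * (G (S.restrict x) - θ)
      = wHat S s lam D z x *
          (((∑ i ∈ D, near S.restrict h x (z i) * (trunc T gh (z i) - g (z i)))
                / nearCount S.restrict h D z x
              + ∑ i ∈ D, near S.restrict h x (z i) / nearCount S.restrict h D z x
                * (g (z i) - G (S.restrict (z i)))
              + ∑ i ∈ D, near S.restrict h x (z i) / nearCount S.restrict h D z x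
                * (G (S.restrict (z i)) - G (S.restrict x))
              - if nearCount S.restrict h D z x = 0 then G (S.restrict x) else 0)
            - ((∑ i ∈ D, wHat S s lam D z (z i) * (trunc T gh (z i) - g (z i)))
                / ∑ i ∈ D, wHat S s lam D z (z i)
              + (∑ i ∈ D, w (z i) * (g (z i) - θ)) / ∑ i ∈ D, w (z i)))
        + ((wHat S s lam D z x - w x) * (G (S.restrict x) - θ)
          - wHat S s lam D z x *
            ((∑ i ∈ D, wHat S s lam D z (z i) * (g (z i) - θ)) / ∑ i ∈ D, wHat S s lam D z (z i)
              - (∑ i ∈ D, w (z i) * (g (z i) - θ)) / ∑ i ∈ D, w (z i))) := by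
  rw [stepHat_eq s lam T hh, if_pos hx]
  linear_combination wHat S s lam D z x *
    (sum_near_mul_div_nearCount_sub_eq S.restrict h D z x (fun i => g (z i))
      (fun i => trunc T gh (z i)) (fun i => G (S.restrict (z i))) (G (S.restrict x))
    - sum_mul_div_sum_sub_eq D hP (y := fun i => g (z i)) (fun i => trunc T gh (z i)) θ)

open Classical in
theorem sq_stepHat_sub_le (hD : D.Nonempty) (z : Fin n → Pt d) (hc : 0 < c)
    (hs : ∀ u, s u ∈ Set.Icc c C) (hlam : 0 < lam) (hh : 0 < h) (h0 : (0 : ℝ) ∈ Set.Icc lo hi)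
    (hg : ∀ x, g x ∈ Set.Icc lo hi) (hG : ∀ u, G u ∈ Set.Icc lo hi) (hθ : θ ∈ Set.Icc lo hi)
    (hb : ∀ u u' : S → ℝ, ‖u - u'‖ ≤ h → |G u - G u'| ≤ b) {x : Pt d}
    (hx : ‖S.restrict x‖ ≤ T) :
    (stepHat S s lam T h D z gh x
        - weight lam 1 (s (S.restrict x)) * (G (S.restrict x) - θ)) ^ 2
      ≤ 3 * ((∑ i ∈ D, near S.restrict h x (z i) * (trunc T gh (z i) - g (z i)) ^ 2)
            / nearCount S.restrict h D z x)
        + 3 * (C / c * ((D.card : ℝ)⁻¹ * ∑ i ∈ D, (trunc T gh (z i) - g (z i)) ^ 2))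
        + 12 * ((∑ i ∈ D, near S.restrict h x (z i) / nearCount S.restrict h D z x
              * (g (z i) - G (S.restrict (z i)))) ^ 2
            + (if nearCount S.restrict h D z x = 0 then (hi - lo) ^ 2 else 0) + b ^ 2
            + ((∑ i ∈ D, weight lam 1 (s (S.restrict (z i))) * (g (z i) - θ))
              / ∑ i ∈ D, weight lam 1 (s (S.restrict (z i)))) ^ 2
            + 4 * (hi - lo) ^ 2 * (1 - rHat S s D z) ^ 2) := by
  have hs_pos (u) : 0 < s u := hc.trans_le (hs u).1
  have hρ := rHat_pos hD hs_pos z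
  have hb0 : 0 ≤ b := (abs_nonneg _).trans (hb 0 0 (by simpa using hh.le))
  set w : Pt d → ℝ := fun y => weight lam 1 (s (S.restrict y))
  have wh_mem (y) : wHat S s lam D z y ∈ Set.Icc 0 1 := weight_mem_Icc hlam hρ (hs_pos _)
  have wh_pos (y) : 0 < wHat S s lam D z y := weight_pos hlam hρ (hs_pos _)
  have sum_wh_pos : 0 < ∑ i ∈ D, wHat S s lam D z (z i) :=
    Finset.sum_pos (fun _ _ => wh_pos _) hD
  have abs_G_le : |G (S.restrict x)| ≤ hi - lo := by
    simpa using abs_sub_le_of_le_of_le (hG (S.restrict x)).1 (hG _).2 h0.1 h0.2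
  have bias_le : |∑ i ∈ D, near S.restrict h x (z i) / nearCount S.restrict h D z x
      * (G (S.restrict (z i)) - G (S.restrict x))| ≤ b :=
    abs_sum_near_div_nearCount_mul_le S.restrict h D z x
      (e := fun i => G (S.restrict (z i)) - G (S.restrict x)) hb0
      fun i _ hnear => hb _ _ ((norm_sub_rev _ _).trans_le hnear)
  rw [stepHat_sub_eq (g := g) z hh sum_wh_pos.ne' w hx]
  refine (sq_error_le (wh_mem x) ?_).trans ?_
  · split_ifs with hN <;> simp [hN]
  gcongr ?_ * ?_ + ?_ * ?_ + ?_ * (?_ + ?_ + ?_ + ?_ + ?_)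
  · exact sq_sum_mul_div_sum_le D _ fun i _ => near_nonneg _ _ _ _
  · exact sq_sum_mul_div_sum_le_mul_mean D _ (fun i _ => (wh_pos _).le) sum_wh_pos
      fun i _ j _ => weight_le_mul_weight hlam hρ hc (hs _).1 (hs _).2 (hs _).1
  · rfl
  · split_ifs
    · exact sq_le_sq' (neg_le_of_abs_le abs_G_le) (le_of_abs_le abs_G_le)
    · simp
  · exact sq_le_sq' (neg_le_of_abs_le bias_le) (le_of_abs_le bias_le)
  · rfl
  · exact sq_weight_error_le (wh_mem x) (abs_weight_sub_weight_one_le hlam hρ (hs_pos _))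
      (abs_sub_le_of_le_of_le (hG (S.restrict x)).1 (hG _).2 hθ.1 hθ.2)
      (abs_wHat_mean_sub_weight_mean_le hD z hs_pos hlam hg hθ)

end StepError

section OneStep

variable {f g : Pt d → ℝ} {S : Finset (Fin d)} {κ : Kernel (S → ℝ) (↥Sᶜ → ℝ)} {r : (S → ℝ) → ℝ}
  {lam c C lo hi T h b ε : ℝ} {D : Finset (Fin n)} {φ : (Fin n → Pt d) → Pt d → ℝ}

theorem measurable_stepBar [IsMarkovKernel κ] (hm : Measurable (rBar f S r)) (hg : Measurable g)
    (hr : ∀ x, g x ∈ Set.Icc lo hi) : Measurable (stepBar f S r lam κ g) := by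
  rw [funext (stepBar_eq hg hr)]
  exact (measurable_wBar hm).mul
    (((measurable_condMean hg).comp (Finset.measurable_restrict S)).sub_const _)

variable [IsProbabilityMeasure (law f)]

theorem meanLE_sq_wBar_mean (hlam : 0 < lam) (hc : 0 < c) (hm : Measurable (rBar f S r))
    (hb : ∀ u, rBar f S r u ∈ Set.Icc c C) (hg : Measurable g) (hr : ∀ x, g x ∈ Set.Icc lo hi)
    (hD : D.Nonempty) :
    MeanLE (sampleLaw (law f) n)
      (fun p => ((∑ i ∈ D, wBar f S r lam (p.2 i) * (g (p.2 i) - thetaBar f S r lam g))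
        / ∑ i ∈ D, wBar f S r lam (p.2 i)) ^ 2)
      ((hi - lo) ^ 2 * (C / c) ^ 2 / D.card) := by
  have hpos (u) : 0 < rBar f S r u := hc.trans_le (hb u).1
  have hθ := thetaBar_mem_Icc hlam hm hpos hg hr
  have _ : (0 : ℝ) < D.card := by exact_mod_cast hD.card_pos
  set θ := thetaBar f S r lam g
  set w := wBar f S r lam
  set w₀ := weight lam 1 c
  have w₀_pos : 0 < w₀ := weight_pos hlam one_pos hc
  have w₀_le (x) : w₀ ≤ w x :=
    (weight_le_mul_weight hlam one_pos hc le_rfl le_rfl (hb _).1).trans_eq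
      ((congrArg (· * w x) (div_self hc.ne')).trans (one_mul _))
  have w_le (x) : w x ≤ C / c * w₀ := weight_le_mul_weight hlam one_pos hc (hb _).1 (hb _).2 le_rfl
  have hwm : Measurable w := measurable_wBar hm
  have hζm : Measurable fun x => w x * (g x - θ) := hwm.mul (hg.sub_const θ)
  have abs_ζ_le (x) : |w x * (g x - θ)| ≤ C / c * w₀ * (hi - lo) := by
    rw [abs_mul, abs_of_pos (w₀_pos.trans_le (w₀_le x))]
    exact mul_le_mul (w_le x) (abs_sub_le_of_le_of_le (hr x).1 (hr x).2 hθ.1 hθ.2) (abs_nonneg _)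
      (w₀_pos.le.trans ((w₀_le x).trans (w_le x)))
  have hsum := (meanLE_sq_sum_centred hζm abs_ζ_le
    (integral_wBar_mul_sub_thetaBar hlam hm hpos hg hr) D).const_mul
    (k := ((D.card * w₀) ^ 2)⁻¹) (by positivity)
  refine hsum.mono (((Finset.measurable_fun_sum _ fun i _ => hζm.comp (measurable_sample i)).div
    (Finset.measurable_fun_sum _ fun i _ => hwm.comp (measurable_sample i))).pow_const 2)
    (fun p => ?_) (le_of_eq ?_)
  · have le_sum : D.card * w₀ ≤ ∑ i ∈ D, w (p.2 i) := by
      rw [← nsmul_eq_mul]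
      exact D.card_nsmul_le_sum _ _ fun i _ => w₀_le _
    rw [div_pow, div_eq_inv_mul]
    gcongr
  · field_simp

theorem meanLE_sq_one_sub_rHat_rBar (hc : 0 < c) (hm : Measurable (rBar f S r))
    (hb : ∀ u, rBar f S r u ∈ Set.Icc c C) (hD : D.Nonempty) :
    MeanLE (sampleLaw (law f) n) (fun p => (1 - rHat S (rBar f S r) D p.2) ^ 2)
      (C ^ 2 / D.card) := by
  have _ : (0 : ℝ) < D.card := by exact_mod_cast hD.card_pos
  have h1 := one_mem_Icc_of_rBar_mem_Icc hc hm hb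
  set s : Pt d → ℝ := fun x => rBar f S r (S.restrict x)
  have hsm : Measurable s := hm.comp (Finset.measurable_restrict S)
  have abs_sub_le (x) : |s x - 1| ≤ C :=
    (abs_sub_le_of_le_of_le (hb _).1 (hb _).2 h1.1 h1.2).trans (sub_le_self C hc.le)
  have integral_sub_one : ∫ x, (s x - 1) ∂(law f) = 0 := by
    rw [integral_sub (integrable_of_mem_Icc hsm fun x => hb _) (integrable_const _),
      integral_rBar fun u => hc.trans_le (hb u).1]
    simp
  have hsum := (meanLE_sq_sum_centred (hsm.sub_const 1) abs_sub_le integral_sub_one D).const_mul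
    (k := ((D.card : ℝ) ^ 2)⁻¹) (by positivity)
  refine hsum.mono ?_ (fun p => le_of_eq ?_) (le_of_eq (by field_simp))
  · exact ((((Finset.measurable_fun_sum _ fun i _ =>
      hsm.comp (measurable_sample i)).const_mul _).const_sub 1)).pow_const 2
  · have sum_sub_one : ∑ i ∈ D, (s (p.2 i) - 1) = ∑ i ∈ D, s (p.2 i) - D.card := by
      simp [Finset.sum_sub_distrib]
    change (1 - (D.card : ℝ)⁻¹ * ∑ i ∈ D, s (p.2 i)) ^ 2 = _
    rw [sum_sub_one]
    field_simp
    ring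

open Classical in
theorem meanLE_sq_stepHat_sub_stepBar_of_nonempty (hκ : IsCondLaw f S κ) (hlam : 0 < lam)
    (hc : 0 < c) (hm : Measurable (rBar f S r)) (hb : ∀ u, rBar f S r u ∈ Set.Icc c C)
    (hg : Measurable g) (hr : ∀ x, g x ∈ Set.Icc lo hi) (h0 : (0 : ℝ) ∈ Set.Icc lo hi)
    (hD : D.Nonempty) (hh : 0 < h) (hhT : h ≤ T)
    (hG : ∀ u u' : S → ℝ, ‖u - u'‖ ≤ h → |condMean S κ g u - condMean S κ g u'| ≤ b)
    (hφm : Measurable fun p : Pt d × (Fin n → Pt d) => φ p.2 p.1)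
    (hφD : ∀ i ∈ D, ∀ z y, φ (Function.update z i y) = φ z)
    (hφ : MeanLE (sampleLaw (law f) n) (fun p => (trunc T (φ p.2) p.1 - g p.1) ^ 2) ε) :
    MeanLE (sampleLaw (law f) n)
      (fun p => if ‖S.restrict p.1‖ ≤ T then
        (stepHat S r lam T h D p.2 (φ p.2) p.1 - stepBar f S r lam κ g p.1) ^ 2 else 0)
      (3 * (2 ^ S.card * ε) + 3 * (C / c * ε)
        + 12 * (2 * (hi - lo) ^ 2 * ((3 * (T / h)) ^ S.card / (D.card + 1))
          + (hi - lo) ^ 2 * ((3 * (T / h)) ^ S.card / (D.card + 1)) + b ^ 2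
          + (hi - lo) ^ 2 * (C / c) ^ 2 / D.card + 4 * (hi - lo) ^ 2 * (C ^ 2 / D.card))) := by
  have : IsMarkovKernel κ := hκ.1
  have hpos (u) : 0 < rBar f S r u := hc.trans_le (hb u).1
  have hC : 0 < C := (hpos 0).trans_le (hb 0).2
  have hπ := Finset.measurable_restrict (X := fun _ : Fin d => ℝ) S
  have hGr (u) : condMean S κ g u ∈ Set.Icc lo hi := condMean_mem_Icc hg hr u
  have hstep : Measurable fun p : Pt d × (Fin n → Pt d) =>
      stepHat S (rBar f S r) lam T h D p.2 (φ p.2) p.1 :=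
    measurable_stepHat (φ := φ) hm lam T hh D hφm
  set ψ : (Fin n → Pt d) → Pt d → ℝ := fun z y => (trunc T (φ z) y - g y) ^ 2 with hψ
  have ψ_update (i) (hi : i ∈ D) (z) (y : Pt d) : ψ (Function.update z i y) = ψ z := by
    simp only [hψ, hφD i hi]
  have propagated_local := (hφ.sum_near_div_nearCount (φ := ψ) hπ hh.le
    (fun _ _ => sq_nonneg _) ψ_update).const_mul (k := 3) zero_le_three
  have propagated_mean := ((hφ.inv_card_mul_sum (φ := ψ) ψ_update).const_mul
    (k := C / c) (by positivity)).const_mul (k := 3) zero_le_three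
  have fluctuation := meanLE_sq_local_average (n := n) hπ hh hhT
    (hg.sub ((measurable_condMean hg).comp hπ))
    (fun x => abs_sub_le_of_le_of_le (hr x).1 (hr x).2 (hGr _).1 (hGr _).2)
    (condCentred_sub_condMean hκ hg hr) D
  have no_neighbour := meanLE_nearCount_eq_zero (μ := law f) hπ hh hhT (hi - lo) D
  have bias := meanLE_const (ν := sampleLaw (law f) n) (sq_nonneg b)
  have mean_fluctuation := meanLE_sq_wBar_mean hlam hc hm hb hg hr hD
  have weight_error := (meanLE_sq_one_sub_rHat_rBar hc hm hb hD).const_mul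
    (k := 4 * (hi - lo) ^ 2) (by positivity)
  refine ((propagated_local.add propagated_mean).add (((((fluctuation.add no_neighbour).add
    bias).add mean_fluctuation).add weight_error).const_mul (k := 12) (by norm_num))).mono
    ?_ (fun p => ?_) (by simp)
  · simp only [← stepHat_rBar (integral_ne_zero_of_rBar_pos hpos)]
    exact measurable_ite_norm_le hπ measurable_fst
      ((hstep.sub ((measurable_stepBar hm hg hr).comp measurable_fst)).pow_const 2) T
  · by_cases hx : ‖S.restrict p.1‖ ≤ T
    · simp only [hx, if_true]
      rw [← stepHat_rBar (integral_ne_zero_of_rBar_pos hpos), stepBar_eq hg hr]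
      exact sq_stepHat_sub_le hD p.2 hc hb hlam hh h0 hr hGr
        (thetaBar_mem_Icc hlam hm hpos hg hr) hG hx
    · simp only [hx, if_false]
      have local_nonneg : 0 ≤ (∑ i ∈ D, near S.restrict h p.1 (p.2 i) * ψ p.2 (p.2 i))
          / nearCount S.restrict h D p.2 p.1 :=
        div_nonneg (Finset.sum_nonneg fun i _ => mul_nonneg (near_nonneg _ _ _ _) (sq_nonneg _))
          (nearCount_nonneg _ _ _ _ _)
      have _ : 0 ≤ ∑ i ∈ D, ψ p.2 (p.2 i) := Finset.sum_nonneg fun i _ => sq_nonneg _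
      positivity

theorem inv_le_two_div_add_one {N : ℝ} (hN : 1 ≤ N) : N⁻¹ ≤ 2 / (N + 1) := by
  rw [inv_eq_one_div, div_le_div_iff₀ (by linarith) (by linarith)]
  linarith

open Classical in
theorem meanLE_sq_stepHat_empty_sub_stepBar [IsMarkovKernel κ] (hlam : 0 < lam)
    (hm : Measurable (rBar f S r)) (hpos : ∀ u, 0 < rBar f S r u) (hg : Measurable g)
    (hr : ∀ x, g x ∈ Set.Icc lo hi) :
    MeanLE (sampleLaw (law f) n)
      (fun p => if ‖S.restrict p.1‖ ≤ T then
        (stepHat S r lam T h ∅ p.2 (φ p.2) p.1 - stepBar f S r lam κ g p.1) ^ 2 else 0)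
      ((hi - lo) ^ 2) := by
  have stepHat_empty (p : Pt d × (Fin n → Pt d)) :
      stepHat S r lam T h ∅ p.2 (φ p.2) p.1 = 0 := by simp [stepHat]
  simp only [stepHat_empty, zero_sub, neg_sq]
  refine (meanLE_const (sq_nonneg (hi - lo))).mono ?_ (fun p => ?_) le_rfl
  · exact measurable_ite_norm_le (Finset.measurable_restrict S) measurable_fst
      (((measurable_stepBar hm hg hr).comp measurable_fst).pow_const 2) T
  · have hθ := thetaBar_mem_Icc hlam hm hpos hg hr
    have hmem := stepBar_mem_Icc (κ := κ) hlam hm hpos hg hr p.1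
    split_ifs
    · refine sq_le_sq' ?_ ?_ <;> linarith [hmem.1, hmem.2, hθ.1, hθ.2]
    · positivity

open Classical in
theorem meanLE_sq_stepHat_sub_stepBar (hκ : IsCondLaw f S κ) (hlam : 0 < lam)
    (hc : 0 < c) (hm : Measurable (rBar f S r)) (hb : ∀ u, rBar f S r u ∈ Set.Icc c C)
    (hg : Measurable g) (hr : ∀ x, g x ∈ Set.Icc lo hi) (h0 : (0 : ℝ) ∈ Set.Icc lo hi)
    (hh : 0 < h) (hhT : h ≤ T)
    (hG : ∀ u u' : S → ℝ, ‖u - u'‖ ≤ h → |condMean S κ g u - condMean S κ g u'| ≤ b)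
    (hφm : Measurable fun p : Pt d × (Fin n → Pt d) => φ p.2 p.1)
    (hφD : ∀ i ∈ D, ∀ z y, φ (Function.update z i y) = φ z)
    (hφ : MeanLE (sampleLaw (law f) n) (fun p => (trunc T (φ p.2) p.1 - g p.1) ^ 2) ε) :
    MeanLE (sampleLaw (law f) n)
      (fun p => if ‖S.restrict p.1‖ ≤ T then
        (stepHat S r lam T h D p.2 (φ p.2) p.1 - stepBar f S r lam κ g p.1) ^ 2 else 0)
      (3 * (C / c + 2 ^ d) * ε + 12 * b ^ 2
        + 12 * (hi - lo) ^ 2 * (3 * 3 ^ d * (T / h) ^ d + 10 * (C / c) ^ 2) / (D.card + 1)) := by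
  have : IsMarkovKernel κ := hκ.1
  have hpos (u) : 0 < rBar f S r u := hc.trans_le (hb u).1
  have one_mem := one_mem_Icc_of_rBar_mem_Icc hc hm hb
  have hTh : 1 ≤ T / h := (one_le_div hh).2 hhT
  have hC : 0 < C := one_pos.trans_le one_mem.2
  have C_le_div : C ≤ C / c := (le_div_iff₀ hc).2 (mul_le_of_le_one_right hC.le one_mem.1)
  have one_le_div : 1 ≤ C / c := one_mem.2.trans C_le_div
  rcases D.eq_empty_or_nonempty with rfl | hD
  · have hstep := meanLE_sq_stepHat_empty_sub_stepBar (n := n) (κ := κ) (T := T) (h := h) (φ := φ)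
      hlam hm hpos hg hr
    refine hstep.mono hstep.measurable (fun _ => le_rfl) ?_
    have sq_le : (hi - lo) ^ 2 ≤ (hi - lo) ^ 2 * (C / c) ^ 2 :=
      le_mul_of_one_le_right (sq_nonneg _) (one_le_pow₀ one_le_div)
    have cells_nonneg : 0 ≤ 12 * (hi - lo) ^ 2 * (3 * 3 ^ d * (T / h) ^ d) := by positivity
    have propagated_nonneg : 0 ≤ 3 * (C / c + 2 ^ d) * ε := mul_nonneg (by positivity) hφ.nonneg
    simp only [Finset.card_empty, Nat.cast_zero, zero_add, div_one]
    linarith [sq_nonneg b, sq_nonneg (hi - lo)]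
  · have hstep := meanLE_sq_stepHat_sub_stepBar_of_nonempty hκ hlam hc hm hb hg hr h0 hD hh hhT hG
      hφm hφD hφ
    refine hstep.mono hstep.measurable (fun _ => le_rfl) ?_
    have card_le : S.card ≤ d := by simpa using S.card_le_univ
    have hε := hφ.nonneg
    have hN : (1 : ℝ) ≤ D.card := by exact_mod_cast hD.card_pos
    calc _ ≤ 3 * (2 ^ d * ε) + 3 * (C / c * ε)
        + 12 * (2 * (hi - lo) ^ 2 * ((3 * (T / h)) ^ d / (D.card + 1))
          + (hi - lo) ^ 2 * ((3 * (T / h)) ^ d / (D.card + 1)) + b ^ 2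
          + (hi - lo) ^ 2 * (C / c) ^ 2 * (2 / (D.card + 1))
          + 4 * (hi - lo) ^ 2 * ((C / c) ^ 2 * (2 / (D.card + 1)))) := by
          simp only [div_eq_mul_inv _ (D.card : ℝ)]
          gcongr
          all_goals first | exact card_le | exact inv_le_two_div_add_one hN | linarith
      _ = _ := by rw [mul_pow]; ring

end OneStep

section Combinatorics

theorem binTail_nonneg (M m : ℕ) {η : ℝ} (hη : η ∈ Set.Icc 0 1) : 0 ≤ binTail M η m :=
  Finset.sum_nonneg fun _ _ => mul_nonneg (mul_nonneg (Nat.cast_nonneg _) (pow_nonneg hη.1 _))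
    (pow_nonneg (sub_nonneg.2 hη.2) _)

theorem choose_add_le_choose_mul_choose {M m i : ℕ} :
    M.choose (m + i) ≤ M.choose m * (M - m).choose i := by
  have choose_mul := Nat.choose_mul (n := M) (Nat.le_add_right m i)
  rw [Nat.add_sub_cancel_left] at choose_mul
  rw [← choose_mul]
  exact Nat.le_mul_of_pos_right _ (Nat.choose_pos (Nat.le_add_right m i))

-- Union bound: at least `m` successes occur only if some `m` of the trials all succeed.
theorem binTail_le_choose_mul_pow (M m : ℕ) {η : ℝ} (hη : η ∈ Set.Icc 0 1) :
    binTail M η m ≤ M.choose m * η ^ m := by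
  have hη0 : 0 ≤ η := hη.1
  have hη1 : 0 ≤ 1 - η := sub_nonneg.2 hη.2
  rcases lt_or_ge M m with hm | hm
  · rw [binTail, Finset.Icc_eq_empty (by omega), Finset.sum_empty]
    positivity
  have binomial_sum :
      ∑ i ∈ Finset.range (M - m + 1), η ^ i * (1 - η) ^ (M - m - i) * ((M - m).choose i : ℝ)
        = 1 := by
    rw [← add_pow, add_sub_cancel, one_pow]
  have reindex : Finset.Icc m M = Finset.Ico m (M + 1) := by ext; simp
  rw [binTail, reindex, Finset.sum_Ico_eq_sum_range, Nat.sub_add_comm hm]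
  calc ∑ i ∈ Finset.range (M - m + 1),
        (M.choose (m + i) : ℝ) * η ^ (m + i) * (1 - η) ^ (M - (m + i))
      ≤ ∑ i ∈ Finset.range (M - m + 1), (M.choose m : ℝ) * η ^ m
          * (η ^ i * (1 - η) ^ (M - m - i) * ((M - m).choose i : ℝ)) := by
        refine Finset.sum_le_sum fun i _ => ?_
        have hchoose : (M.choose (m + i) : ℝ) ≤ M.choose m * (M - m).choose i := by
          exact_mod_cast choose_add_le_choose_mul_choose
        calc (M.choose (m + i) : ℝ) * η ^ (m + i) * (1 - η) ^ (M - (m + i))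
            ≤ (M.choose m * (M - m).choose i) * η ^ (m + i) * (1 - η) ^ (M - (m + i)) := by gcongr
          _ = _ := by rw [pow_add, Nat.sub_add_eq]; ring
    _ = M.choose m * η ^ m := by rw [← Finset.mul_sum, binomial_sum, mul_one]

theorem sum_choose_succ_mul_pow_le (M : ℕ) (q : ℝ) :
    ∑ m ∈ Finset.range M, (M.choose (m + 1) : ℝ) * q ^ (m + 1) ≤ (1 + q) ^ M := by
  rw [add_comm 1 q, add_pow, Finset.sum_range_succ']
  simp only [one_pow, mul_one, pow_zero, Nat.choose_zero_right, Nat.cast_one,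
    mul_comm (Nat.cast _) (q ^ _)]
  exact le_add_of_nonneg_right (zero_le_one' ℝ)

variable {𝕊 : Finset (Finset (Fin d))} {S : Finset (Fin d)} {m M : ℕ}

theorem mem_of_mem_paths {Ss : Fin (m + 1) → Finset (Fin d)} (h : Ss ∈ paths 𝕊 m S) (j) :
    Ss j ∈ 𝕊 :=
  Fintype.mem_piFinset.1 (Finset.mem_filter.1 h).1 j

theorem last_of_mem_paths {Ss : Fin (m + 1) → Finset (Fin d)} (h : Ss ∈ paths 𝕊 m S) :
    Ss (Fin.last m) = S :=
  (Finset.mem_filter.1 h).2.2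

theorem card_paths_le : (paths 𝕊 m S).card ≤ 𝕊.card ^ m := by
  have card_words : (Fintype.piFinset fun _ : Fin m => 𝕊).card = 𝕊.card ^ m := by
    rw [Fintype.card_piFinset_const]
  rw [← card_words]
  refine Finset.card_le_card_of_injOn (fun Ss j => Ss j.castSucc) (fun Ss hSs => ?_) ?_
  · exact Fintype.mem_piFinset.2 fun j => mem_of_mem_paths hSs _
  · intro Ss hSs Ss' hSs' heq
    funext j
    refine Fin.lastCases ?_ (fun j => congrFun heq j) j
    rw [last_of_mem_paths hSs, last_of_mem_paths hSs']

theorem inv_card_mem_Icc (hS : S ∈ 𝕊) : (𝕊.card : ℝ)⁻¹ ∈ Set.Icc 0 1 :=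
  ⟨by positivity, inv_le_one_of_one_le₀ (by exact_mod_cast Finset.card_pos.2 ⟨S, hS⟩)⟩

theorem card_paths_mul_binTail_le (hS : S ∈ 𝕊) :
    ((paths 𝕊 m S).card : ℝ) * binTail M (𝕊.card : ℝ)⁻¹ (m + 1) ≤ M.choose (m + 1) := by
  have hη := inv_card_mem_Icc hS
  have card_ne : (𝕊.card : ℝ) ≠ 0 := by exact_mod_cast (Finset.card_pos.2 ⟨S, hS⟩).ne'
  calc ((paths 𝕊 m S).card : ℝ) * binTail M (𝕊.card : ℝ)⁻¹ (m + 1)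
      ≤ (𝕊.card : ℝ) ^ m * (M.choose (m + 1) * ((𝕊.card : ℝ)⁻¹) ^ (m + 1)) :=
        mul_le_mul (by exact_mod_cast card_paths_le) (binTail_le_choose_mul_pow M (m + 1) hη)
          (binTail_nonneg _ _ hη) (by positivity)
    _ = M.choose (m + 1) * (𝕊.card : ℝ)⁻¹ := by rw [pow_succ, inv_pow]; field_simp
    _ ≤ M.choose (m + 1) := mul_le_of_le_one_right (by positivity) hη.2

theorem sum_paths_binTail_mul_pow_le (hS : S ∈ 𝕊) (M : ℕ) {q : ℝ} (hq : 0 ≤ q) :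
    ∑ s ∈ (Finset.range M).sigma fun m => paths 𝕊 m S,
      binTail M (𝕊.card : ℝ)⁻¹ (s.1 + 1) * q ^ (s.1 + 1) ≤ (1 + q) ^ M := by
  rw [Finset.sum_sigma]
  refine (Finset.sum_le_sum fun m _ => ?_).trans (sum_choose_succ_mul_pow_le M q)
  dsimp only
  rw [Finset.sum_const, nsmul_eq_mul, ← mul_assoc]
  exact mul_le_mul_of_nonneg_right (card_paths_mul_binTail_le hS) (by positivity)

theorem IsSplit.le_two_mul {D : ℕ → Finset (Fin n)} (hD : IsSplit n M D)
    (hm : m ∈ Finset.Icc 1 M) : n ≤ 2 * (M * ((D m).card + 1)) := by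
  have sum_card : ∑ k ∈ Finset.Icc 1 M, (D k).card = (n + 1) / 2 := by
    rw [← Finset.card_biUnion hD.disjoint, hD.union, Fin.card_filter_val_lt]
    omega
  have sum_card_le : ∑ k ∈ Finset.Icc 1 M, (D k).card ≤ M * ((D m).card + 1) := by
    simpa using Finset.sum_le_card_nsmul _ _ _ fun k hk => hD.balanced k hk m hm
  omega

end Combinatorics

section PathSum

theorem MeanLE.sq_sum_mul {ι Ω : Type*} [MeasurableSpace Ω] {ν : Measure Ω} {I : Finset ι}
    {B x : ι → ℝ} {e : ι → Ω → ℝ} (hB : ∀ i ∈ I, 0 ≤ B i) (hem : ∀ i ∈ I, Measurable (e i))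
    (he : ∀ i ∈ I, MeanLE ν (fun ω => e i ω ^ 2) (x i)) :
    MeanLE ν (fun ω => (∑ i ∈ I, B i * e i ω) ^ 2) ((∑ i ∈ I, B i) * ∑ i ∈ I, B i * x i) := by
  have hmean := (MeanLE.sum I fun i hi => (he i hi).const_mul (hB i hi)).const_mul
    (Finset.sum_nonneg hB)
  refine hmean.mono ?_ (fun ω => ?_) le_rfl
  · exact (Finset.measurable_fun_sum _ fun i hi => (hem i hi).const_mul _).pow_const 2
  · exact Finset.sum_sq_le_sum_mul_sum_of_sq_le_mul I hB
      (fun i hi => mul_nonneg (hB i hi) (sq_nonneg _)) fun i _ => le_of_eq (by ring)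

theorem MeanLE.sq_sum_paths {Ω : Type*} [MeasurableSpace Ω] {ν : Measure Ω}
    {𝕊 : Finset (Finset (Fin d))} {S : Finset (Fin d)} (hS : S ∈ 𝕊) {M : ℕ} {q y : ℝ}
    (hq : 0 ≤ q) (hy : 0 ≤ y) {e : (Σ m : ℕ, Fin (m + 1) → Finset (Fin d)) → Ω → ℝ}
    (hem : ∀ s ∈ (Finset.range M).sigma fun m => paths 𝕊 m S, Measurable (e s))
    (he : ∀ s ∈ (Finset.range M).sigma fun m => paths 𝕊 m S,
      MeanLE ν (fun ω => e s ω ^ 2) (q ^ (s.1 + 1) * y)) :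
    MeanLE ν (fun ω => (∑ s ∈ (Finset.range M).sigma fun m => paths 𝕊 m S,
      binTail M (𝕊.card : ℝ)⁻¹ (s.1 + 1) * e s ω) ^ 2) ((2 * (1 + q)) ^ M * y) := by
  have weight_nonneg (m : ℕ) : 0 ≤ binTail M (𝕊.card : ℝ)⁻¹ m :=
    binTail_nonneg M m (inv_card_mem_Icc hS)
  have total_weight := sum_paths_binTail_mul_pow_le hS M zero_le_one
  have total_error := sum_paths_binTail_mul_pow_le hS M hq
  simp only [one_pow, mul_one, one_add_one_eq_two] at total_weight
  have hsum := MeanLE.sq_sum_mul (fun s _ => weight_nonneg (s.1 + 1)) hem he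
  refine hsum.mono hsum.measurable (fun _ => le_rfl) ?_
  simp only [← mul_assoc, ← Finset.sum_mul]
  rw [mul_pow]
  refine mul_le_mul_of_nonneg_right (mul_le_mul total_weight total_error ?_ (by positivity)) hy
  exact Finset.sum_nonneg fun s _ => mul_nonneg (weight_nonneg _) (by positivity)

theorem aHat_succ_eq_zero (r : ∀ S : Finset (Fin d), (S → ℝ) → ℝ) (lam : Finset (Fin d) → ℝ)
    {T : ℝ} (h : ℝ) (D : ℕ → Finset (Fin n)) (z : Fin n → Pt d) (a : Pt d → ℝ) {m : ℕ}
    (Ss : Fin (m + 1) → Finset (Fin d)) {x : Pt d}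
    (hx : ¬ ‖(Ss (Fin.last m)).restrict x‖ ≤ T) : aHat r lam T h D z a (m + 1) Ss x = 0 :=
  if_neg hx

theorem alphaHat_eq_sum (𝕊 : Finset (Finset (Fin d))) (r : ∀ S : Finset (Fin d), (S → ℝ) → ℝ)
    (lam : Finset (Fin d) → ℝ) (T h : ℝ) (D : ℕ → Finset (Fin n)) (z : Fin n → Pt d)
    (a : Pt d → ℝ) (η : ℝ) (M : ℕ) (S : Finset (Fin d)) (x : Pt d) :
    alphaHat 𝕊 r lam T h D z a η M S x = ∑ m ∈ Finset.range M, (-1) ^ m *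
      ∑ Ss ∈ paths 𝕊 m S, binTail M η (m + 1) * aHat r lam T h D z a (m + 1) Ss x := by
  refine ite_eq_left_iff.2 fun hx => (Finset.sum_eq_zero fun m _ => ?_).symm
  rw [Finset.sum_eq_zero fun Ss hSs => ?_, mul_zero]
  obtain rfl := last_of_mem_paths hSs
  rw [aHat_succ_eq_zero r lam h D z a Ss hx, mul_zero]

theorem alphaHat_sub_alpha (𝕊 : Finset (Finset (Fin d))) (f : Pt d → ℝ)
    (r : ∀ S : Finset (Fin d), (S → ℝ) → ℝ) (lam : Finset (Fin d) → ℝ)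
    (κ : ∀ S : Finset (Fin d), Kernel (S → ℝ) (↥Sᶜ → ℝ)) (T h : ℝ) (D : ℕ → Finset (Fin n))
    (z : Fin n → Pt d) (a : Pt d → ℝ) (η : ℝ) (M : ℕ) (S : Finset (Fin d)) (x : Pt d) :
    alphaHat 𝕊 r lam T h D z a η M S x - alpha 𝕊 f r lam κ a η M S x
      = ∑ s ∈ (Finset.range M).sigma fun m => paths 𝕊 m S, binTail M η (s.1 + 1) * ((-1) ^ s.1
        * (aHat r lam T h D z a (s.1 + 1) s.2 x - aBar f r lam κ a (s.1 + 1) s.2 x)) := by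
  rw [alphaHat_eq_sum, alpha, ← Finset.sum_sub_distrib, Finset.sum_sigma]
  refine Finset.sum_congr rfl fun m _ => ?_
  rw [← mul_sub, ← Finset.sum_sub_distrib, Finset.mul_sum]
  exact Finset.sum_congr rfl fun Ss _ => by ring

end PathSum

section Constants

/-- The factor by which, up to a numerical constant, one regression step inflates the mean squared
error of its input: `2 ^ d` comes from the local average and `C / c` from the weighted mean. -/
def inflation (d : ℕ) (c C : ℝ) : ℝ := C / c + 2 ^ d

/-- The mean squared error after `m` regression steps, relative to `amplitude * errorRate`, when
each step inflates the previous error by `K`. -/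
def errorFactor (K : ℝ) (m : ℕ) : ℝ := 16 * (14 * K - 1) ^ m - 15

/-- The dependence of the error bound on `a₀ = ‖a‖_∞`, the Hölder constant `L = L₁ + L₂ + L₃` and
the range `[c, C]` of the normalised shifts. -/
def amplitude (d : ℕ) (a₀ L c C : ℝ) : ℝ :=
  max (a₀ ^ 2) 1 * max ((C / c) ^ 2) (max (L ^ 2) (8 ^ d))

/-- The rate of convergence: fluctuation, squared smoothing bias and tail. -/
def errorRate (f : Pt d → ℝ) (M n : ℕ) (T h β : ℝ) : ℝ :=
  (M : ℝ) / n * (T / h) ^ d + h ^ (2 * β) + (law f).real {x | T ≤ ‖x‖}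

theorem add_one_sq_le_four_pow (m : ℕ) : ((m : ℝ) + 1) ^ 2 ≤ 4 ^ m := by
  induction m with
  | zero => norm_num
  | succ m ih =>
    have _ : (0 : ℝ) ≤ m := m.cast_nonneg
    push_cast
    rw [pow_succ 4]
    nlinarith

theorem one_add_mul_sq_le {K : ℝ} (hK : 1 ≤ K) (m : ℕ) : (1 + m * K) ^ 2 ≤ 4 ^ m * K ^ 2 := by
  calc (1 + m * K) ^ 2 ≤ ((m + 1) * K) ^ 2 := by gcongr; linarith
    _ = (m + 1) ^ 2 * K ^ 2 := mul_pow _ _ _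
    _ ≤ 4 ^ m * K ^ 2 := by gcongr; exact add_one_sq_le_four_pow m

theorem errorFactor_succ_ge {K : ℝ} (hK : 5 ≤ K) (m : ℕ) :
    3 * K * errorFactor K m + 1001 + 48 * (1 + m * K) ^ 2 ≤ errorFactor K (m + 1) := by
  simp only [errorFactor]
  rcases m with _ | m
  · norm_num
    linarith
  set q := 14 * K - 1 with hq
  have one_le : (1 : ℝ) ≤ 4 ^ m := one_le_pow₀ (by norm_num)
  have four_pow_le : (4 : ℝ) ^ m ≤ q ^ m := by gcongr; linarith
  have quadratic := one_add_mul_sq_le (by linarith : 1 ≤ K) (m + 1)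
  have hK2 : K ^ 2 ≤ K ^ 2 * 4 ^ m := le_mul_of_one_le_right (sq_nonneg _) one_le
  have growth : 130 * K ^ 2 * 4 ^ m ≤ q * (11 * K - 1) * q ^ m := by
    have hq_ge : 130 * K ^ 2 ≤ q * (11 * K - 1) := by rw [hq]; nlinarith
    exact mul_le_mul hq_ge four_pow_le (by positivity) (le_trans (by positivity) hq_ge)
  have split : 16 * q ^ (m + 1 + 1) - 3 * K * (16 * q ^ (m + 1))
      = 16 * (q * (11 * K - 1) * q ^ m) := by rw [pow_succ, pow_succ, hq]; ring
  rw [pow_succ 4] at quadratic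
  nlinarith

theorem three_pow_le_eight_pow (hd : 2 ≤ d) : 64 * (3 : ℝ) ^ d ≤ 9 * 8 ^ d := by
  obtain ⟨k, rfl⟩ := Nat.exists_eq_add_of_le hd
  have : (3 : ℝ) ^ k ≤ 8 ^ k := pow_le_pow_left₀ (by norm_num) (by norm_num) k
  rw [pow_add, pow_add]
  linarith

theorem five_le_inflation (hd : 2 ≤ d) {c C : ℝ} (hc : 0 < c) (hC : c ≤ C) :
    5 ≤ inflation d c C := by
  have ratio : 1 ≤ C / c := (one_le_div hc).2 hC
  have two_pow : (2 : ℝ) ^ 2 ≤ 2 ^ d := pow_le_pow_right₀ one_le_two hd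
  rw [inflation]
  linarith

variable {a₀ w L L₁ L₂ L₃ c C K : ℝ}

theorem sq_max_one (ha : 0 ≤ a₀) : max a₀ 1 ^ 2 = max (a₀ ^ 2) 1 := by
  rcases le_total a₀ 1 with h | h
  · rw [max_eq_right h, max_eq_right (pow_le_one₀ ha h), one_pow]
  · rw [max_eq_left h, max_eq_left (one_le_pow₀ h)]

theorem one_le_max_amplitude (d : ℕ) (L c C : ℝ) :
    1 ≤ max ((C / c) ^ 2) (max (L ^ 2) ((8 : ℝ) ^ d)) :=
  (one_le_pow₀ (by norm_num)).trans ((le_max_right _ _).trans (le_max_right _ _))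

theorem amplitude_pos (d : ℕ) (a₀ L c C : ℝ) : 0 < amplitude d a₀ L c C :=
  mul_pos (one_pos.trans_le (le_max_right _ _)) (one_pos.trans_le (one_le_max_amplitude d L c C))

theorem sq_le_amplitude (d : ℕ) (a₀ L c C : ℝ) : a₀ ^ 2 ≤ amplitude d a₀ L c C :=
  (le_max_left _ _).trans
    (le_mul_of_one_le_right (zero_le_one.trans (le_max_right _ _)) (one_le_max_amplitude d L c C))

theorem holder_const_le (m : ℕ) (hw : w ∈ Set.Icc 0 (2 * a₀)) (hL₁ : 0 ≤ L₁) (hL₂ : 0 ≤ L₂)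
    (hL₃ : 0 ≤ L₃) (hc : 0 < c) (hK : 1 ≤ K) (hcK : 1 ≤ K * c) :
    L₁ + m * (2 * a₀ * (L₂ + L₃ / (4 * c))) + w * L₂
      ≤ 2 * max a₀ 1 * ((L₁ + L₂ + L₃) * (1 + m * K)) := by
  set R := max a₀ 1
  have _ : 0 ≤ a₀ := by linarith [hw.1.trans hw.2]
  have haR : a₀ ≤ R := le_max_left _ _
  have hR : 1 ≤ R := le_max_right _ _
  have hL₃K : L₃ / (4 * c) ≤ L₃ * K := by
    rw [div_le_iff₀ (by positivity)]
    nlinarith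
  have increment : L₂ + L₃ / (4 * c) ≤ (L₁ + L₂ + L₃) * K := by nlinarith
  calc L₁ + m * (2 * a₀ * (L₂ + L₃ / (4 * c))) + w * L₂
      ≤ R * L₁ + m * (2 * R * ((L₁ + L₂ + L₃) * K)) + 2 * R * L₂ := by
        gcongr
        · exact le_mul_of_one_le_left hL₁ hR
        · linarith [hw.2]
    _ ≤ 2 * R * ((L₁ + L₂ + L₃) * (1 + m * K)) := by
        have : 0 ≤ R * L₁ := by positivity
        have : 0 ≤ R * L₃ := by positivity
        linarith

theorem bias_sq_le (m : ℕ) (hw : w ∈ Set.Icc 0 (2 * a₀)) (hL₁ : 0 ≤ L₁) (hL₂ : 0 ≤ L₂)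
    (hL₃ : 0 ≤ L₃) (hc : 0 < c) (h1 : 1 ∈ Set.Icc c C) :
    (L₁ + m * (2 * a₀ * (L₂ + L₃ / (4 * c))) + w * L₂) ^ 2
      ≤ 4 * (1 + m * inflation d c C) ^ 2 * amplitude d a₀ (L₁ + L₂ + L₃) c C := by
  have ha : 0 ≤ a₀ := by linarith [hw.1.trans hw.2]
  have ratio : 1 ≤ C / c := (one_le_div hc).2 (h1.1.trans h1.2)
  have hK : 1 ≤ inflation d c C := by
    rw [inflation]
    exact ratio.trans (le_add_of_nonneg_right (by positivity))
  have hcK : 1 ≤ inflation d c C * c := by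
    rw [inflation, add_mul, div_mul_cancel₀ C hc.ne']
    exact h1.2.trans (le_add_of_nonneg_right (by positivity))
  have const_nonneg : 0 ≤ L₁ + m * (2 * a₀ * (L₂ + L₃ / (4 * c))) + w * L₂ := by
    have := hw.1
    positivity
  calc (L₁ + m * (2 * a₀ * (L₂ + L₃ / (4 * c))) + w * L₂) ^ 2
      ≤ (2 * max a₀ 1 * ((L₁ + L₂ + L₃) * (1 + m * inflation d c C))) ^ 2 :=
        pow_le_pow_left₀ const_nonneg (holder_const_le m hw hL₁ hL₂ hL₃ hc hK hcK) 2
    _ = 4 * (1 + m * inflation d c C) ^ 2 * (max (a₀ ^ 2) 1 * (L₁ + L₂ + L₃) ^ 2) := by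
        rw [← sq_max_one ha]
        ring
    _ ≤ _ := by
        rw [amplitude]
        gcongr
        exact (le_max_left _ _).trans (le_max_right _ _)

theorem fluctuation_le (hd : 2 ≤ d) (L c C : ℝ) (hw : w ∈ Set.Icc 0 (2 * a₀)) {τ η N : ℝ}
    (hτ : 1 ≤ τ) (hN : 0 ≤ N) (hη : (N + 1)⁻¹ ≤ 2 * η) :
    12 * w ^ 2 * (3 * 3 ^ d * τ + 10 * (C / c) ^ 2) / (N + 1)
      ≤ 1001 * amplitude d a₀ L c C * (η * τ) := by
  rw [amplitude]
  set W := max ((C / c) ^ 2) (max (L ^ 2) ((8 : ℝ) ^ d))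
  have _ : 1 ≤ W := one_le_max_amplitude d L c C
  have hratio : (C / c) ^ 2 ≤ W := le_max_left _ _
  have height : (8 : ℝ) ^ d ≤ W := (le_max_right _ _).trans (le_max_right _ _)
  have hcells : 3 * 3 ^ d * τ + 10 * (C / c) ^ 2 ≤ 1001 / 96 * (W * τ) := by
    have hcube : 3 * (3 : ℝ) ^ d * τ ≤ 27 / 64 * W * τ := by
      have := three_pow_le_eight_pow hd
      exact mul_le_mul_of_nonneg_right (by linarith) (by positivity)
    have hratio_τ : (C / c) ^ 2 ≤ W * τ := hratio.trans (le_mul_of_one_le_right (by positivity) hτ)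
    have : 0 ≤ W * τ := by positivity
    linarith
  have hw2 : w ^ 2 ≤ 4 * max (a₀ ^ 2) 1 := by
    calc w ^ 2 ≤ (2 * a₀) ^ 2 := pow_le_pow_left₀ hw.1 hw.2 2
      _ = 4 * a₀ ^ 2 := by ring
      _ ≤ 4 * max (a₀ ^ 2) 1 := by gcongr; exact le_max_left _ _
  calc 12 * w ^ 2 * (3 * 3 ^ d * τ + 10 * (C / c) ^ 2) / (N + 1)
      = 12 * w ^ 2 * (3 * 3 ^ d * τ + 10 * (C / c) ^ 2) * (N + 1)⁻¹ := div_eq_mul_inv _ _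
    _ ≤ 12 * (4 * max (a₀ ^ 2) 1) * (1001 / 96 * (W * τ)) * (2 * η) := by gcongr
    _ = 1001 * (max (a₀ ^ 2) 1 * W) * (η * τ) := by ring

variable {f : Pt d → ℝ} {M : ℕ} {T h β : ℝ}

theorem errorRate_nonneg (f : Pt d → ℝ) (M n : ℕ) (β : ℝ) (hh : 0 ≤ h) (hT : 0 ≤ T) :
    0 ≤ errorRate f M n T h β := by
  rw [errorRate]
  positivity

theorem measureReal_le_errorRate (f : Pt d → ℝ) (M n : ℕ) (β : ℝ) (hh : 0 ≤ h) (hT : 0 ≤ T) :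
    (law f).real {x | T ≤ ‖x‖} ≤ errorRate f M n T h β := by
  rw [errorRate]
  exact le_add_of_nonneg_left (by positivity)

theorem inv_add_one_le_two_mul_div (hn : 0 < n) {N : ℕ} (hN : n ≤ 2 * (M * (N + 1))) :
    ((N : ℝ) + 1)⁻¹ ≤ 2 * ((M : ℝ) / n) := by
  have hN' : (n : ℝ) ≤ 2 * (M * (N + 1)) := by exact_mod_cast hN
  have hn' : (0 : ℝ) < n := by exact_mod_cast hn
  rw [inv_le_iff_one_le_mul₀ (by positivity), mul_div_assoc', div_mul_eq_mul_div,
    one_le_div hn', mul_assoc]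
  exact hN'

theorem error_succ_le (hd : 2 ≤ d) (m : ℕ) (hw : w ∈ Set.Icc 0 (2 * a₀)) (hL₁ : 0 ≤ L₁)
    (hL₂ : 0 ≤ L₂) (hL₃ : 0 ≤ L₃) (hc : 0 < c) (h1 : 1 ∈ Set.Icc c C) (hh : 0 < h) (hhT : h ≤ T)
    (hn : 0 < n) {N : ℕ} (hN : n ≤ 2 * (M * (N + 1))) :
    3 * inflation d c C * (errorFactor (inflation d c C) m
          * (amplitude d a₀ (L₁ + L₂ + L₃) c C * errorRate f M n T h β))
        + 12 * ((L₁ + m * (2 * a₀ * (L₂ + L₃ / (4 * c))) + w * L₂) * h ^ β) ^ 2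
        + 12 * w ^ 2 * (3 * 3 ^ d * (T / h) ^ d + 10 * (C / c) ^ 2) / (N + 1)
        + (2 * a₀) ^ 2 * (law f).real {x | T ≤ ‖x‖}
      ≤ errorFactor (inflation d c C) (m + 1)
          * (amplitude d a₀ (L₁ + L₂ + L₃) c C * errorRate f M n T h β) := by
  have hτ : 1 ≤ (T / h) ^ d := one_le_pow₀ ((one_le_div hh).2 hhT)
  have fluctuation := fluctuation_le hd (L₁ + L₂ + L₃) c C hw hτ N.cast_nonneg
    (inv_add_one_le_two_mul_div hn hN)
  have bias := mul_le_mul_of_nonneg_right (bias_sq_le (d := d) m hw hL₁ hL₂ hL₃ hc h1)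
    (sq_nonneg (h ^ β))
  have tail := mul_le_mul_of_nonneg_right (sq_le_amplitude d a₀ (L₁ + L₂ + L₃) c C)
    (measureReal_nonneg (μ := law f) (s := {x | T ≤ ‖x‖}))
  have hpow : (h ^ β) ^ 2 = h ^ (2 * β) := by
    rw [mul_comm, Real.rpow_mul hh.le, Real.rpow_two]
  rw [hpow] at bias
  have hY := amplitude_pos d a₀ (L₁ + L₂ + L₃) c C
  have hfluct : 0 ≤ (M : ℝ) / n * (T / h) ^ d := by positivity
  have hbias : 0 ≤ h ^ (2 * β) := by positivity
  have htail : 0 ≤ (law f).real {x | T ≤ ‖x‖} := measureReal_nonneg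
  have recursion := mul_le_mul_of_nonneg_right
    (errorFactor_succ_ge (five_le_inflation hd hc (h1.1.trans h1.2)) m)
    (mul_nonneg hY.le (errorRate_nonneg f M n β hh.le (hh.le.trans hhT)))
  refine le_trans ?_ recursion
  rw [mul_pow _ (h ^ β), hpow]
  have hP : 0 ≤ (1 + m * inflation d c C) ^ 2 := sq_nonneg _
  rw [errorRate]
  generalize amplitude d a₀ (L₁ + L₂ + L₃) c C = Y at *
  generalize (1 + m * inflation d c C) ^ 2 = P at *
  generalize (M : ℝ) / n * (T / h) ^ d = t₁ at *
  generalize h ^ (2 * β) = t₂ at *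
  generalize (law f).real {x | T ≤ ‖x‖} = t₃ at *
  nlinarith [mul_nonneg (mul_nonneg hP hY.le) hfluct, mul_nonneg (mul_nonneg hP hY.le) htail,
    mul_nonneg hY.le hbias, mul_nonneg hY.le htail]

end Constants

section Recursion

theorem aHat_update {D : ℕ → Finset (Fin n)} {M m : ℕ} (hD : IsSplit n M D) (hm : m + 1 ≤ M)
    (r : ∀ S : Finset (Fin d), (S → ℝ) → ℝ) (lam : Finset (Fin d) → ℝ) (T h : ℝ) (a : Pt d → ℝ)
    (Ss : Fin m → Finset (Fin d)) {i : Fin n} (hi : i ∈ D (m + 1)) (z : Fin n → Pt d) (y : Pt d) :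
    aHat r lam T h D (Function.update z i y) a m Ss = aHat r lam T h D z a m Ss := by
  refine aHat_congr r lam T h D a m Ss fun k hk j hj => Function.update_of_ne ?_ _ _
  rintro rfl
  rw [Finset.mem_Icc] at hk
  have disjoint_pieces := hD.disjoint k (Finset.mem_Icc.2 (by omega)) (m + 1)
    (Finset.mem_Icc.2 (by omega)) (by omega)
  exact Finset.disjoint_left.1 disjoint_pieces hj hi

theorem meanLE_norm_tail (μ : Measure (Pt d)) [IsProbabilityMeasure μ] (T : ℝ) {V : ℝ}
    (hV : 0 ≤ V) :
    MeanLE (sampleLaw μ n) (fun p => {x : Pt d | T ≤ ‖x‖}.indicator (fun _ => V) p.1)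
      (V * μ.real {x | T ≤ ‖x‖}) := by
  have tail_measurable : MeasurableSet {x : Pt d | T ≤ ‖x‖} :=
    measurableSet_le measurable_const measurable_norm
  have hm : Measurable ({x : Pt d | T ≤ ‖x‖}.indicator fun _ => V) :=
    measurable_const.indicator tail_measurable
  refine ⟨hm.comp measurable_fst, mul_nonneg hV measureReal_nonneg, le_of_eq ?_⟩
  rw [(measurePreserving_fst (μ := μ) (ν := Measure.pi fun _ : Fin n => μ)).lintegral_comp
    (f := fun x => ENNReal.ofReal ({x : Pt d | T ≤ ‖x‖}.indicator (fun _ => V) x))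
    hm.ennreal_ofReal]
  have ofReal_indicator (x) : ENNReal.ofReal ({x : Pt d | T ≤ ‖x‖}.indicator (fun _ => V) x)
      = {x : Pt d | T ≤ ‖x‖}.indicator (fun _ => ENNReal.ofReal V) x :=
    (Set.indicator_comp_of_zero (g := ENNReal.ofReal) ENNReal.ofReal_zero ▸ rfl)
  simp only [ofReal_indicator]
  rw [lintegral_indicator_const tail_measurable, ENNReal.ofReal_mul hV, ofReal_measureReal]

variable {μ : Measure (Pt d)} [IsProbabilityMeasure μ] {S : Finset (Fin d)} {T V ε : ℝ}

open Classical in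
theorem meanLE_sq_sub_of_eq_or_eq_zero {F v : Pt d × (Fin n → Pt d) → ℝ} {G : Pt d → ℝ}
    (hF : MeanLE (sampleLaw μ n)
      (fun p => if ‖S.restrict p.1‖ ≤ T then (F p - G p.1) ^ 2 else 0) ε)
    (hGm : Measurable G) (hG : ∀ x, |G x| ≤ V) (hvm : Measurable v)
    (hv : ∀ p, ‖S.restrict p.1‖ ≤ T ∧ v p = F p ∨ T ≤ ‖p.1‖ ∧ v p = 0) :
    MeanLE (sampleLaw μ n) (fun p => (v p - G p.1) ^ 2)
      (ε + V ^ 2 * μ.real {x | T ≤ ‖x‖}) := by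
  refine (hF.add (meanLE_norm_tail μ T (sq_nonneg V))).mono
    ((hvm.sub (hGm.comp measurable_fst)).pow_const 2) (fun p => ?_) le_rfl
  rcases hv p with ⟨hp, hvF⟩ | ⟨hp, hv0⟩
  · rw [if_pos hp, hvF]
    exact le_add_of_nonneg_right (Set.indicator_nonneg (fun _ _ => sq_nonneg V) _)
  · rw [Set.indicator_of_mem (show p.1 ∈ {x | T ≤ ‖x‖} from hp), hv0, zero_sub, neg_sq]
    refine le_add_of_nonneg_of_le ?_ (sq_le_sq' (abs_le.1 (hG _)).1 (abs_le.1 (hG _)).2)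
    split_ifs <;> positivity

theorem meanLE_sq_trunc_sub {a : Pt d → ℝ} (ham : Measurable a) (ha : ∀ x, |a x| ≤ V) :
    MeanLE (sampleLaw μ n) (fun p => (trunc T a p.1 - a p.1) ^ 2)
      (V ^ 2 * μ.real {x | T ≤ ‖x‖}) := by
  refine (meanLE_norm_tail μ T (sq_nonneg V)).mono ?_ (fun p => ?_) le_rfl
  · exact ((measurable_trunc T (φ := fun _ => a) (ham.comp measurable_fst)).sub
      (ham.comp measurable_fst)).pow_const 2
  · by_cases hp : ‖p.1‖ ≤ T
    · rw [trunc, if_pos hp, sub_self, zero_pow two_ne_zero]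
      exact Set.indicator_nonneg (fun _ _ => sq_nonneg V) _
    · rw [trunc, if_neg hp, zero_sub, neg_sq,
        Set.indicator_of_mem (show p.1 ∈ {x | T ≤ ‖x‖} from (not_le.1 hp).le)]
      exact sq_le_sq' (abs_le.1 (ha _)).1 (abs_le.1 (ha _)).2

end Recursion

/-- The assumptions on the population quantities, with a common smoothness exponent `β` and a
bound `a₀` for `‖a‖_∞`. -/
structure SmoothProblem (𝕊 : Finset (Finset (Fin d))) (f : Pt d → ℝ)
    (κ : ∀ S : Finset (Fin d), Kernel (S → ℝ) (↥Sᶜ → ℝ)) (r : ∀ S : Finset (Fin d), (S → ℝ) → ℝ)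
    (lam : Finset (Fin d) → ℝ) (a : Pt d → ℝ) (a₀ β L₁ L₂ L₃ c C : ℝ) : Prop where
  isDensity : IsDensity f
  isCondLaw : ∀ S ∈ 𝕊, IsCondLaw f S (κ S)
  lam_pos : ∀ S ∈ 𝕊, 0 < lam S
  abs_le : ∀ x, |a x| ≤ a₀
  exponent_pos : 0 < β
  L₁_nonneg : 0 ≤ L₁
  L₂_nonneg : 0 ≤ L₂
  L₃_nonneg : 0 ≤ L₃
  smooth_a : A1 a β L₁
  smooth_condLaw : A2 𝕊 κ β L₂
  smooth_rBar : A3 𝕊 f r β L₃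
  c_pos : 0 < c
  rBar_mem_Icc : ∀ S ∈ 𝕊, ∀ u, rBar f S (r S) u ∈ Set.Icc c C

namespace SmoothProblem

variable {𝕊 : Finset (Finset (Fin d))} {f : Pt d → ℝ}
  {κ : ∀ S : Finset (Fin d), Kernel (S → ℝ) (↥Sᶜ → ℝ)} {r : ∀ S : Finset (Fin d), (S → ℝ) → ℝ}
  {lam : Finset (Fin d) → ℝ} {a : Pt d → ℝ} {a₀ β L₁ L₂ L₃ c C : ℝ} {S : Finset (Fin d)}

theorem measurable_a (H : SmoothProblem 𝕊 f κ r lam a a₀ β L₁ L₂ L₃ c C) : Measurable a :=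
  (LocHolder.continuous H.smooth_a H.exponent_pos).measurable

theorem measurable_rBar (H : SmoothProblem 𝕊 f κ r lam a a₀ β L₁ L₂ L₃ c C) (hS : S ∈ 𝕊) :
    Measurable (rBar f S (r S)) :=
  (LocHolder.continuous (F := rBar f S (r S)) (H.smooth_rBar S hS) H.exponent_pos).measurable

theorem measurable_r (H : SmoothProblem 𝕊 f κ r lam a a₀ β L₁ L₂ L₃ c C) (S) (hS : S ∈ 𝕊) :
    Measurable (r S) := by
  have integral_ne_zero := integral_ne_zero_of_rBar_pos fun u =>
    H.c_pos.trans_le (H.rBar_mem_Icc S hS u).1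
  convert (H.measurable_rBar hS).mul_const (∫ x, r S (S.restrict x) ∂(law f)) using 2 with u
  exact (div_mul_cancel₀ _ integral_ne_zero).symm

theorem one_mem_Icc (H : SmoothProblem 𝕊 f κ r lam a a₀ β L₁ L₂ L₃ c C) (hS : S ∈ 𝕊) :
    1 ∈ Set.Icc c C :=
  have := H.isDensity.isProbabilityMeasure
  one_mem_Icc_of_rBar_mem_Icc H.c_pos (H.measurable_rBar hS) (H.rBar_mem_Icc S hS)

theorem aBar_mem_Icc_and_locHolder (H : SmoothProblem 𝕊 f κ r lam a a₀ β L₁ L₂ L₃ c C) (m : ℕ)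
    (Ss : Fin m → Finset (Fin d)) (hSs : ∀ j, Ss j ∈ 𝕊) :
    (∃ lo hi, 0 ∈ Set.Icc lo hi ∧ hi - lo ≤ 2 * a₀ ∧
      ∀ x, aBar f r lam κ a m Ss x ∈ Set.Icc lo hi) ∧
    LocHolder (aBar f r lam κ a m Ss) β (L₁ + m * (2 * a₀ * (L₂ + L₃ / (4 * c)))) :=
  have := H.isDensity.isProbabilityMeasure
  exists_aBar_mem_Icc_and_locHolder_aBar (fun S hS => (H.isCondLaw S hS).1) H.lam_pos H.abs_le
    H.exponent_pos H.L₁_nonneg H.L₂_nonneg H.L₃_nonneg H.smooth_a H.smooth_condLaw H.smooth_rBar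
    H.c_pos (fun S hS u => (H.rBar_mem_Icc S hS u).1) m Ss hSs

theorem measurable_aBar (H : SmoothProblem 𝕊 f κ r lam a a₀ β L₁ L₂ L₃ c C) (m : ℕ)
    (Ss : Fin m → Finset (Fin d)) (hSs : ∀ j, Ss j ∈ 𝕊) : Measurable (aBar f r lam κ a m Ss) :=
  ((H.aBar_mem_Icc_and_locHolder m Ss hSs).2.continuous H.exponent_pos).measurable

theorem abs_aBar_le (H : SmoothProblem 𝕊 f κ r lam a a₀ β L₁ L₂ L₃ c C) (m : ℕ)
    (Ss : Fin m → Finset (Fin d)) (hSs : ∀ j, Ss j ∈ 𝕊) (x : Pt d) :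
    |aBar f r lam κ a m Ss x| ≤ 2 * a₀ := by
  obtain ⟨⟨lo, hi, h0, hwidth, hrange⟩, -⟩ := H.aBar_mem_Icc_and_locHolder m Ss hSs
  rw [_root_.abs_le]
  constructor <;> linarith [(hrange x).1, (hrange x).2, h0.1, h0.2]

variable {M m : ℕ} {D : ℕ → Finset (Fin n)} {T h ε : ℝ}

open Classical in
theorem meanLE_sq_aHat_sub_aBar_succ (H : SmoothProblem 𝕊 f κ r lam a a₀ β L₁ L₂ L₃ c C)
    (hD : IsSplit n M D) (hm : m + 1 ≤ M) (hh : h ∈ Set.Ioc 0 1) (hhT : h ≤ T)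
    (Ss : Fin (m + 1) → Finset (Fin d)) (hSs : ∀ j, Ss j ∈ 𝕊)
    (hprev : MeanLE (sampleLaw (law f) n) (fun p =>
      (trunc T (aHat r lam T h D p.2 a m fun j => Ss j.castSucc) p.1
        - aBar f r lam κ a m (fun j => Ss j.castSucc) p.1) ^ 2) ε) :
    ∃ w ∈ Set.Icc 0 (2 * a₀), MeanLE (sampleLaw (law f) n)
      (fun p => if ‖(Ss (Fin.last m)).restrict p.1‖ ≤ T then
        (aHat r lam T h D p.2 a (m + 1) Ss p.1 - aBar f r lam κ a (m + 1) Ss p.1) ^ 2 else 0)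
      (3 * inflation d c C * ε
        + 12 * ((L₁ + m * (2 * a₀ * (L₂ + L₃ / (4 * c))) + w * L₂) * h ^ β) ^ 2
        + 12 * w ^ 2 * (3 * 3 ^ d * (T / h) ^ d + 10 * (C / c) ^ 2) / ((D (m + 1)).card + 1)) := by
  have := H.isDensity.isProbabilityMeasure
  have hS : Ss (Fin.last m) ∈ 𝕊 := hSs _
  have hSs' : ∀ j : Fin m, Ss j.castSucc ∈ 𝕊 := fun j => hSs _
  have : IsMarkovKernel (κ (Ss (Fin.last m))) := (H.isCondLaw _ hS).1
  have ha₀ : 0 ≤ a₀ := (abs_nonneg _).trans (H.abs_le 0)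
  obtain ⟨⟨lo, hi, h0, hwidth, hrange⟩, holder⟩ := H.aBar_mem_Icc_and_locHolder m _ hSs'
  have width_nonneg : 0 ≤ hi - lo := sub_nonneg.2 (h0.1.trans h0.2)
  set ℓ := L₁ + m * (2 * a₀ * (L₂ + L₃ / (4 * c)))
  have hℓ : 0 ≤ ℓ := by
    have := H.L₁_nonneg
    have := H.L₂_nonneg
    have := H.L₃_nonneg
    have := H.c_pos
    positivity
  have smoothing_bias (u u' : Ss (Fin.last m) → ℝ) (hu : ‖u - u'‖ ≤ h) :
      |condMean _ (κ _) (aBar f r lam κ a m fun j => Ss j.castSucc) u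
        - condMean _ (κ _) (aBar f r lam κ a m fun j => Ss j.castSucc) u'|
      ≤ (ℓ + (hi - lo) * L₂) * h ^ β := by
    refine (locHolder_condMean holder H.exponent_pos hℓ hrange (H.smooth_condLaw _ hS) u u'
      (hu.trans hh.2)).trans (mul_le_mul_of_nonneg_left ?_ ?_)
    · exact Real.rpow_le_rpow (norm_nonneg _) hu H.exponent_pos.le
    · exact add_nonneg hℓ (mul_nonneg width_nonneg H.L₂_nonneg)
  exact ⟨hi - lo, ⟨width_nonneg, hwidth⟩, meanLE_sq_stepHat_sub_stepBar (H.isCondLaw _ hS)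
    (H.lam_pos _ hS) H.c_pos (H.measurable_rBar hS) (H.rBar_mem_Icc _ hS)
    (H.measurable_aBar m _ hSs') hrange h0 hh.1 hhT smoothing_bias
    (φ := fun z => aHat r lam T h D z a m fun j => Ss j.castSucc)
    (measurable_aHat H.measurable_r lam T hh.1 D H.measurable_a m _ hSs')
    (fun _ hi z y => aHat_update hD hm r lam T h a _ hi z y) hprev⟩

theorem meanLE_sq_sub_aBar_succ (hd : 2 ≤ d)
    (H : SmoothProblem 𝕊 f κ r lam a a₀ β L₁ L₂ L₃ c C) (hn : 0 < n) (hD : IsSplit n M D)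
    (hh : h ∈ Set.Ioc 0 1) (hhT : h ≤ T) (hm : m + 1 ≤ M) (Ss : Fin (m + 1) → Finset (Fin d))
    (hSs : ∀ j, Ss j ∈ 𝕊)
    (hprev : MeanLE (sampleLaw (law f) n) (fun p =>
      (trunc T (aHat r lam T h D p.2 a m fun j => Ss j.castSucc) p.1
        - aBar f r lam κ a m (fun j => Ss j.castSucc) p.1) ^ 2)
      (errorFactor (inflation d c C) m
        * (amplitude d a₀ (L₁ + L₂ + L₃) c C * errorRate f M n T h β)))
    {v : Pt d × (Fin n → Pt d) → ℝ} (hvm : Measurable v)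
    (hv : ∀ p, ‖(Ss (Fin.last m)).restrict p.1‖ ≤ T ∧ v p = aHat r lam T h D p.2 a (m + 1) Ss p.1
      ∨ T ≤ ‖p.1‖ ∧ v p = 0) :
    MeanLE (sampleLaw (law f) n) (fun p => (v p - aBar f r lam κ a (m + 1) Ss p.1) ^ 2)
      (errorFactor (inflation d c C) (m + 1)
        * (amplitude d a₀ (L₁ + L₂ + L₃) c C * errorRate f M n T h β)) := by
  have := H.isDensity.isProbabilityMeasure
  obtain ⟨w, hw, hstep⟩ := H.meanLE_sq_aHat_sub_aBar_succ hD hm hh hhT Ss hSs hprev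
  have htotal := meanLE_sq_sub_of_eq_or_eq_zero hstep (H.measurable_aBar _ Ss hSs)
    (H.abs_aBar_le _ Ss hSs) hvm hv
  exact htotal.mono htotal.measurable (fun _ => le_rfl)
    (error_succ_le hd m hw H.L₁_nonneg H.L₂_nonneg H.L₃_nonneg H.c_pos (H.one_mem_Icc (hSs 0))
      hh.1 hhT hn (hD.le_two_mul (Finset.mem_Icc.2 (by omega))))

end SmoothProblem

namespace SmoothProblem

variable {𝕊 : Finset (Finset (Fin d))} {f : Pt d → ℝ}
  {κ : ∀ S : Finset (Fin d), Kernel (S → ℝ) (↥Sᶜ → ℝ)} {r : ∀ S : Finset (Fin d), (S → ℝ) → ℝ}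
  {lam : Finset (Fin d) → ℝ} {a : Pt d → ℝ} {a₀ β L₁ L₂ L₃ c C : ℝ} {S : Finset (Fin d)}
  {M m : ℕ} {D : ℕ → Finset (Fin n)} {T h : ℝ}

theorem meanLE_sq_trunc_aHat_sub_aBar (hd : 2 ≤ d)
    (H : SmoothProblem 𝕊 f κ r lam a a₀ β L₁ L₂ L₃ c C) (hn : 0 < n) (hD : IsSplit n M D)
    (hh : h ∈ Set.Ioc 0 1) (hhT : h ≤ T) (hm : m ≤ M) (Ss : Fin m → Finset (Fin d))
    (hSs : ∀ j, Ss j ∈ 𝕊) :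
    MeanLE (sampleLaw (law f) n)
      (fun p => (trunc T (aHat r lam T h D p.2 a m Ss) p.1 - aBar f r lam κ a m Ss p.1) ^ 2)
      (errorFactor (inflation d c C) m
        * (amplitude d a₀ (L₁ + L₂ + L₃) c C * errorRate f M n T h β)) := by
  have := H.isDensity.isProbabilityMeasure
  induction m with
  | zero =>
    have htail := meanLE_sq_trunc_sub (n := n) (μ := law f) (T := T) H.measurable_a H.abs_le
    refine htail.mono htail.measurable (fun _ => le_rfl) ?_
    rw [errorFactor, pow_zero, show (16 * 1 - 15 : ℝ) = 1 by norm_num, one_mul]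
    exact mul_le_mul (sq_le_amplitude _ _ _ _ _)
      (measureReal_le_errorRate f M n β hh.1.le (hh.1.le.trans hhT)) measureReal_nonneg
      (amplitude_pos _ _ _ _ _).le
  | succ m ih =>
    refine H.meanLE_sq_sub_aBar_succ hd hn hD hh hhT hm Ss hSs
      (ih (Nat.le_of_succ_le hm) _ fun _ => hSs _)
      (measurable_trunc T (φ := fun z => aHat r lam T h D z a (m + 1) Ss)
        (measurable_aHat H.measurable_r lam T hh.1 D H.measurable_a (m + 1) Ss hSs)) fun p => ?_
    by_cases hp : ‖p.1‖ ≤ T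
    · exact .inl ⟨(norm_restrict_le _ _).trans hp, if_pos hp⟩
    · exact .inr ⟨(not_le.1 hp).le, if_neg hp⟩

theorem meanLE_sq_aHat_sub_aBar (hd : 2 ≤ d)
    (H : SmoothProblem 𝕊 f κ r lam a a₀ β L₁ L₂ L₃ c C) (hn : 0 < n) (hD : IsSplit n M D)
    (hh : h ∈ Set.Ioc 0 1) (hhT : h ≤ T) (hm : m + 1 ≤ M) (Ss : Fin (m + 1) → Finset (Fin d))
    (hSs : ∀ j, Ss j ∈ 𝕊) :
    MeanLE (sampleLaw (law f) n)
      (fun p => (aHat r lam T h D p.2 a (m + 1) Ss p.1 - aBar f r lam κ a (m + 1) Ss p.1) ^ 2)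
      (errorFactor (inflation d c C) (m + 1)
        * (amplitude d a₀ (L₁ + L₂ + L₃) c C * errorRate f M n T h β)) := by
  refine H.meanLE_sq_sub_aBar_succ hd hn hD hh hhT hm Ss hSs
    (H.meanLE_sq_trunc_aHat_sub_aBar hd hn hD hh hhT (Nat.le_of_succ_le hm) _ fun _ => hSs _)
    (measurable_aHat H.measurable_r lam T hh.1 D H.measurable_a (m + 1) Ss hSs) fun p => ?_
  by_cases hp : ‖(Ss (Fin.last m)).restrict p.1‖ ≤ T
  · exact .inl ⟨hp, rfl⟩
  · exact .inr ⟨(not_le.1 hp).le.trans (norm_restrict_le _ _), aHat_succ_eq_zero _ _ _ _ _ _ _ hp⟩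

theorem meanLE_sq_alphaHat_sub_alpha (hd : 2 ≤ d)
    (H : SmoothProblem 𝕊 f κ r lam a a₀ β L₁ L₂ L₃ c C) (hn : 0 < n) (hD : IsSplit n M D)
    (hh : h ∈ Set.Ioc 0 1) (hhT : h ≤ T) (hS : S ∈ 𝕊) :
    MeanLE (sampleLaw (law f) n)
      (fun p => (alphaHat 𝕊 r lam T h D p.2 a (𝕊.card : ℝ)⁻¹ M S p.1
        - alpha 𝕊 f r lam κ a (𝕊.card : ℝ)⁻¹ M S p.1) ^ 2)
      ((28 * inflation d c C) ^ M
        * (16 * (amplitude d a₀ (L₁ + L₂ + L₃) c C * errorRate f M n T h β))) := by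
  set Y := amplitude d a₀ (L₁ + L₂ + L₃) c C * errorRate f M n T h β
  set q := 14 * inflation d c C - 1 with hq
  have hY : 0 ≤ Y := mul_nonneg (amplitude_pos _ _ _ _ _).le
    (errorRate_nonneg f M n β hh.1.le (hh.1.le.trans hhT))
  have hq_nonneg : 0 ≤ q := by
    have h1 := H.one_mem_Icc hS
    linarith [five_le_inflation hd H.c_pos (h1.1.trans h1.2)]
  simp only [alphaHat_sub_alpha]
  rw [show 28 * inflation d c C = 2 * (1 + q) by rw [hq]; ring]
  refine MeanLE.sq_sum_paths hS hq_nonneg (mul_nonneg (by norm_num) hY) (fun s hs => ?_)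
    fun s hs => ?_
  · have hSs := mem_of_mem_paths (Finset.mem_sigma.1 hs).2
    exact ((measurable_aHat H.measurable_r lam T hh.1 D H.measurable_a _ _ hSs).sub
      ((H.measurable_aBar _ _ hSs).comp measurable_fst)).const_mul _
  · obtain ⟨hm, hpath⟩ := Finset.mem_sigma.1 hs
    have herr := H.meanLE_sq_aHat_sub_aBar hd hn hD hh hhT (Finset.mem_range.1 hm) s.2
      (mem_of_mem_paths hpath)
    simp only [mul_pow, ← pow_mul, mul_comm s.1 2, pow_mul _ 2, neg_one_sq, one_pow, one_mul]
    refine herr.mono herr.measurable (fun _ => le_rfl) ?_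
    exact (mul_le_mul_of_nonneg_right (sub_le_self _ (by norm_num)) hY).trans_eq (by ring)

end SmoothProblem

theorem A2.mono_exponent {𝕊 : Finset (Finset (Fin d))}
    {κ : ∀ S : Finset (Fin d), Kernel (S → ℝ) (↥Sᶜ → ℝ)} {β β' L : ℝ} (hA2 : A2 𝕊 κ β L)
    (hL : 0 ≤ L) (hβ' : 0 ≤ β') (h : β' ≤ β) : A2 𝕊 κ β' L := fun S hS u u' hu =>
  (hA2 S hS u u' hu).trans (mul_le_mul_of_nonneg_left
    (Real.rpow_le_rpow_of_exponent_ge' (norm_nonneg _) hu hβ' h) hL)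

theorem lintegral_lintegral_eq_lintegral_sampleLaw {E Ω : Type*} [MeasurableSpace E]
    [MeasurableSpace Ω] {μ : Measure E} [IsProbabilityMeasure μ] {P : Measure Ω}
    [IsProbabilityMeasure P] {X : Fin n → Ω → E} (hX : ∀ i, HasLaw (X i) μ P)
    (hindep : iIndepFun X P) {G : E × (Fin n → E) → ℝ≥0∞} (hG : Measurable G) :
    ∫⁻ ω, ∫⁻ x, G (x, fun i => X i ω) ∂μ ∂P = ∫⁻ p, G p ∂(sampleLaw μ n) := by
  have law_sample : P.map (fun ω i => X i ω) = Measure.pi fun _ : Fin n => μ := by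
    rw [(iIndepFun_iff_map_fun_eq_pi_map fun i => (hX i).aemeasurable).1 hindep]
    simp only [fun i => (hX i).map_eq]
  rw [lintegral_prod_symm _ hG.aemeasurable, ← law_sample,
    lintegral_map' hG.lintegral_prod_left'.aemeasurable
      (aemeasurable_pi_lambda _ fun i => (hX i).aemeasurable)]

end

end IncompleteData

theorem proposition7_general {d : ℕ} (hd : 2 ≤ d)
    (𝕊 : Finset (Finset (Fin d)))
    (f : Pt d → ℝ) (hf : IsDensity f)
    (κ : ∀ S : Finset (Fin d), Kernel (S → ℝ) (↥Sᶜ → ℝ))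
    (hκ : ∀ S ∈ 𝕊, IsCondLaw f S (κ S))
    (r : ∀ S : Finset (Fin d), (S → ℝ) → ℝ)
    (lam : Finset (Fin d) → ℝ) (hlam : ∀ S ∈ 𝕊, 0 < lam S)
    (a : Pt d → ℝ) (ha : BddAbove (Set.range fun x => |a x|))
    (β₁ β₂ β₃ L₁ L₂ L₃ c C : ℝ)
    (hβ₁ : 0 < β₁) (hβ₂ : 0 < β₂) (hβ₃ : 0 < β₃) (hL₁ : 0 ≤ L₁) (hL₂ : 0 ≤ L₂) (hL₃ : 0 ≤ L₃)
    (hA1 : A1 a β₁ L₁) (hA2 : A2 𝕊 κ β₂ L₂) (hA3 : A3 𝕊 f r β₃ L₃)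
    (hc : 0 < c)
    (hrBar : ∀ S ∈ 𝕊, ∀ u, c ≤ rBar f S (r S) u ∧ rBar f S (r S) u ≤ C)
    {Ω : Type*} [MeasurableSpace Ω] (P : Measure Ω) [IsProbabilityMeasure P]
    (n : ℕ) (hn : 0 < n) (X : Fin n → Ω → Pt d)
    (hX : ∀ i, HasLaw (X i) (law f) P) (hindep : iIndepFun X P)
    (M : ℕ) (D : ℕ → Finset (Fin n)) (hD : IsSplit n M D)
    (T h : ℝ) (hhT : h ≤ T) (hh : h ∈ Set.Ioc (0 : ℝ) 1)
    (S : Finset (Fin d)) (hS : S ∈ 𝕊) :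
    ∫⁻ ω, ∫⁻ x, ENNReal.ofReal
        ((alphaHat 𝕊 r lam T h D (fun i => X i ω) a (𝕊.card : ℝ)⁻¹ M S x
          - alpha 𝕊 f r lam κ a (𝕊.card : ℝ)⁻¹ M S x) ^ 2) ∂(law f) ∂P
      ≤ ENNReal.ofReal
        ((28 * (C / c + 2 ^ d)) ^ M
          * (16 * max ((⨆ x, |a x|) ^ 2) 1
              * max ((C / c) ^ 2) (max ((L₁ + L₂ + L₃) ^ 2) (8 ^ d)))
          * ((M : ℝ) / n * (T / h) ^ d + h ^ (2 * min β₁ (min β₂ β₃))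
              + (law f).real {x | T ≤ ‖x‖})) := by
  set β := min β₁ (min β₂ β₃)
  have hβ : 0 < β := lt_min hβ₁ (lt_min hβ₂ hβ₃)
  have H : SmoothProblem 𝕊 f κ r lam a (⨆ x, |a x|) β L₁ L₂ L₃ c C :=
    { isDensity := hf
      isCondLaw := hκ
      lam_pos := hlam
      abs_le := le_ciSup ha
      exponent_pos := hβ
      L₁_nonneg := hL₁
      L₂_nonneg := hL₂
      L₃_nonneg := hL₃
      smooth_a := LocHolder.mono_exponent hA1 hL₁ hβ.le (min_le_left _ _)
      smooth_condLaw := A2.mono_exponent hA2 hL₂ hβ.le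
        ((min_le_right _ _).trans (min_le_left _ _))
      smooth_rBar := fun S hS => LocHolder.mono_exponent (F := rBar f S (r S)) (hA3 S hS) hL₃
        hβ.le ((min_le_right _ _).trans (min_le_right _ _))
      c_pos := hc
      rBar_mem_Icc := hrBar }
  have := hf.isProbabilityMeasure
  have hrisk := H.meanLE_sq_alphaHat_sub_alpha hd hn hD hh hhT hS
  rw [lintegral_lintegral_eq_lintegral_sampleLaw hX hindep hrisk.measurable.ennreal_ofReal]
  refine hrisk.le.trans (ENNReal.ofReal_le_ofReal (le_of_eq ?_))
  rw [inflation, amplitude, errorRate]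
  ring

theorem proposition7 {d : ℕ} (hd : 2 ≤ d)
    (𝕊 : Finset (Finset (Fin d))) (h𝕊 : Finset.univ ∉ 𝕊)
    (f : Pt d → ℝ) (hf : IsDensity f)
    (κ : ∀ S : Finset (Fin d), Kernel (S → ℝ) (↥Sᶜ → ℝ))
    (hκ : ∀ S ∈ 𝕊, IsCondLaw f S (κ S))
    (r : ∀ S : Finset (Fin d), (S → ℝ) → ℝ) (hr : ∀ S ∈ 𝕊, ∀ u, 0 < r S u)
    (lam : Finset (Fin d) → ℝ) (hlam : ∀ S ∈ 𝕊, 0 < lam S)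
    (a : Pt d → ℝ) (ha : BddAbove (Set.range fun x => |a x|))
    (β₁ β₂ β₃ L₁ L₂ L₃ c C : ℝ)
    (hβ₁ : β₁ ∈ Set.Ioc (0 : ℝ) 1) (hβ₂ : β₂ ∈ Set.Ioc (0 : ℝ) 1)
    (hβ₃ : β₃ ∈ Set.Ioc (0 : ℝ) 1)
    (hL₁ : 0 < L₁) (hL₂ : 0 < L₂) (hL₃ : 0 < L₃)
    (hA1 : A1 a β₁ L₁) (hA2 : A2 𝕊 κ β₂ L₂) (hA3 : A3 𝕊 f r β₃ L₃)
    (hc : 0 < c)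
    (hrBar : ∀ S ∈ 𝕊, ∀ u, c ≤ rBar f S (r S) u ∧ rBar f S (r S) u ≤ C)
    {Ω : Type*} [MeasurableSpace Ω] (P : Measure Ω) [IsProbabilityMeasure P]
    (n : ℕ) (hn : 0 < n) (X : Fin n → Ω → Pt d)
    (hX : ∀ i, HasLaw (X i) (law f) P) (hindep : iIndepFun X P)
    (M : ℕ) (hM : 1 ≤ M) (D : ℕ → Finset (Fin n)) (hD : IsSplit n M D)
    (T h : ℝ) (hT : 1 ≤ T) (hh : h ∈ Set.Ioo (0 : ℝ) 1)
    (S : Finset (Fin d)) (hS : S ∈ 𝕊) :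
    ∫⁻ ω, ∫⁻ x, ENNReal.ofReal
        ((alphaHat 𝕊 r lam T h D (fun i => X i ω) a (𝕊.card : ℝ)⁻¹ M S x
          - alpha 𝕊 f r lam κ a (𝕊.card : ℝ)⁻¹ M S x) ^ 2) ∂(law f) ∂P
      ≤ ENNReal.ofReal
        ((28 * (C / c + 2 ^ d)) ^ M
          * (16 * max ((⨆ x, |a x|) ^ 2) 1
              * max ((C / c) ^ 2) (max ((L₁ + L₂ + L₃) ^ 2) (8 ^ d)))
          * ((M : ℝ) / n * (T / h) ^ d + h ^ (2 * min β₁ (min β₂ β₃))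
              + (law f).real {x | T ≤ ‖x‖})) :=
  proposition7_general hd 𝕊 f hf κ hκ r lam hlam a ha β₁ β₂ β₃ L₁ L₂ L₃ c C hβ₁.1 hβ₂.1 hβ₃.1
    hL₁.le hL₂.le hL₃.le hA1 hA2 hA3 hc hrBar P n hn X hX hindep M D hD T h (hh.2.le.trans hT)
    ⟨hh.1, hh.2.le⟩ S hS
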